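/- **Setting.** Let $u_0<u_S<u_1$ and $v_0<v_1$, and let $v_*:[u_S,u_1]\to\mathbb R$ be continuous and strictly decreasing with $v_*(u_S)=v_1$ and $v_*(u_1)>v_0$. Put $$\mathcal D=\{(u,v)\in[u_0,u_1]\times[v_0,v_1]:\ u<u_S\ \text{or}\ v<v_*(u)\},\qquad \mathcal S=\{(u,v_*(u)):u_S\le u\le u_1\},\qquad \bar{\mathcal D}=\mathcal D\cup\mathcal S .$$ Let $Q\neq0$ be a constant and let $(r,\Omega^2,\phi)$, with $r,\Omega^2>0$, be $C^2$ functions on $\mathcal D$ solving the spherically symmetric Einstein–Maxwell–scalar field system $$\partial_u(-\Omega^{-2}\partial_u r)=\Omega^{-2}r(\partial_u\phi)^2,\qquad \partial_v(-\Omega^{-2}\partial_v r)=\Omega^{-2}r(\partial_v\phi)^2,$$ $$\partial_u\partial_v r=-\frac{\Omega^2}{4r}-\frac{\partial_u r\,\partial_v r}{r}+\frac{\Omega^2Q^2}{4r^3},\qquad \partial_u\partial_v\log\Omega^2=\frac{\Omega^2}{2r^2}+\frac{2\partial_u r\,\partial_v r}{r^2}-\frac{\Omega^2Q^2}{r^4}-2\partial_u\phi\,\partial_v\phi,$$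 $$\partial_u\partial_v\phi=-\frac{\partial_u r\,\partial_v\phi}{r}-\frac{\partial_v r\,\partial_u\phi}{r},$$ for the metric $g=-\Omega^2\,du\,dv+r^2\,d\sigma_{\mathbb S^2}$, the scalar field $\phi$ and the Maxwell field $F=\frac{Q}{2r^2}\Omega^2\,du\wedge dv$. Suppose that the data on $C_0=\{u=u_0\}$ and $\underline C_0=\{v=v_0\}$ are trapped ($\partial_u r,\partial_v r<0$) and in the gauge $\partial_v r=-1$ on $C_0$, $\partial_u r=-1$ on $\underline C_0$, and that the development $\mathcal D$ terminates at the spacelike singularity $\mathcal S$: $r$ extends continuously by $0$ to $\mathcal S$. Let $R_0>0$ and $\alpha\in(0,1)$, and assume that everywhere in $\mathcal D$ $$\text{(QTS)}\quad \min\{-r\partial_v r,\,-r\partial_u r\}\ge R_0,\qquad \text{(SKE)}\quad \min\{|r^2L\phi|^2,\,|r^2\underline L\phi|^2\}\ge1+\alpha,$$ where $L=\frac{1}{-r\partial_v r}\partial_v$ and $\underline L=\frac{1}{-r\partial_u r}\partial_u$. Write $r_0=r(u_0,v_0)$, $\beta=\alpha/2$ and $\ell(r)=1+|\log r|$. A function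 $f$ on $\mathcal D$ is $C^{0,\beta}$ (resp. $C^{0,\beta,\log}$) if it is bounded and, along every segment in $\mathcal D$ of length $h>0$ on which $u$ or $v$ is constant, the difference of its end values is at most $Ch^\beta$ (resp. $Ch^\beta(1+|\log h|)$), with $C$ independent of the segment; it is $C^{1,\beta}$ if it is $C^1$ with $\partial_uf,\partial_vf$ both $C^{0,\beta}$. **Theorem.** Under these assumptions: (I) $r^2$ is $C^{1,\beta}$ in $\mathcal D$; there is $R_1>R_0$ with $R_0\le-r\partial_u r\le R_1$ and $R_0\le-r\partial_v r\le R_1$ in $\mathcal D$; the function $v_*$ is $C^{1,\beta}$ on $[u_S,u_1]$, so that $\mathcal S$ is a $C^{1,\beta}$ curve; and $-r\partial_ur$, $-r\partial_vr$ have limits $C_u(p)$, $C_v(p)$ at every $p\in\mathcal S$. There are functions $\Psi,\Xi,\mathfrak M$, continuous on $\bar{\mathcal D}$, with values $\Psi_\infty(p),\Xi_\infty(p),\mathfrak M_\infty(p)$ at $p\in\mathcal S$, such that: (II) $\Psi$ is $C^{0,\beta}$ and $\Xi$ is $C^{0,\beta,\log}$ in $\mathcal D$, and $\phi=\Psi\log(r_0/r)+\Xi$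 in $\mathcal D$. (III) $\mathfrak M$ is $C^{0,\beta,\log}$ in $\mathcal D$ and positive on $\bar{\mathcal D}$, and $4\Omega^{-2}\partial_ur\,\partial_vr=\mathfrak M\,(r/r_0)^{-(\Psi^2+1)}$ in $\mathcal D$. For every $p=(u_p,v_*(u_p))\in\mathcal S$ there is a constant $D>0$ such that, at every point of $J^-(p)=\{(u,v)\in\mathcal D:u\le u_p,\ v\le v_*(u_p)\}$ and with $C_u,C_v,\Psi_\infty,\Xi_\infty,\mathfrak M_\infty$ evaluated at $p$: (IV) $$|-r\partial_ur-C_u|\le Dr^\alpha,\quad|-r\partial_vr-C_v|\le Dr^\alpha,\quad|r^2\partial_u\phi-C_u\Psi_\infty|\le Dr^\alpha,\quad|r^2\partial_v\phi-C_v\Psi_\infty|\le Dr^\alpha,$$ $$\Big|\phi-\Psi_\infty\log\frac{r_0}{r}-\Xi_\infty\Big|\le Dr^\alpha\,\ell(r),\qquad\Big|\Omega^2-\frac{4C_uC_v}{r_0^2}\mathfrak M_\infty^{-1}\Big(\frac r{r_0}\Big)^{\Psi_\infty^2-1}\Big|\le Dr^{\Psi_\infty^2-1+\alpha}\,\ell(r).$$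 (V) For the Hawking mass $m$, defined by $1-\frac{2m}{r}=g(\nabla r,\nabla r)$, the Kretschmann scalar and the scalar field, $$\Big|2m-\mathfrak M_\infty r_0\Big(\frac{r_0}{r}\Big)^{\Psi_\infty^2}\Big|\le Dr^{-\Psi_\infty^2+\alpha}\,\ell(r),$$ $$\Big|\mathrm{Riem}_{\alpha\beta\gamma\delta}\mathrm{Riem}^{\alpha\beta\gamma\delta}-\mathfrak M_\infty^2\Big(\frac{r_0}{r}\Big)^{2(\Psi_\infty^2+3)}\frac{4(3-2\Psi_\infty^2+2\Psi_\infty^4)}{r_0^4}\Big|\le Dr^{-2\Psi_\infty^2-6+\alpha}\,\ell(r),$$ $$\Big|\nabla_\alpha\phi\nabla^\alpha\phi+\frac{\mathfrak M_\infty\Psi_\infty^2}{r_0^2}\Big(\frac{r_0}{r}\Big)^{\Psi_\infty^2+3}\Big|\le Dr^{-\Psi_\infty^2-3+\alpha}\,\ell(r).$$ In addition, $F_{\mu\nu}F^{\mu\nu}=-2Q^2/r^4$ in $\mathcal D$. -/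

import Mathlib

open Set Filter Topology

noncomputable section

namespace EMSF

/-! ### Geometry of spacetime in a coordinate chart -/

/-- The partial derivative of `f` in the `i`-th coordinate at a point `x` of the region `U`. It is
taken along the coordinate line through `x` inside `U`, hence it is one-sided at those boundary
points of the region that belong to the region. -/
def coordDeriv (U : Set (Fin 4 → ℝ)) (i : Fin 4) (f : (Fin 4 → ℝ) → ℝ) (x : Fin 4 → ℝ) : ℝ :=
  derivWithin (fun s => f (Function.update x i s)) {s | Function.update x i s ∈ U} (x i)

/-- Christoffel symbols `Γ^k_{ij}` of the metric with components `g`. -/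
def christoffel (U : Set (Fin 4 → ℝ)) (g : (Fin 4 → ℝ) → Matrix (Fin 4) (Fin 4) ℝ)
    (k i j : Fin 4) (x : Fin 4 → ℝ) : ℝ :=
  (1 / 2) * ∑ l, (g x)⁻¹ k l *
    (coordDeriv U i (fun y => g y j l) x + coordDeriv U j (fun y => g y i l) x
      - coordDeriv U l (fun y => g y i j) x)

/-- The components `R^a_{bcd} = ∂_c Γ^a_{db} - ∂_d Γ^a_{cb} + Γ^a_{ce} Γ^e_{db} - Γ^a_{de} Γ^e_{cb}`
of the Riemann tensor. -/
def riemannUp (U : Set (Fin 4 → ℝ)) (g : (Fin 4 → ℝ) → Matrix (Fin 4) (Fin 4) ℝ)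
    (a b c d : Fin 4) (x : Fin 4 → ℝ) : ℝ :=
  coordDeriv U c (christoffel U g a d b) x - coordDeriv U d (christoffel U g a c b) x
    + ∑ e, (christoffel U g a c e x * christoffel U g e d b x
      - christoffel U g a d e x * christoffel U g e c b x)

/-- The components `R_{abcd}` of the Riemann tensor with all indices lowered. -/
def riemann (U : Set (Fin 4 → ℝ)) (g : (Fin 4 → ℝ) → Matrix (Fin 4) (Fin 4) ℝ)
    (a b c d : Fin 4) (x : Fin 4 → ℝ) : ℝ :=
  ∑ e, g x a e * riemannUp U g e b c d x

/-- The Kretschmann scalar `R_{abcd} R^{abcd}`. -/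
def kretschmann (U : Set (Fin 4 → ℝ)) (g : (Fin 4 → ℝ) → Matrix (Fin 4) (Fin 4) ℝ)
    (x : Fin 4 → ℝ) : ℝ :=
  ∑ a, ∑ b, ∑ c, ∑ d, riemann U g a b c d x *
    ∑ a', ∑ b', ∑ c', ∑ d', (g x)⁻¹ a a' * (g x)⁻¹ b b' * (g x)⁻¹ c c' * (g x)⁻¹ d d' *
      riemann U g a' b' c' d' x

/-- The squared gradient `g(∇f, ∇f) = ∇_a f ∇^a f`. -/
def gradSq (U : Set (Fin 4 → ℝ)) (g : (Fin 4 → ℝ) → Matrix (Fin 4) (Fin 4) ℝ)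
    (f : (Fin 4 → ℝ) → ℝ) (x : Fin 4 → ℝ) : ℝ :=
  ∑ a, ∑ b, (g x)⁻¹ a b * coordDeriv U a f x * coordDeriv U b f x

/-- The full contraction `F_{ab} F^{ab}` of a covariant 2-tensor. -/
def tensorSq (g F : (Fin 4 → ℝ) → Matrix (Fin 4) (Fin 4) ℝ) (x : Fin 4 → ℝ) : ℝ :=
  ∑ a, ∑ b, F x a b * ∑ c, ∑ d, (g x)⁻¹ a c * (g x)⁻¹ b d * F x c d

/-! ### Spherically symmetric fields in double null coordinates

Points of spacetime have coordinates `(u, v, θ, ϕ)`, where `(u, v)` lies in a planar region `D` and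
`θ ∈ (0, π)`, `ϕ` are polar coordinates on the round sphere. -/

/-- The chart over `D`. -/
def chart (D : Set (ℝ × ℝ)) : Set (Fin 4 → ℝ) :=
  {x | (x 0, x 1) ∈ D ∧ x 2 ∈ Ioo 0 Real.pi}

/-- A function of `(u, v)`, seen as a function on spacetime. -/
def lift (f : ℝ × ℝ → ℝ) (x : Fin 4 → ℝ) : ℝ := f (x 0, x 1)

/-- The metric `g = - Ω² du dv + r² (dθ² + sin² θ dϕ²)`; `W` stands for `Ω²`. -/
def metric (r W : ℝ × ℝ → ℝ) (x : Fin 4 → ℝ) : Matrix (Fin 4) (Fin 4) ℝ :=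
  !![0, -(lift W x) / 2, 0, 0;
     -(lift W x) / 2, 0, 0, 0;
     0, 0, (lift r x) ^ 2, 0;
     0, 0, 0, (lift r x) ^ 2 * Real.sin (x 2) ^ 2]

/-- The Maxwell field `F = (Q / (2 r²)) Ω² du ∧ dv`. -/
def maxwell (Q : ℝ) (r W : ℝ × ℝ → ℝ) (x : Fin 4 → ℝ) : Matrix (Fin 4) (Fin 4) ℝ :=
  !![0, Q / (2 * lift r x ^ 2) * lift W x, 0, 0;
     -(Q / (2 * lift r x ^ 2) * lift W x), 0, 0, 0;
     0, 0, 0, 0;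
     0, 0, 0, 0]

/-- The Hawking mass `m`, given by `1 - 2 m / r = g(∇r, ∇r)`. -/
def hawkingMass (D : Set (ℝ × ℝ)) (r W : ℝ × ℝ → ℝ) (x : Fin 4 → ℝ) : ℝ :=
  lift r x / 2 * (1 - gradSq (chart D) (metric r W) (lift r) x)

/-- `∂_u f` on the planar region `D` (one-sided at boundary points belonging to `D`). -/
def du (D : Set (ℝ × ℝ)) (f : ℝ × ℝ → ℝ) (p : ℝ × ℝ) : ℝ :=
  derivWithin (fun s => f (s, p.2)) {s | (s, p.2) ∈ D} p.1

/-- `∂_v f` on the planar region `D` (one-sided at boundary points belonging to `D`). -/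
def dv (D : Set (ℝ × ℝ)) (f : ℝ × ℝ → ℝ) (p : ℝ × ℝ) : ℝ :=
  derivWithin (fun s => f (p.1, s)) {s | (p.1, s) ∈ D} p.2

/-- The outgoing null derivative `L f = (- r ∂_v r)⁻¹ ∂_v f`. -/
def outL (D : Set (ℝ × ℝ)) (r f : ℝ × ℝ → ℝ) (p : ℝ × ℝ) : ℝ :=
  dv D f p / (-(r p) * dv D r p)

/-- The ingoing null derivative `L̲ f = (- r ∂_u r)⁻¹ ∂_u f`. -/
def inL (D : Set (ℝ × ℝ)) (r f : ℝ × ℝ → ℝ) (p : ℝ × ℝ) : ℝ :=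
  du D f p / (-(r p) * du D r p)

/-- `(r, W, φ)`, with `W = Ω²`, is a classical solution in `D` of the spherically symmetric
Einstein-Maxwell-scalar field system with constant charge `Q`. -/
structure IsSolution (D : Set (ℝ × ℝ)) (Q : ℝ) (r W φ : ℝ × ℝ → ℝ) : Prop where
  contDiff_r : ContDiffOn ℝ 2 r D
  contDiff_W : ContDiffOn ℝ 2 W D
  contDiff_φ : ContDiffOn ℝ 2 φ D
  r_pos : ∀ p ∈ D, 0 < r p
  W_pos : ∀ p ∈ D, 0 < W p
  /-- Raychaudhuri equation in `u`. -/
  raych_u : ∀ p ∈ D, du D (fun q => -(W q)⁻¹ * du D r q) p = (W p)⁻¹ * r p * (du D φ p) ^ 2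
  /-- Raychaudhuri equation in `v`. -/
  raych_v : ∀ p ∈ D, dv D (fun q => -(W q)⁻¹ * dv D r q) p = (W p)⁻¹ * r p * (dv D φ p) ^ 2
  /-- Propagation equation for `r`. -/
  wave_r : ∀ p ∈ D, du D (dv D r) p =
    -(W p) / (4 * r p) - du D r p * dv D r p / r p + W p / (4 * r p ^ 3) * Q ^ 2
  /-- Propagation equation for `Ω²`. -/
  wave_W : ∀ p ∈ D, du D (dv D (fun q => Real.log (W q))) p =
    W p / (2 * r p ^ 2) + 2 * du D r p * dv D r p / r p ^ 2 - W p / r p ^ 4 * Q ^ 2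
      - 2 * du D φ p * dv D φ p
  /-- Wave equation for the scalar field. -/
  wave_φ : ∀ p ∈ D, du D (dv D φ) p =
    -(du D r p * dv D φ p / r p) - dv D r p * du D φ p / r p

/-! ### The domain of a strongly singular development -/

/-- A characteristic rectangle `[u₀, u₁] × [v₀, v₁]` together with a strictly decreasing continuous
curve `v = vs u`, `uS ≤ u ≤ u₁`, that leaves the rectangle at `(uS, v₁)` and meets the edge `u = u₁`
strictly above the initial edge `v = v₀`. Thus `uS` is what is usually written `vs⁻¹(v₁)`. -/
structure SingularRegion where
  u₀ : ℝ
  u₁ : ℝ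
  v₀ : ℝ
  v₁ : ℝ
  uS : ℝ
  vs : ℝ → ℝ
  hu₀ : u₀ < uS
  hu₁ : uS < u₁
  continuousOn_vs : ContinuousOn vs (Icc uS u₁)
  strictAntiOn_vs : StrictAntiOn vs (Icc uS u₁)
  vs_uS : vs uS = v₁
  vs_u₁ : v₀ < vs u₁

/-- The part of the rectangle that lies strictly below (to the past of) the curve. -/
def SingularRegion.D (G : SingularRegion) : Set (ℝ × ℝ) :=
  {p | p.1 ∈ Icc G.u₀ G.u₁ ∧ p.2 ∈ Icc G.v₀ G.v₁ ∧ (p.1 < G.uS ∨ p.2 < G.vs p.1)}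

/-- The point of the curve over `u`. -/
def SingularRegion.pt (G : SingularRegion) (u : ℝ) : ℝ × ℝ := (u, G.vs u)

/-- The curve `S`, the future boundary of `D`. -/
def SingularRegion.S (G : SingularRegion) : Set (ℝ × ℝ) := G.pt '' Icc G.uS G.u₁

/-- The causal past `J⁻(p)`. -/
def SingularRegion.past (G : SingularRegion) (p : ℝ × ℝ) : Set (ℝ × ℝ) :=
  {q ∈ G.D | q.1 ≤ p.1 ∧ q.2 ≤ p.2}

/-- `(r, W, φ)` is a development, in the domain `G.D`, of trapped characteristic data on the two
initial null segments, in the gauge `∂_v r = -1` on `u = u₀` and `∂_u r = -1` on `v = v₀`, which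
terminates at the spacelike singularity `G.S`, where `r` extends continuously to `0`.
Since `r` tends to `0` at every point of `G.S`, no larger development exists: `G.D` is the domain
of the maximal future development of the data. -/
structure IsStronglySingular (G : SingularRegion) (Q : ℝ) (r W φ : ℝ × ℝ → ℝ) : Prop where
  solution : IsSolution G.D Q r W φ
  trapped_out : ∀ v ∈ Icc G.v₀ G.v₁, du G.D r (G.u₀, v) < 0
  trapped_in : ∀ u ∈ Icc G.u₀ G.u₁, dv G.D r (u, G.v₀) < 0
  gauge_out : ∀ v ∈ Icc G.v₀ G.v₁, dv G.D r (G.u₀, v) = -1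
  gauge_in : ∀ u ∈ Icc G.u₀ G.u₁, du G.D r (u, G.v₀) = -1
  singular : ∀ p ∈ G.S, Tendsto r (𝓝[G.D] p) (𝓝 0)

/-- Quantitatively trapped spheres. -/
def QTS (D : Set (ℝ × ℝ)) (r : ℝ × ℝ → ℝ) (R₀ : ℝ) : Prop :=
  ∀ p ∈ D, R₀ ≤ -(r p) * dv D r p ∧ R₀ ≤ -(r p) * du D r p

/-- Subcritical Kasner exponents. -/
def SKE (D : Set (ℝ × ℝ)) (r φ : ℝ × ℝ → ℝ) (α : ℝ) : Prop :=
  ∀ p ∈ D, 1 + α ≤ |r p ^ 2 * outL D r φ p| ^ 2 ∧ 1 + α ≤ |r p ^ 2 * inL D r φ p| ^ 2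

/-! ### Hölder regularity -/

/-- `f` is bounded on `D` and has modulus of continuity `C ω` along the coordinate segments
contained in `D`. -/
def HasModulus (D : Set (ℝ × ℝ)) (ω : ℝ → ℝ) (f : ℝ × ℝ → ℝ) : Prop :=
  ∃ C : ℝ, (∀ p ∈ D, |f p| ≤ C) ∧
    (∀ u a b : ℝ, a < b → {u} ×ˢ Icc a b ⊆ D → |f (u, b) - f (u, a)| ≤ C * ω (b - a)) ∧
    (∀ v a b : ℝ, a < b → Icc a b ×ˢ {v} ⊆ D → |f (b, v) - f (a, v)| ≤ C * ω (b - a))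

/-- The `C^{0,β}` norm of `f` on `D` is finite. -/
def IsHolder (D : Set (ℝ × ℝ)) (β : ℝ) (f : ℝ × ℝ → ℝ) : Prop :=
  HasModulus D (fun h => h ^ β) f

/-- The `C^{0,β,log}` norm of `f` on `D` is finite. -/
def IsLogHolder (D : Set (ℝ × ℝ)) (β : ℝ) (f : ℝ × ℝ → ℝ) : Prop :=
  HasModulus D (fun h => h ^ β * (1 + |Real.log h|)) f

/-- `f` is `C^{1,β}` on `D`. -/
def IsC1Holder (D : Set (ℝ × ℝ)) (β : ℝ) (f : ℝ × ℝ → ℝ) : Prop :=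
  ContDiffOn ℝ 1 f D ∧ IsHolder D β (du D f) ∧ IsHolder D β (dv D f)

/-- The function `f` of one variable is `C^{1,β}` on the compact interval `[a, b]`. -/
def IsC1HolderOn (a b β : ℝ) (f : ℝ → ℝ) : Prop :=
  ContDiffOn ℝ 1 f (Icc a b) ∧ ∃ C : ℝ, ∀ s ∈ Icc a b, ∀ t ∈ Icc a b,
    |derivWithin f (Icc a b) s - derivWithin f (Icc a b) t| ≤ C * |s - t| ^ β

end EMSF

end

open EMSF

/-! The area `r ^ 2` is a good coordinate near the singularity: `∂_u r² = -2 areaU` and `∂_v r² = -2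
areaV`, where (QTS) bounds `areaU = -r ∂_u r` and `areaV = -r ∂_v r` from below. Changing the
variable from `u` or `v` to `r`, a bound `r ^ (k - 2)` on a null derivative therefore integrates to
a bound `r ^ k` if `k < 0`, and to a convergent integral if `k > 0`. The aim is to show that the
relevant quantities have null derivatives of size `r ^ (α - 2)`, up to a logarithm.

The gain `α` comes from (SKE). Raychaudhuri's equation says that `log (areaU / (r Ω²))` grows,
relative to `log (1 / r)`, at the rate `kasnerU ^ 2 ≥ 1 + α`, so `Ω² / areaU ≲ r ^ α`
(`powBound_W_div_areaU`). The wave equation for `r` becomes `∂_v areaU = ∂_u areaV = areaSource`, in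
which the product `∂_u r ∂_v r` has cancelled. What remains is integrable, so the areas are bounded
and `Ω² ≲ r ^ α`.

The rescaled derivatives `kasnerU = r² L̲φ` and `kasnerV = r² Lφ` are transported in opposite null
directions, and each is pulled towards the other at the non-integrable rate `area / r²`. This pull
cannot be integrated, but it has a sign: where one of the two first touches a common barrier, the
other is no larger in modulus, so the pull points inwards (`IsPast.abs_lt_barrier`,
`PowBound_of_relaxation`). The operator `L - L̲` annihilates `r`, so the tangential derivatives of
the pair obey the same kind of system and are `O(r ^ (α - 2))`. In the `v`-derivative of `(kasnerU -
kasnerV) / r²` the singular terms cancel, and only tangential and integrable terms remain. Hence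
`kasnerU - kasnerV = O(r ^ α)`, and every null derivative of `kasnerU` is `O(r ^ (α - 2))`.

It follows that `φ - kasnerU log (r₀ / r)` and the logarithm of the renormalized mass have null
derivatives of size `r ^ (α - 2)` times at most one logarithm. A function whose increments towards
the future are dominated by the decrease of some `Φ (r)`, with `Φ → 0` at `0`, extends continuously
to the singularity. It is within a multiple of `Φ (r)` of its boundary value in the past of each
boundary point. Since `r²` is Lipschitz, it also has Hölder exponent `α / 2`, with a logarithm when
`Φ` has one.

The slope of the curve is obtained by computing `r²` at the corner below a chord in two ways, along
the two null segments that lead to the curve. The blow-up rates come from an exact formula for the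
curvature in terms of `massAspect = 4 Ω⁻² ∂_u r ∂_v r`, the product `kasnerU * kasnerV` and `Q² /
r²`. The inverse of `massAspect` is `O(r ^ (α + 2))`, so even multiplied by `Q² / r²` it only
contributes to the error. -/

open EMSF

/-! ### Calculus along the coordinate lines of a planar region -/

/-- `f` has the partial derivative `f'` in `u` at `p`, along the region `D`. -/
def HasDu (D : Set (ℝ × ℝ)) (f : ℝ × ℝ → ℝ) (f' : ℝ) (p : ℝ × ℝ) : Prop :=
  HasDerivWithinAt (fun s => f (s, p.2)) f' {s | (s, p.2) ∈ D} p.1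

/-- `f` has the partial derivative `f'` in `v` at `p`, along the region `D`. -/
def HasDv (D : Set (ℝ × ℝ)) (f : ℝ × ℝ → ℝ) (f' : ℝ) (p : ℝ × ℝ) : Prop :=
  HasDerivWithinAt (fun s => f (p.1, s)) f' {s | (p.1, s) ∈ D} p.2

section Calculus

variable {D : Set (ℝ × ℝ)} {f g : ℝ × ℝ → ℝ} {f' g' : ℝ} {p : ℝ × ℝ}

theorem HasDu.add (hf : HasDu D f f' p) (hg : HasDu D g g' p) :
    HasDu D (fun q => f q + g q) (f' + g') p := HasDerivWithinAt.add hf hg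

theorem HasDu.sub (hf : HasDu D f f' p) (hg : HasDu D g g' p) :
    HasDu D (fun q => f q - g q) (f' - g') p := HasDerivWithinAt.sub hf hg

theorem HasDu.mul (hf : HasDu D f f' p) (hg : HasDu D g g' p) :
    HasDu D (fun q => f q * g q) (f' * g p + f p * g') p := HasDerivWithinAt.mul hf hg

theorem HasDu.div (hf : HasDu D f f' p) (hg : HasDu D g g' p) (h : g p ≠ 0) :
    HasDu D (fun q => f q / g q) ((f' * g p - f p * g') / g p ^ 2) p :=
  HasDerivWithinAt.div hf hg h

theorem HasDu.neg (hf : HasDu D f f' p) : HasDu D (fun q => -f q) (-f') p :=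
  HasDerivWithinAt.neg hf

theorem HasDu.comp {k : ℝ → ℝ} {k' : ℝ} (hk : HasDerivAt k k' (f p)) (hf : HasDu D f f' p) :
    HasDu D (fun q => k (f q)) (k' * f') p :=
  HasDerivAt.comp_hasDerivWithinAt p.1 (h₂ := k) (h := fun s => f (s, p.2)) hk hf

theorem HasDu.const (c : ℝ) (p : ℝ × ℝ) : HasDu D (fun _ => c) 0 p :=
  hasDerivWithinAt_const _ _ _

theorem HasDu.fst (p : ℝ × ℝ) : HasDu D (fun q => q.1) 1 p := hasDerivWithinAt_id _ _

theorem HasDu.congr (hf : HasDu D f f' p) (hp : p ∈ D) (h : ∀ q ∈ D, g q = f q) :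
    HasDu D g f' p :=
  HasDerivWithinAt.congr hf (fun s hs => h (s, p.2) hs) (h p hp)

theorem HasDu.congr_deriv (hf : HasDu D f f' p) (h : f' = g') : HasDu D f g' p := h ▸ hf

theorem HasDv.add (hf : HasDv D f f' p) (hg : HasDv D g g' p) :
    HasDv D (fun q => f q + g q) (f' + g') p := HasDerivWithinAt.add hf hg

theorem HasDv.sub (hf : HasDv D f f' p) (hg : HasDv D g g' p) :
    HasDv D (fun q => f q - g q) (f' - g') p := HasDerivWithinAt.sub hf hg

theorem HasDv.mul (hf : HasDv D f f' p) (hg : HasDv D g g' p) :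
    HasDv D (fun q => f q * g q) (f' * g p + f p * g') p := HasDerivWithinAt.mul hf hg

theorem HasDv.div (hf : HasDv D f f' p) (hg : HasDv D g g' p) (h : g p ≠ 0) :
    HasDv D (fun q => f q / g q) ((f' * g p - f p * g') / g p ^ 2) p :=
  HasDerivWithinAt.div hf hg h

theorem HasDv.neg (hf : HasDv D f f' p) : HasDv D (fun q => -f q) (-f') p :=
  HasDerivWithinAt.neg hf

theorem HasDv.comp {k : ℝ → ℝ} {k' : ℝ} (hk : HasDerivAt k k' (f p)) (hf : HasDv D f f' p) :
    HasDv D (fun q => k (f q)) (k' * f') p :=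
  HasDerivAt.comp_hasDerivWithinAt p.2 (h₂ := k) (h := fun s => f (p.1, s)) hk hf

theorem HasDv.const (c : ℝ) (p : ℝ × ℝ) : HasDv D (fun _ => c) 0 p :=
  hasDerivWithinAt_const _ _ _

theorem HasDv.snd (p : ℝ × ℝ) : HasDv D (fun q => q.2) 1 p := hasDerivWithinAt_id _ _

theorem HasDv.congr (hf : HasDv D f f' p) (hp : p ∈ D) (h : ∀ q ∈ D, g q = f q) :
    HasDv D g f' p :=
  HasDerivWithinAt.congr hf (fun s hs => h (p.1, s) hs) (h p hp)

theorem HasDv.congr_deriv (hf : HasDv D f f' p) (h : f' = g') : HasDv D f g' p := h ▸ hf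

end Calculus

/-- `D` contains, with every point, the characteristic rectangle between `lo` and that point. -/
structure IsPast (D : Set (ℝ × ℝ)) (lo : ℝ × ℝ) : Prop where
  lo_le : ∀ p ∈ D, lo ≤ p
  mem_of_le : ∀ p ∈ D, ∀ q, lo ≤ q → q ≤ p → q ∈ D

/-! ### Comparison, mixed derivatives and a maximum principle on past-closed regions. -/

namespace IsPast

variable {D : Set (ℝ × ℝ)} {lo : ℝ × ℝ}

theorem swap (hD : IsPast D lo) : IsPast (Prod.swap ⁻¹' D) lo.swap where
  lo_le p hp := by
    have := hD.lo_le _ hp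
    exact ⟨this.2, this.1⟩
  mem_of_le p hp q h1 h2 := hD.mem_of_le _ hp q.swap ⟨h1.2, h1.1⟩ ⟨h2.2, h2.1⟩

/-- Both `g - f` and `g + f` are nondecreasing in `u`. Stating the majorant through a primitive `g`,
later a function of `r` or a coordinate, replaces integration, so neither derivative needs to be
integrable or continuous. -/
theorem abs_sub_le_u (hD : IsPast D lo) {f f' g g' : ℝ × ℝ → ℝ}
    (hf : ∀ p ∈ D, HasDu D f (f' p) p) (hg : ∀ p ∈ D, HasDu D g (g' p) p)
    (h : ∀ p ∈ D, |f' p| ≤ g' p) {u u' v : ℝ} (hlo : lo.1 ≤ u) (huu : u ≤ u')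
    (hm : (u', v) ∈ D) : |f (u', v) - f (u, v)| ≤ g (u', v) - g (u, v) := by
  have hsub : ∀ s ∈ Icc u u', (s, v) ∈ D := fun s hs =>
    hD.mem_of_le _ hm _ ⟨hlo.trans hs.1, (hD.lo_le _ hm).2⟩ ⟨hs.2, le_rfl⟩
  have key : ∀ {k k' : ℝ × ℝ → ℝ}, (∀ p ∈ D, HasDu D k (k' p) p) → (∀ p ∈ D, 0 ≤ k' p) →
      k (u, v) ≤ k (u', v) := by
    intro k k' hk hk'
    have hder : ∀ s ∈ Icc u u', HasDerivWithinAt (fun s => k (s, v)) (k' (s, v)) (Icc u u') s :=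
      fun s hs => (hk _ (hsub s hs)).mono fun t ht => hsub t ht
    refine monotoneOn_of_hasDerivWithinAt_nonneg (f' := fun s => k' (s, v)) (convex_Icc u u')
      (fun s hs => (hder s hs).continuousWithinAt)
      (fun s hs => (hder s (interior_subset hs)).mono interior_subset)
      (fun s hs => hk' _ (hsub s (interior_subset hs))) ⟨le_rfl, huu⟩ ⟨huu, le_rfl⟩ huu
  have h1 := key (k := fun q => g q - f q) (fun p hp => (hg p hp).sub (hf p hp))
    (fun p hp => by have := (abs_le.1 (h p hp)).2; linarith)
  have h2 := key (k := fun q => g q + f q) (fun p hp => (hg p hp).add (hf p hp))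
    (fun p hp => by have := (abs_le.1 (h p hp)).1; linarith)
  rw [abs_le]; constructor <;> linarith

theorem abs_sub_le_v (hD : IsPast D lo) {f f' g g' : ℝ × ℝ → ℝ}
    (hf : ∀ p ∈ D, HasDv D f (f' p) p) (hg : ∀ p ∈ D, HasDv D g (g' p) p)
    (h : ∀ p ∈ D, |f' p| ≤ g' p) {u v v' : ℝ} (hlo : lo.2 ≤ v) (hvv : v ≤ v')
    (hm : (u, v') ∈ D) : |f (u, v') - f (u, v)| ≤ g (u, v') - g (u, v) :=
  hD.swap.abs_sub_le_u (f := f ∘ Prod.swap) (f' := f' ∘ Prod.swap) (g := g ∘ Prod.swap)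
    (g' := g' ∘ Prod.swap) (fun p hp => hf p.swap hp) (fun p hp => hg p.swap hp)
    (fun p hp => h p.swap hp) hlo hvv hm

/-- Existence and value of `∂_v ∂_u g`, when only `∂_u ∂_v g` is known to exist and to be
continuous. -/
theorem hasDv_of_hasDu (hD : IsPast D lo) {g g₁ g₂ H : ℝ × ℝ → ℝ}
    (hu : ∀ p ∈ D, HasDu D g (g₁ p) p) (hv : ∀ p ∈ D, HasDv D g (g₂ p) p)
    (hG : ∀ p ∈ D, HasDu D g₂ (H p) p) (hH : ContinuousOn H D)
    (huniq : ∀ p ∈ D, UniqueDiffWithinAt ℝ {s | (s, p.2) ∈ D} p.1) :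
    ∀ p ∈ D, HasDv D g₁ (H p) p := by
  rintro ⟨u, v⟩ hp
  rw [HasDv, hasDerivWithinAt_iff_isLittleO, Asymptotics.isLittleO_iff]
  intro ε hε
  obtain ⟨δ, hδ, hball⟩ := Metric.continuousWithinAt_iff.1 (hH _ hp) ε hε
  have hlo : lo.1 ≤ u ∧ lo.2 ≤ v := hD.lo_le _ hp
  have hnear : ∀ᶠ t in 𝓝[{s | (u, s) ∈ D}] v, t ∈ {s | (u, s) ∈ D} ∧ |t - v| < δ := by
    refine (eventually_mem_nhdsWithin).and (mem_nhdsWithin_of_mem_nhds ?_)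
    exact Metric.ball_mem_nhds v hδ
  filter_upwards [hnear] with t ht
  obtain ⟨htD, htv⟩ := ht
  have htD : (u, t) ∈ D := htD
  have hlot : lo.2 ≤ t := (hD.lo_le _ htD).2
  -- The row at the larger height `m` is the shorter one: past-closedness puts its abscissae in both
  -- rows `t` and `v`. Both `u`-derivatives can thus be restricted to one common set that
  -- accumulates at `u`.
  set m := max t v with hm
  have hmD : (u, m) ∈ D := by
    rcases max_choice t v with h | h <;> rw [hm, h] <;> assumption
  have hacc : (𝓝[{s | (s, m) ∈ D} \ {u}] u).NeBot := by
    have := (uniqueDiffWithinAt_iff_accPt).1 (huniq _ hmD)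
    rwa [accPt_principal_iff_nhdsWithin] at this
  set H0 := H (u, v) with hH0
  have hderiv : HasDerivWithinAt (fun s => g (s, t) - g (s, v) - (t - v) * H0 * s)
      (g₁ (u, t) - g₁ (u, v) - (t - v) * H0) {s | (s, m) ∈ D} u := by
    have h1 : HasDerivWithinAt (fun s => g (s, t)) (g₁ (u, t)) {s | (s, m) ∈ D} u :=
      (hu _ htD).mono fun s hs => hD.mem_of_le _ hs _ ⟨(hD.lo_le _ hs).1, hlot⟩
        ⟨le_rfl, le_max_left _ _⟩
    have h2 : HasDerivWithinAt (fun s => g (s, v)) (g₁ (u, v)) {s | (s, m) ∈ D} u :=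
      (hu _ hp).mono fun s hs => hD.mem_of_le _ hs _ ⟨(hD.lo_le _ hs).1, hlo.2⟩
        ⟨le_rfl, le_max_right _ _⟩
    simpa using (h1.fun_sub h2).fun_sub ((hasDerivWithinAt_id u _).const_mul ((t - v) * H0))
  have hslope := (hasDerivWithinAt_iff_tendsto_slope.1 hderiv).abs
  have hbound : |g₁ (u, t) - g₁ (u, v) - (t - v) * H0| ≤ ε * |t - v| := by
    refine le_of_tendsto hslope ?_
    have hnear' : ∀ᶠ s in 𝓝[{s | (s, m) ∈ D} \ {u}] u,
        s ∈ {s | (s, m) ∈ D} \ {u} ∧ |s - u| < δ := by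
      refine (eventually_mem_nhdsWithin).and (mem_nhdsWithin_of_mem_nhds ?_)
      exact Metric.ball_mem_nhds u hδ
    filter_upwards [hnear'] with s hs
    obtain ⟨⟨hsD, hsu⟩, hsd⟩ := hs
    have hsD : (s, m) ∈ D := hsD
    have hsu : s ≠ u := hsu
    have hmax : (max s u, m) ∈ D := by
      rcases max_choice s u with h | h <;> rw [h] <;> assumption
    have hlos : lo.1 ≤ s := (hD.lo_le _ hsD).1
    have hbox : ∀ x ∈ uIcc u s, ∀ y ∈ uIcc v t, (x, y) ∈ D := by
      intro x hx y hy
      have hx : min u s ≤ x ∧ x ≤ max u s := hx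
      have hy : min v t ≤ y ∧ y ≤ max v t := hy
      refine hD.mem_of_le _ hmax _ ⟨(le_min hlo.1 hlos).trans hx.1, (le_min hlo.2 hlot).trans hy.1⟩
        ⟨?_, ?_⟩
      · exact hx.2.trans (max_comm u s).le
      · exact hy.2.trans (max_comm v t).le
    have hboxH : ∀ x ∈ uIcc u s, ∀ y ∈ uIcc v t, |H (x, y) - H0| ≤ ε := by
      intro x hx y hy
      refine (hball (hbox x hx y hy) ?_).le
      rw [Prod.dist_eq, max_lt_iff]
      have hx' := abs_sub_left_of_mem_uIcc hx
      have hy' := abs_sub_left_of_mem_uIcc hy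
      exact ⟨hx'.trans_lt hsd, hy'.trans_lt htv⟩
    -- The double difference of `g` over the rectangle, minus `(s - u) (t - v) H0`, is at most `ε |s
    -- - u| |t - v|`: one mean value inequality in `x` for `g₂`, then one in `y` for `g`. Dividing
    -- by `s - u` and letting `s → u` gives the claim.
    have inner : ∀ y ∈ uIcc v t, |g₂ (s, y) - g₂ (u, y) - (s - u) * H0| ≤ ε * |s - u| := by
      intro y hy
      have := Convex.norm_image_sub_le_of_norm_hasDerivWithin_le
        (f := fun x => g₂ (x, y) - H0 * x) (f' := fun x => H (x, y) - H0) (C := ε)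
        (s := uIcc u s) (x := u) (y := s) (fun x hx => by
          simpa using ((hG _ (hbox x hx y hy)).mono fun z hz => hbox z hz y hy).fun_sub
            ((hasDerivWithinAt_id x _).const_mul H0))
        (fun x hx => hboxH x hx y hy) (convex_uIcc u s) left_mem_uIcc right_mem_uIcc
      simp only [Real.norm_eq_abs] at this
      convert this using 2; ring
    have outer := Convex.norm_image_sub_le_of_norm_hasDerivWithin_le
        (f := fun y => g (s, y) - g (u, y) - (s - u) * H0 * y)
        (f' := fun y => g₂ (s, y) - g₂ (u, y) - (s - u) * H0) (C := ε * |s - u|)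
        (s := uIcc v t) (x := v) (y := t) (fun y hy => by
          have h1 := (hv _ (hbox s right_mem_uIcc y hy)).mono
            (fun z hz => hbox s right_mem_uIcc z hz : uIcc v t ⊆ _)
          have h2 := (hv _ (hbox u left_mem_uIcc y hy)).mono
            (fun z hz => hbox u left_mem_uIcc z hz : uIcc v t ⊆ _)
          simpa using (h1.fun_sub h2).fun_sub ((hasDerivWithinAt_id y _).const_mul ((s - u) * H0)))
        (fun y hy => inner y hy) (convex_uIcc v t) left_mem_uIcc right_mem_uIcc
    simp only [Real.norm_eq_abs] at outer
    rw [slope_def_field, abs_div, div_le_iff₀ (abs_pos.2 (sub_ne_zero.2 hsu))]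
    calc _ = |g (s, t) - g (u, t) - (s - u) * H0 * t - (g (s, v) - g (u, v) - (s - u) * H0 * v)| := by
          congr 1; ring
      _ ≤ _ := outer
      _ = _ := by ring
  simpa [Real.norm_eq_abs, smul_eq_mul] using hbound

theorem hasDu_of_hasDv (hD : IsPast D lo) {g g₁ g₂ H : ℝ × ℝ → ℝ}
    (hv : ∀ p ∈ D, HasDv D g (g₁ p) p) (hu : ∀ p ∈ D, HasDu D g (g₂ p) p)
    (hG : ∀ p ∈ D, HasDv D g₂ (H p) p) (hH : ContinuousOn H D)
    (huniq : ∀ p ∈ D, UniqueDiffWithinAt ℝ {s | (p.1, s) ∈ D} p.2) :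
    ∀ p ∈ D, HasDu D g₁ (H p) p := fun p hp =>
  hD.swap.hasDv_of_hasDu (g := g ∘ Prod.swap) (g₁ := g₁ ∘ Prod.swap) (g₂ := g₂ ∘ Prod.swap)
    (H := H ∘ Prod.swap) (fun p hp => hv p.swap hp) (fun p hp => hu p.swap hp)
    (fun p hp => hG p.swap hp) (hH.comp continuous_swap.continuousOn fun _ h => h)
    (fun p hp => huniq p.swap hp) p.swap hp

/-- A maximum principle for pairs of functions transported in the two null directions, each of
which relaxes towards the other one. -/
theorem abs_lt_barrier (hD : IsPast D lo) {X Y B X' Y' Bu Bv k l : ℝ × ℝ → ℝ}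
    (hX : ContinuousOn X D) (hY : ContinuousOn Y D) (hB : ContinuousOn B D)
    (hdX : ∀ p ∈ D, HasDv D X (X' p) p) (hdY : ∀ p ∈ D, HasDu D Y (Y' p) p)
    (hBu : ∀ p ∈ D, HasDu D B (Bu p) p) (hBv : ∀ p ∈ D, HasDv D B (Bv p) p)
    (hk : ∀ p ∈ D, 0 ≤ k p) (hl : ∀ p ∈ D, 0 ≤ l p)
    (hX0 : ∀ p ∈ D, p.2 = lo.2 → |X p| < B p) (hY0 : ∀ p ∈ D, p.1 = lo.1 → |Y p| < B p)
    (hXB : ∀ p ∈ D, |X p| ≤ B p → |X' p - k p * (Y p - X p)| < Bv p)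
    (hYB : ∀ p ∈ D, |Y p| ≤ B p → |Y' p - l p * (X p - Y p)| < Bu p) :
    ∀ p ∈ D, |X p| < B p ∧ |Y p| < B p := by
  intro p hp
  have hrect : Icc lo p ⊆ D := fun q hq => hD.mem_of_le p hp q hq.1 hq.2
  set J : Set (ℝ × ℝ) := {q ∈ Icc lo p | 0 ≤ max (|X q| - B q) (|Y q| - B q)} with hJ
  have hcont : ContinuousOn (fun q => max (|X q| - B q) (|Y q| - B q)) (Icc lo p) :=
    (((hX.abs.sub hB).sup (hY.abs.sub hB)).mono hrect)
  have hJc : IsCompact J := by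
    have : J = Icc lo p ∩ (fun q => max (|X q| - B q) (|Y q| - B q)) ⁻¹' Ici 0 := rfl
    rw [this]
    exact isCompact_Icc.of_isClosed_subset (hcont.preimage_isClosed_of_isClosed isClosed_Icc
      isClosed_Ici) inter_subset_left
  suffices hE : J = ∅ by
    by_contra hcon
    have : p ∈ J := by
      refine ⟨⟨hD.lo_le p hp, le_rfl⟩, ?_⟩
      rw [not_and_or, not_lt, not_lt] at hcon
      rcases hcon with h | h
      · exact le_max_of_le_left (by linarith)
      · exact le_max_of_le_right (by linarith)
    rw [hE] at this; exact this
  by_contra hne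
  -- First contact: a point minimizing the sum of the coordinates over the compact set where a bound
  -- fails. Every other point of the rectangle between `lo` and it has a smaller sum, so both strict
  -- bounds hold there.
  obtain ⟨q, hqJ, hmin⟩ := hJc.exists_isMinOn (nonempty_iff_ne_empty.2 hne)
    (f := fun q : ℝ × ℝ => q.1 + q.2) (by fun_prop)
  obtain ⟨x, y⟩ := q
  have hq : (x, y) ∈ D := hrect hqJ.1
  obtain ⟨⟨hlq, hqp⟩, hmax⟩ := hqJ
  have hbefore : ∀ q', lo ≤ q' → q' ≤ (x, y) → q'.1 + q'.2 < x + y → |X q'| < B q' ∧ |Y q'| < B q' := by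
    intro q' h1 h2 h3
    by_contra hcon
    refine absurd (hmin (a := q') ⟨⟨h1, h2.trans hqp⟩, ?_⟩) (not_le.2 h3)
    rw [not_and_or, not_lt, not_lt] at hcon
    rcases hcon with h | h
    · exact le_max_of_le_left (by linarith)
    · exact le_max_of_le_right (by linarith)
  have hlx : lo.1 ≤ x := hlq.1
  have hly : lo.2 ≤ y := hlq.2
  -- one-sided derivatives of a function that becomes nonnegative for the first time
  have first : ∀ {c d : ℝ} {h : ℝ → ℝ} {T : Set ℝ} {h' : ℝ}, c < d → Icc c d ⊆ T →
      HasDerivWithinAt h h' T d → (∀ s ∈ Ico c d, h s < 0) → h d = 0 → 0 ≤ h' := by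
    intro c d h T h' hcd hT hder hneg hzero
    have hd : HasDerivWithinAt h h' (Iio d) d := by
      refine (hder.mono hT).mono_of_mem_nhdsWithin ?_
      exact mem_of_superset (Ico_mem_nhdsLT hcd) Ico_subset_Icc_self
    have := (hasDerivWithinAt_iff_tendsto_slope' (by simp)).1 hd
    refine ge_of_tendsto this ?_
    filter_upwards [Ico_mem_nhdsLT hcd] with s hs
    rw [slope_def_field, hzero, sub_zero]
    exact div_nonneg_of_nonpos (hneg s hs).le (by linarith [hs.2])
  have segv : lo.2 < y → Icc lo.2 y ⊆ {s | (x, s) ∈ D} := fun _ s hs =>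
    hD.mem_of_le _ hq _ ⟨hlx, hs.1⟩ ⟨le_rfl, hs.2⟩
  have segu : lo.1 < x → Icc lo.1 x ⊆ {s | (s, y) ∈ D} := fun _ s hs =>
    hD.mem_of_le _ hq _ ⟨hs.1, hly⟩ ⟨hs.2, le_rfl⟩
  -- The strict bounds at earlier points pass to the limit, so at the contact point neither modulus
  -- exceeds `B`.
  have hlimX : |X (x, y)| ≤ B (x, y) := by
    rcases hly.eq_or_lt with h | h
    · exact (hX0 _ hq h.symm).le
    · have hc : ContinuousWithinAt (fun s => B (x, s) - |X (x, s)|) (Icc lo.2 y) y := by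
        have h1 := ((hBv _ hq).continuousWithinAt).mono (segv h)
        have h2 := ((hdX _ hq).continuousWithinAt).mono (segv h)
        exact h1.sub h2.abs
      have hc' := (hc.mono Ico_subset_Icc_self)
      have : (𝓝[Ico lo.2 y] y).NeBot := by
        rw [nhdsWithin_Ico_eq_nhdsLT h]; infer_instance
      have := ge_of_tendsto hc' (b := 0) (by
        filter_upwards [self_mem_nhdsWithin] with s hs
        have := (hbefore (x, s) ⟨hlx, hs.1⟩ ⟨le_rfl, hs.2.le⟩ (by simpa using hs.2)).1
        linarith)
      linarith
  have hlimY : |Y (x, y)| ≤ B (x, y) := by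
    rcases hlx.eq_or_lt with h | h
    · exact (hY0 _ hq h.symm).le
    · have hc : ContinuousWithinAt (fun s => B (s, y) - |Y (s, y)|) (Icc lo.1 x) x := by
        have h1 := ((hBu _ hq).continuousWithinAt).mono (segu h)
        have h2 := ((hdY _ hq).continuousWithinAt).mono (segu h)
        exact h1.sub h2.abs
      have hc' := (hc.mono Ico_subset_Icc_self)
      have : (𝓝[Ico lo.1 x] x).NeBot := by
        rw [nhdsWithin_Ico_eq_nhdsLT h]; infer_instance
      have := ge_of_tendsto hc' (b := 0) (by
        filter_upwards [self_mem_nhdsWithin] with s hs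
        have := (hbefore (s, y) ⟨hs.1, hly⟩ ⟨hs.2.le, le_rfl⟩ (by simpa using hs.2)).2
        linarith)
      linarith
  have hYX := abs_le.1 hlimX
  have hYY := abs_le.1 hlimY
  rcases le_max_iff.1 hmax with h | h
  -- Here `|X| = B ≥ |Y|`, so the term `k (Y - X)` has the sign opposite to `X`, and `hXB` makes
  -- `|X|` grow strictly slower than `B`. A first contact requires the opposite inequality. The case
  -- of `Y` is symmetric.
  · have hXe : |X (x, y)| = B (x, y) := le_antisymm hlimX (by linarith)
    have hlt : lo.2 < y := by
      refine lt_of_le_of_ne hly fun h' => ?_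
      have := hX0 _ hq h'.symm; linarith
    have hX'B := abs_lt.1 (hXB _ hq hlimX)
    have hk' := hk _ hq
    rcases abs_choice (X (x, y)) with hs | hs
    · have := first hlt (segv hlt) ((hdX _ hq).sub (hBv _ hq))
        (fun s hs => by
          have := (hbefore (x, s) ⟨hlx, hs.1⟩ ⟨le_rfl, hs.2.le⟩ (by simpa using hs.2)).1
          have := (abs_lt.1 this).2
          linarith) (by linarith)
      nlinarith
    · have := first hlt (segv hlt) ((hdX _ hq).neg.sub (hBv _ hq))
        (fun s hs => by
          have := (hbefore (x, s) ⟨hlx, hs.1⟩ ⟨le_rfl, hs.2.le⟩ (by simpa using hs.2)).1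
          have := (abs_lt.1 this).1
          linarith) (by linarith)
      nlinarith
  · have hYe : |Y (x, y)| = B (x, y) := le_antisymm hlimY (by linarith)
    have hlt : lo.1 < x := by
      refine lt_of_le_of_ne hlx fun h' => ?_
      have := hY0 _ hq h'.symm; linarith
    have hY'B := abs_lt.1 (hYB _ hq hlimY)
    have hl' := hl _ hq
    rcases abs_choice (Y (x, y)) with hs | hs
    · have := first hlt (segu hlt) ((hdY _ hq).sub (hBu _ hq))
        (fun s hs => by
          have := (hbefore (s, y) ⟨hs.1, hly⟩ ⟨hs.2.le, le_rfl⟩ (by simpa using hs.2)).2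
          have := (abs_lt.1 this).2
          linarith) (by linarith)
      nlinarith
    · have := first hlt (segu hlt) ((hdY _ hq).neg.sub (hBu _ hq))
        (fun s hs => by
          have := (hbefore (s, y) ⟨hs.1, hly⟩ ⟨hs.2.le, le_rfl⟩ (by simpa using hs.2)).2
          have := (abs_lt.1 this).1
          linarith) (by linarith)
      nlinarith

end IsPast

/-! ### The domain of dependence -/

namespace EMSF.SingularRegion

variable (G : SingularRegion)

theorem v₀_lt_v₁ : G.v₀ < G.v₁ := by
  have h := G.strictAntiOn_vs ⟨le_rfl, G.hu₁.le⟩ ⟨G.hu₁.le, le_rfl⟩ G.hu₁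
  rw [G.vs_uS] at h
  exact G.vs_u₁.trans h

theorem vs_mem {u : ℝ} (hu : u ∈ Icc G.uS G.u₁) : G.vs u ∈ Ioc G.v₀ G.v₁ := by
  refine ⟨G.vs_u₁.trans_le (G.strictAntiOn_vs.antitoneOn hu ⟨G.hu₁.le, le_rfl⟩ hu.2), ?_⟩
  rw [← G.vs_uS]
  exact G.strictAntiOn_vs.antitoneOn ⟨le_rfl, G.hu₁.le⟩ hu hu.1

/-- The curve is decreasing, so a step to the left or downwards from a point below it stays below
it. -/
theorem isPast : IsPast G.D (G.u₀, G.v₀) where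
  lo_le p hp := ⟨hp.1.1, hp.2.1.1⟩
  mem_of_le := by
    rintro ⟨u, v⟩ ⟨h1, h2, h3⟩ ⟨u', v'⟩ ⟨hu0, hv0⟩ ⟨hu, hv⟩
    simp only at *
    refine ⟨⟨hu0, hu.trans h1.2⟩, ⟨hv0, hv.trans h2.2⟩, ?_⟩
    rcases lt_or_ge u' G.uS with h | h
    · exact Or.inl h
    · right
      rcases h3 with h3 | h3
      · exact absurd h3 (not_lt.2 (h.trans hu))
      · exact (hv.trans_lt h3).trans_le
          (G.strictAntiOn_vs.antitoneOn ⟨h, hu.trans h1.2⟩ ⟨h.trans hu, h1.2⟩ hu)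

theorem lo_mem : (G.u₀, G.v₀) ∈ G.D :=
  ⟨⟨le_rfl, (G.hu₀.trans G.hu₁).le⟩, ⟨le_rfl, G.v₀_lt_v₁.le⟩, Or.inl G.hu₀⟩

theorem mem_of_fst_lt {u v : ℝ} (hu : u ∈ Ico G.u₀ G.uS) (hv : v ∈ Icc G.v₀ G.v₁) :
    (u, v) ∈ G.D :=
  ⟨⟨hu.1, (hu.2.trans G.hu₁).le⟩, hv, Or.inl hu.2⟩

theorem mem_of_snd_lt {u v : ℝ} (hu : u ∈ Icc G.u₀ G.u₁) (hv : v ∈ Ico G.v₀ (G.vs G.u₁)) :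
    (u, v) ∈ G.D := by
  have h1 := G.vs_mem ⟨G.hu₁.le, le_rfl⟩
  refine ⟨hu, ⟨hv.1, hv.2.le.trans h1.2⟩, ?_⟩
  rcases lt_or_ge u G.uS with h | h
  · exact Or.inl h
  · exact Or.inr (hv.2.trans_le (G.strictAntiOn_vs.antitoneOn ⟨h, hu.2⟩ ⟨G.hu₁.le, le_rfl⟩ hu.2))

theorem mem_of_mem_curve {u u' v : ℝ} (hu : u ∈ Icc G.uS G.u₁) (hu' : u' ∈ Icc G.u₀ u)
    (hv : v ∈ Icc G.v₀ (G.vs u)) (h : u' < u ∨ v < G.vs u) : (u', v) ∈ G.D := by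
  refine ⟨⟨hu'.1, hu'.2.trans hu.2⟩, ⟨hv.1, hv.2.trans (G.vs_mem hu).2⟩, ?_⟩
  rcases lt_or_ge u' G.uS with hS | hS
  · exact Or.inl hS
  · right
    have hm : u' ∈ Icc G.uS G.u₁ := ⟨hS, hu'.2.trans hu.2⟩
    rcases h with h | h
    · exact hv.2.trans_lt (G.strictAntiOn_vs hm hu h)
    · exact h.trans_le (G.strictAntiOn_vs.antitoneOn hm hu hu'.2)

/-- Each horizontal slice is an interval containing `(u₀, uS)`. Uniqueness of derivatives along
slices is what allows `du` to be read off from any `HasDu` statement. -/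
theorem uniqueDiffWithinAt_u {p : ℝ × ℝ} (hp : p ∈ G.D) :
    UniqueDiffWithinAt ℝ {s | (s, p.2) ∈ G.D} p.1 := by
  refine uniqueDiffWithinAt_convex ?_ ?_ (subset_closure hp)
  · refine (OrdConnected.convex ⟨?_⟩)
    intro x hx y hy z hz
    exact G.isPast.mem_of_le _ hy _ ⟨hx.1.1.trans hz.1, hy.2.1.1⟩ ⟨hz.2, le_rfl⟩
  · refine ⟨(G.u₀ + G.uS) / 2, mem_interior.2 ⟨Ioo G.u₀ G.uS, fun s hs => ?_, isOpen_Ioo, ?_⟩⟩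
    · exact G.mem_of_fst_lt ⟨hs.1.le, hs.2⟩ hp.2.1
    · have := G.hu₀; constructor <;> linarith

theorem uniqueDiffWithinAt_v {p : ℝ × ℝ} (hp : p ∈ G.D) :
    UniqueDiffWithinAt ℝ {s | (p.1, s) ∈ G.D} p.2 := by
  refine uniqueDiffWithinAt_convex ?_ ?_ (subset_closure hp)
  · refine (OrdConnected.convex ⟨?_⟩)
    intro x hx y hy z hz
    exact G.isPast.mem_of_le _ hy _ ⟨hy.1.1, hx.2.1.1.trans hz.1⟩ ⟨le_rfl, hz.2⟩
  · refine ⟨(G.v₀ + G.vs G.u₁) / 2,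
      mem_interior.2 ⟨Ioo G.v₀ (G.vs G.u₁), fun s hs => ?_, isOpen_Ioo, ?_⟩⟩
    · exact G.mem_of_snd_lt hp.1 ⟨hs.1.le, hs.2⟩
    · have := G.vs_u₁; constructor <;> linarith

theorem uniqueDiffOn : UniqueDiffOn ℝ G.D := by
  -- Nothing is assumed about `vs` outside `[uS, u₁]`. The constant extension is continuous
  -- everywhere and exhibits the region as a rectangle intersected with an open set.
  set V := IccExtend G.hu₁.le (domRestrict (Icc G.uS G.u₁) G.vs) with hV
  have hVc : Continuous V := G.continuousOn_vs.domRestrict.Icc_extend'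
  have hD : G.D = (Icc G.u₀ G.u₁ ×ˢ Icc G.v₀ G.v₁) ∩ ({p | p.1 < G.uS} ∪ {p | p.2 < V p.1}) := by
    ext ⟨u, v⟩
    simp only [SingularRegion.D, mem_ofPred_eq, mem_inter_iff, mem_prod, mem_union, and_assoc]
    refine and_congr_right fun hu => and_congr_right fun _ => ?_
    rcases lt_or_ge u G.uS with h | h
    · simp [h]
    · rw [hV, IccExtend_of_mem _ _ (⟨h, hu.2⟩ : u ∈ Icc G.uS G.u₁)]; rfl
  rw [hD]
  refine UniqueDiffOn.inter ?_ ?_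
  · exact (uniqueDiffOn_Icc (G.hu₀.trans G.hu₁)).prod (uniqueDiffOn_Icc G.v₀_lt_v₁)
  · exact (isOpen_lt continuous_fst continuous_const).union
      (isOpen_lt continuous_snd (hVc.comp continuous_fst))

variable {G} {f : ℝ × ℝ → ℝ} {p : ℝ × ℝ}

theorem du_eq {f' : ℝ} (hf : HasDu G.D f f' p) (hp : p ∈ G.D) : du G.D f p = f' :=
  hf.derivWithin (G.uniqueDiffWithinAt_u hp)

theorem dv_eq {f' : ℝ} (hf : HasDv G.D f f' p) (hp : p ∈ G.D) : dv G.D f p = f' :=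
  hf.derivWithin (G.uniqueDiffWithinAt_v hp)

theorem hasDu_fderivWithin (hf : DifferentiableOn ℝ f G.D) (hp : p ∈ G.D) :
    HasDu G.D f (fderivWithin ℝ f G.D p (1, 0)) p := by
  have h1 := (hf p hp).hasFDerivWithinAt
  have h2 : HasDerivWithinAt (fun s : ℝ => (s, p.2)) (1, 0) {s | (s, p.2) ∈ G.D} p.1 :=
    (hasDerivWithinAt_id _ _).prodMk (hasDerivWithinAt_const _ _ _)
  exact HasFDerivWithinAt.comp_hasDerivWithinAt (f := fun s : ℝ => (s, p.2)) (l := f) (t := G.D) p.1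
    h1 h2 (fun s hs => hs)

theorem hasDv_fderivWithin (hf : DifferentiableOn ℝ f G.D) (hp : p ∈ G.D) :
    HasDv G.D f (fderivWithin ℝ f G.D p (0, 1)) p := by
  have h1 := (hf p hp).hasFDerivWithinAt
  have h2 : HasDerivWithinAt (fun s : ℝ => (p.1, s)) (0, 1) {s | (p.1, s) ∈ G.D} p.2 :=
    (hasDerivWithinAt_const _ _ _).prodMk (hasDerivWithinAt_id _ _)
  exact HasFDerivWithinAt.comp_hasDerivWithinAt (f := fun s : ℝ => (p.1, s)) (l := f) (t := G.D) p.2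
    h1 h2 (fun s hs => hs)

theorem hasDu_du (hf : ContDiffOn ℝ 1 f G.D) (hp : p ∈ G.D) : HasDu G.D f (du G.D f p) p := by
  have h := hasDu_fderivWithin (hf.differentiableOn one_ne_zero) hp
  rwa [du_eq h hp]

theorem hasDv_dv (hf : ContDiffOn ℝ 1 f G.D) (hp : p ∈ G.D) : HasDv G.D f (dv G.D f p) p := by
  have h := hasDv_fderivWithin (hf.differentiableOn one_ne_zero) hp
  rwa [dv_eq h hp]

theorem contDiffOn_du {n m : WithTop ℕ∞} (hf : ContDiffOn ℝ n f G.D) (h : m + 1 ≤ n) :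
    ContDiffOn ℝ m (du G.D f) G.D := by
  have h1 := (hf.fderivWithin G.uniqueDiffOn h).clm_apply (contDiffOn_const (c := ((1, 0) : ℝ × ℝ)))
  refine h1.congr fun p hp => ?_
  exact du_eq (hasDu_fderivWithin
    (hf.differentiableOn (by rintro rfl; simp at h)) hp) hp

theorem contDiffOn_dv {n m : WithTop ℕ∞} (hf : ContDiffOn ℝ n f G.D) (h : m + 1 ≤ n) :
    ContDiffOn ℝ m (dv G.D f) G.D := by
  have h1 := (hf.fderivWithin G.uniqueDiffOn h).clm_apply (contDiffOn_const (c := ((0, 1) : ℝ × ℝ)))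
  refine h1.congr fun p hp => ?_
  exact dv_eq (hasDv_fderivWithin
    (hf.differentiableOn (by rintro rfl; simp at h)) hp) hp

theorem exists_bound_of_snd_eq (hf : ContinuousOn f G.D) :
    ∃ C, ∀ p ∈ G.D, p.2 = G.v₀ → |f p| ≤ C := by
  have hK : IsCompact (Icc G.u₀ G.u₁ ×ˢ {G.v₀}) := isCompact_Icc.prod isCompact_singleton
  obtain ⟨C, hC⟩ := hK.exists_bound_of_continuousOn (f := f) (hf.mono (by
    rintro ⟨u, v⟩ ⟨hu, hv⟩
    obtain rfl : v = G.v₀ := hv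
    exact G.mem_of_snd_lt hu ⟨le_rfl, G.vs_u₁⟩))
  exact ⟨C, fun p hp h => hC p ⟨hp.1, h⟩⟩

theorem exists_bound_of_fst_eq (hf : ContinuousOn f G.D) :
    ∃ C, ∀ p ∈ G.D, p.1 = G.u₀ → |f p| ≤ C := by
  have hK : IsCompact ({G.u₀} ×ˢ Icc G.v₀ G.v₁) := isCompact_singleton.prod isCompact_Icc
  obtain ⟨C, hC⟩ := hK.exists_bound_of_continuousOn (f := f) (hf.mono (by
    rintro ⟨u, v⟩ ⟨hu, hv⟩
    obtain rfl : u = G.u₀ := hu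
    exact G.mem_of_fst_lt ⟨le_rfl, G.hu₀⟩ hv))
  exact ⟨C, fun p hp h => hC p ⟨h, hp.2.1⟩⟩

/-- Points of the singular curve are limits of points of the region that lie in the causal future
of any given point of their causal past. -/
theorem neBot_nhdsWithin_future {u : ℝ} (hu : u ∈ Icc G.uS G.u₁) {q : ℝ × ℝ} (hq : q ∈ G.D)
    (hqp : q ≤ G.pt u) : (𝓝[{x ∈ G.D | q ≤ x}] (G.pt u)).NeBot := by
  rw [← mem_closure_iff_nhdsWithin_neBot]
  obtain ⟨x, y⟩ := q
  obtain ⟨hx, hy⟩ : x ≤ u ∧ y ≤ G.vs u := hqp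
  have hq0 := G.isPast.lo_le _ hq
  have hu0 : G.u₀ ≤ u := hq0.1.trans hx
  rcases hy.eq_or_lt with h | h
  · have hxu : x < u := by
      rcases hx.eq_or_lt with rfl | h'
      · rcases hq.2.2 with h2 | h2
        · exact absurd h2 (not_lt.2 hu.1)
        · exact absurd h2 (not_lt.2 h.ge)
      · exact h'
    have hc : ContinuousWithinAt (fun s : ℝ => (s, G.vs u)) (Ico x u) u :=
      (by fun_prop : Continuous fun s : ℝ => (s, G.vs u)).continuousWithinAt
    refine hc.mem_closure (by rw [closure_Ico hxu.ne]; exact ⟨hxu.le, le_rfl⟩) ?_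
    intro s hs
    exact ⟨G.mem_of_mem_curve hu ⟨hq0.1.trans hs.1, hs.2.le⟩ ⟨(G.vs_mem hu).1.le, le_rfl⟩
      (Or.inl hs.2), ⟨hs.1, h.le⟩⟩
  · have hc : ContinuousWithinAt (fun s : ℝ => (u, s)) (Ico y (G.vs u)) (G.vs u) :=
      (by fun_prop : Continuous fun s : ℝ => (u, s)).continuousWithinAt
    refine hc.mem_closure (by rw [closure_Ico h.ne]; exact ⟨h.le, le_rfl⟩) ?_
    intro s hs
    exact ⟨G.mem_of_mem_curve hu ⟨hu0, le_rfl⟩ ⟨hq0.2.trans hs.1, hs.2.le⟩ (Or.inr hs.2),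
      ⟨hx, hs.1⟩⟩

theorem lo_le_pt {u : ℝ} (hu : u ∈ Icc G.uS G.u₁) : (G.u₀, G.v₀) ≤ G.pt u :=
  ⟨G.hu₀.le.trans hu.1, (G.vs_mem hu).1.le⟩

theorem neBot_nhdsWithin_pt {u : ℝ} (hu : u ∈ Icc G.uS G.u₁) : (𝓝[G.D] (G.pt u)).NeBot :=
  (neBot_nhdsWithin_future hu G.lo_mem (lo_le_pt hu)).mono (nhdsWithin_mono _ fun _ h => h.1)

end EMSF.SingularRegion

/-! ### The geometry of spherically symmetric spacetimes -/

namespace EMSF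

section Geometry

theorem forall_fin_four {p : Fin 4 → Prop} (h0 : p 0) (h1 : p 1) (h2 : p 2) (h3 : p 3)
    (i : Fin 4) : p i := by
  match i with
  | 0 => exact h0
  | 1 => exact h1
  | 2 => exact h2
  | 3 => exact h3

variable {D : Set (ℝ × ℝ)} {x : Fin 4 → ℝ}

theorem update_zero_mem_chart (hx : x ∈ chart D) (s : ℝ) :
    Function.update x 0 s ∈ chart D ↔ (s, x 1) ∈ D := by
  simp [chart] at hx ⊢; tauto

theorem update_one_mem_chart (hx : x ∈ chart D) (s : ℝ) :
    Function.update x 1 s ∈ chart D ↔ (x 0, s) ∈ D := by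
  simp [chart] at hx ⊢; tauto

theorem update_two_mem_chart (hx : x ∈ chart D) (s : ℝ) :
    Function.update x 2 s ∈ chart D ↔ s ∈ Ioo 0 Real.pi := by
  simp [chart] at hx ⊢; tauto

variable {k : (Fin 4 → ℝ) → ℝ} {A : ℝ × ℝ → ℝ} {B : ℝ → ℝ}

/-- Every metric component and Christoffel symbol here is a function of `(u, v)` times a function of
`θ`. For such products the derivatives in the chart reduce to `du`, `dv` and an ordinary derivative
in `θ`. -/
theorem coordDeriv_zero_of_eq (hx : x ∈ chart D)
    (h : ∀ y ∈ chart D, k y = A (y 0, y 1) * B (y 2)) :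
    coordDeriv (chart D) 0 k x = du D A (x 0, x 1) * B (x 2) := by
  have hs : {s | Function.update x 0 s ∈ chart D} = {s | (s, x 1) ∈ D} := by
    ext s; exact update_zero_mem_chart hx s
  have hk : ∀ s ∈ {s | (s, x 1) ∈ D}, k (Function.update x 0 s) = A (s, x 1) * B (x 2) := by
    intro s hs
    rw [h _ ((update_zero_mem_chart hx s).2 hs)]
    simp
  rw [coordDeriv, hs, derivWithin_congr hk (hk _ hx.1), derivWithin_mul_const_field]
  rfl

theorem coordDeriv_one_of_eq (hx : x ∈ chart D)
    (h : ∀ y ∈ chart D, k y = A (y 0, y 1) * B (y 2)) :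
    coordDeriv (chart D) 1 k x = dv D A (x 0, x 1) * B (x 2) := by
  have hs : {s | Function.update x 1 s ∈ chart D} = {s | (x 0, s) ∈ D} := by
    ext s; exact update_one_mem_chart hx s
  have hk : ∀ s ∈ {s | (x 0, s) ∈ D}, k (Function.update x 1 s) = A (x 0, s) * B (x 2) := by
    intro s hs
    rw [h _ ((update_one_mem_chart hx s).2 hs)]
    simp
  rw [coordDeriv, hs, derivWithin_congr hk (hk _ hx.1), derivWithin_mul_const_field]
  rfl

theorem coordDeriv_two_of_eq (hx : x ∈ chart D)
    (h : ∀ y ∈ chart D, k y = A (y 0, y 1) * B (y 2)) :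
    coordDeriv (chart D) 2 k x = A (x 0, x 1) * deriv B (x 2) := by
  have hs : {s | Function.update x 2 s ∈ chart D} = Ioo 0 Real.pi := by
    ext s; exact update_two_mem_chart hx s
  have hk : ∀ s ∈ Ioo 0 Real.pi, k (Function.update x 2 s) = A (x 0, x 1) * B s := by
    intro s hs
    rw [h _ ((update_two_mem_chart hx s).2 hs)]
    simp
  rw [coordDeriv, hs, derivWithin_congr hk (hk _ hx.2), derivWithin_const_mul_field,
    derivWithin_of_isOpen isOpen_Ioo hx.2]

theorem coordDeriv_three_of_eq (hx : x ∈ chart D)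
    (h : ∀ y ∈ chart D, k y = A (y 0, y 1) * B (y 2)) :
    coordDeriv (chart D) 3 k x = 0 := by
  have hc : ∀ s, Function.update x 3 s ∈ chart D := fun s => by
    simp [chart] at hx ⊢; tauto
  have hk : (fun s => k (Function.update x 3 s)) = fun _ => A (x 0, x 1) * B (x 2) := by
    ext s; rw [h _ (hc s)]; simp
  rw [coordDeriv, hk, derivWithin_fun_const]; rfl

theorem sin_pos_of_mem_chart (hx : x ∈ chart D) : 0 < Real.sin (x 2) :=
  Real.sin_pos_of_pos_of_lt_pi hx.2.1 hx.2.2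

variable {r W : ℝ × ℝ → ℝ}

/-- The inverse of the spherically symmetric metric. -/
noncomputable def metricInv (r W : ℝ × ℝ → ℝ) (x : Fin 4 → ℝ) : Matrix (Fin 4) (Fin 4) ℝ :=
  !![0, -2 / lift W x, 0, 0;
     -2 / lift W x, 0, 0, 0;
     0, 0, 1 / (lift r x) ^ 2, 0;
     0, 0, 0, 1 / ((lift r x) ^ 2 * Real.sin (x 2) ^ 2)]

theorem metric_inv (hr : lift r x ≠ 0) (hW : lift W x ≠ 0) (hs : Real.sin (x 2) ≠ 0) :
    (metric r W x)⁻¹ = metricInv r W x := by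
  apply Matrix.inv_eq_right_inv
  ext i j
  fin_cases i <;> fin_cases j <;>
    simp [metric, metricInv, Matrix.mul_apply, Fin.sum_univ_four] <;> field_simp

theorem tensorSq_maxwell (Q : ℝ) (hr : lift r x ≠ 0) (hW : lift W x ≠ 0)
    (hs : Real.sin (x 2) ≠ 0) :
    tensorSq (metric r W) (maxwell Q r W) x = -2 * Q ^ 2 / lift r x ^ 4 := by
  simp only [tensorSq, metric_inv hr hW hs]
  simp [metricInv, maxwell, Fin.sum_univ_four]
  field_simp
  ring

theorem gradSq_lift (hx : x ∈ chart D) (hr : lift r x ≠ 0) (hW : lift W x ≠ 0) (f : ℝ × ℝ → ℝ) :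
    gradSq (chart D) (metric r W) (lift f) x =
      -4 * (lift W x)⁻¹ * du D f (x 0, x 1) * dv D f (x 0, x 1) := by
  have h : ∀ y ∈ chart D, lift f y = f (y 0, y 1) * (fun _ : ℝ => (1 : ℝ)) (y 2) :=
    fun y _ => by simp [lift]
  have h0 := coordDeriv_zero_of_eq (B := fun _ => 1) hx h
  have h1 := coordDeriv_one_of_eq (B := fun _ => 1) hx h
  have h2 := coordDeriv_two_of_eq (B := fun _ => 1) hx h
  have h3 := coordDeriv_three_of_eq (B := fun _ => 1) hx h
  simp only [deriv_const, mul_zero, mul_one] at h0 h1 h2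
  simp only [gradSq, metric_inv hr hW (sin_pos_of_mem_chart hx).ne', Fin.sum_univ_four,
    h0, h1, h2, h3]
  simp [metricInv]
  ring

/-- The derivatives of the components of the metric. -/
noncomputable def metricDeriv (r ru rv Wu Wv : ℝ) (θ : ℝ) (i : Fin 4) : Matrix (Fin 4) (Fin 4) ℝ :=
  !![0, ![-Wu / 2, -Wv / 2, 0, 0] i, 0, 0;
     ![-Wu / 2, -Wv / 2, 0, 0] i, 0, 0, 0;
     0, 0, ![2 * r * ru, 2 * r * rv, 0, 0] i, 0;
     0, 0, 0, ![2 * r * ru * Real.sin θ ^ 2, 2 * r * rv * Real.sin θ ^ 2,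
      r ^ 2 * (2 * Real.sin θ * Real.cos θ), 0] i]

/-- The Christoffel symbols `Γ^k_{ij}`, as matrices with row index `k` and column index `j`, in
terms of the values at a point of `W`, of `rᵤ / r`, `rᵥ / r`, `Wᵤ / W`, `Wᵥ / W` and of
`2 r rᵤ / W`, `2 r rᵥ / W`. -/
noncomputable def christoffelMatrix (ρu ρv ωu ωv σu σv : ℝ) (θ : ℝ) : Fin 4 → Matrix (Fin 4) (Fin 4) ℝ :=
  ![!![ωu, 0, 0, 0; 0, 0, 0, 0; 0, 0, ρu, 0; 0, 0, 0, ρu],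
    !![0, 0, 0, 0; 0, ωv, 0, 0; 0, 0, ρv, 0; 0, 0, 0, ρv],
    !![0, 0, σv, 0; 0, 0, σu, 0; ρu, ρv, 0, 0; 0, 0, 0, Real.cos θ / Real.sin θ],
    !![0, 0, 0, σv * Real.sin θ ^ 2; 0, 0, 0, σu * Real.sin θ ^ 2;
      0, 0, 0, -(Real.sin θ * Real.cos θ); ρu, ρv, Real.cos θ / Real.sin θ, 0]]

theorem coordDeriv_eq_of_eq (hx : x ∈ chart D) {a b c : ℝ}
    (h : ∀ y ∈ chart D, k y = A (y 0, y 1) * B (y 2))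
    (ha : du D A (x 0, x 1) * B (x 2) = a) (hb : dv D A (x 0, x 1) * B (x 2) = b)
    (hc : A (x 0, x 1) * deriv B (x 2) = c) (i : Fin 4) :
    coordDeriv (chart D) i k x = ![a, b, c, 0] i := by
  revert i
  refine forall_fin_four ?_ ?_ ?_ ?_
  · exact (coordDeriv_zero_of_eq hx h).trans ha
  · exact (coordDeriv_one_of_eq hx h).trans hb
  · exact (coordDeriv_two_of_eq hx h).trans hc
  · exact (coordDeriv_three_of_eq hx h)

theorem coordDeriv_fun_zero (i : Fin 4) :
    coordDeriv (chart D) i (fun _ => 0) x = 0 := by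
  rw [coordDeriv, derivWithin_fun_const]; rfl

theorem coordDeriv_metric {ru rv Wu Wv : ℝ} (hx : x ∈ chart D)
    (hru : du D (fun p => r p ^ 2) (x 0, x 1) = 2 * lift r x * ru)
    (hrv : dv D (fun p => r p ^ 2) (x 0, x 1) = 2 * lift r x * rv)
    (hWu : du D (fun p => -W p / 2) (x 0, x 1) = -Wu / 2)
    (hWv : dv D (fun p => -W p / 2) (x 0, x 1) = -Wv / 2) (i j l : Fin 4) :
    coordDeriv (chart D) i (fun y => metric r W y j l) x =
      metricDeriv (lift r x) ru rv Wu Wv (x 2) i j l := by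
  have h0 : coordDeriv (chart D) i (fun _ => 0) x = 0 := coordDeriv_fun_zero i
  have hW := coordDeriv_eq_of_eq (k := fun y => -(lift W y) / 2) (A := fun p => -W p / 2)
    (B := fun _ => 1) (a := -Wu / 2) (b := -Wv / 2) (c := 0) hx
    (fun y _ => by simp [lift]) (by simp [hWu]) (by simp [hWv]) (by simp) i
  have h2 := coordDeriv_eq_of_eq (k := fun y => (lift r y) ^ 2) (A := fun p => r p ^ 2)
    (B := fun _ => 1) (a := 2 * lift r x * ru) (b := 2 * lift r x * rv) (c := 0) hx
    (fun y _ => by simp [lift]) (by simp [hru]) (by simp [hrv]) (by simp) i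
  have h3 := coordDeriv_eq_of_eq (k := fun y => (lift r y) ^ 2 * Real.sin (y 2) ^ 2)
    (A := fun p => r p ^ 2) (B := fun θ => Real.sin θ ^ 2)
    (a := 2 * lift r x * ru * Real.sin (x 2) ^ 2) (b := 2 * lift r x * rv * Real.sin (x 2) ^ 2)
    (c := lift r x ^ 2 * (2 * Real.sin (x 2) * Real.cos (x 2))) hx
    (fun y _ => by simp [lift]) (by simp [hru]) (by simp [hrv])
    (by simp [lift]) i
  revert j l
  refine forall_fin_four ?_ ?_ ?_ ?_ <;> refine forall_fin_four ?_ ?_ ?_ ?_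
  exacts [h0, hW, h0, h0, hW, h0, h0, h0, h0, h0, h2, h0, h0, h0, h0, h3]

theorem christoffel_metric {ru rv Wu Wv : ℝ} (hx : x ∈ chart D)
    (hr : lift r x ≠ 0) (hW : lift W x ≠ 0)
    (hru : du D (fun p => r p ^ 2) (x 0, x 1) = 2 * lift r x * ru)
    (hrv : dv D (fun p => r p ^ 2) (x 0, x 1) = 2 * lift r x * rv)
    (hWu : du D (fun p => -W p / 2) (x 0, x 1) = -Wu / 2)
    (hWv : dv D (fun p => -W p / 2) (x 0, x 1) = -Wv / 2) (i j k : Fin 4) :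
    christoffel (chart D) (metric r W) k i j x =
      christoffelMatrix (ru / lift r x) (rv / lift r x) (Wu / lift W x) (Wv / lift W x)
        (2 * lift r x * ru / lift W x) (2 * lift r x * rv / lift W x) (x 2) i k j := by
  have hs := (sin_pos_of_mem_chart hx).ne'
  simp only [christoffel, metric_inv hr hW hs, metricInv, coordDeriv_metric hx hru hrv hWu hWv,
    Fin.sum_univ_four]
  clear hru hrv hWu hWv
  generalize lift r x = r at *
  generalize lift W x = W at *
  generalize x 2 = θ at *
  revert i j k
  refine forall_fin_four ?_ ?_ ?_ ?_ <;> refine forall_fin_four ?_ ?_ ?_ ?_ <;>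
    refine forall_fin_four ?_ ?_ ?_ ?_ <;>
    simp [metricDeriv, christoffelMatrix] <;> field_simp

/-- The derivatives of the Christoffel symbols, in terms of the gradients of the functions that
occur in `christoffelMatrix`. -/
noncomputable def christoffelDeriv (σu σv : ℝ) (ρu' ρv' ωu' ωv' σu' σv' : Fin 4 → ℝ) (θ : ℝ)
    (c : Fin 4) : Fin 4 → Matrix (Fin 4) (Fin 4) ℝ :=
  ![!![ωu' c, 0, 0, 0; 0, 0, 0, 0; 0, 0, ρu' c, 0; 0, 0, 0, ρu' c],
    !![0, 0, 0, 0; 0, ωv' c, 0, 0; 0, 0, ρv' c, 0; 0, 0, 0, ρv' c],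
    !![0, 0, σv' c, 0; 0, 0, σu' c, 0; ρu' c, ρv' c, 0, 0;
      0, 0, 0, ![0, 0, -1 / Real.sin θ ^ 2, 0] c],
    !![0, 0, 0, ![σv' 0 * Real.sin θ ^ 2, σv' 1 * Real.sin θ ^ 2,
          σv * (2 * Real.sin θ * Real.cos θ), 0] c;
      0, 0, 0, ![σu' 0 * Real.sin θ ^ 2, σu' 1 * Real.sin θ ^ 2,
          σu * (2 * Real.sin θ * Real.cos θ), 0] c;
      0, 0, 0, ![0, 0, 2 * Real.sin θ ^ 2 - 1, 0] c;
      ρu' c, ρv' c, ![0, 0, -1 / Real.sin θ ^ 2, 0] c, 0]]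

theorem coordDeriv_christoffel {g : (Fin 4 → ℝ) → Matrix (Fin 4) (Fin 4) ℝ}
    {ρu ρv ωu ωv σu σv : ℝ × ℝ → ℝ} (hx : x ∈ chart D)
    (hΓ : ∀ y ∈ chart D, ∀ i j k, christoffel (chart D) g k i j y =
      christoffelMatrix (ρu (y 0, y 1)) (ρv (y 0, y 1)) (ωu (y 0, y 1)) (ωv (y 0, y 1))
        (σu (y 0, y 1)) (σv (y 0, y 1)) (y 2) i k j) (c i j k : Fin 4) :
    coordDeriv (chart D) c (christoffel (chart D) g k i j) x =
      christoffelDeriv (σu (x 0, x 1)) (σv (x 0, x 1))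
        ![du D ρu (x 0, x 1), dv D ρu (x 0, x 1), 0, 0]
        ![du D ρv (x 0, x 1), dv D ρv (x 0, x 1), 0, 0]
        ![du D ωu (x 0, x 1), dv D ωu (x 0, x 1), 0, 0]
        ![du D ωv (x 0, x 1), dv D ωv (x 0, x 1), 0, 0]
        ![du D σu (x 0, x 1), dv D σu (x 0, x 1), 0, 0]
        ![du D σv (x 0, x 1), dv D σv (x 0, x 1), 0, 0] (x 2) c i k j := by
  have hs := (sin_pos_of_mem_chart hx).ne'
  have h1 : ∀ A : ℝ × ℝ → ℝ,
      (∀ y ∈ chart D, christoffel (chart D) g k i j y = A (y 0, y 1)) →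
      coordDeriv (chart D) c (christoffel (chart D) g k i j) x =
        ![du D A (x 0, x 1), dv D A (x 0, x 1), 0, 0] c := fun A h =>
    coordDeriv_eq_of_eq (A := A) (B := fun _ => 1) hx (fun y hy => by rw [h y hy, mul_one])
      (by simp) (by simp) (by simp) c
  have h0 : (∀ y ∈ chart D, christoffel (chart D) g k i j y = 0) →
      coordDeriv (chart D) c (christoffel (chart D) g k i j) x = 0 := fun h => by
    rw [h1 (fun _ => 0) h]
    revert c
    refine forall_fin_four ?_ ?_ ?_ ?_ <;> simp [du, dv]
  have h2 : ∀ A : ℝ × ℝ → ℝ,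
      (∀ y ∈ chart D, christoffel (chart D) g k i j y = A (y 0, y 1) * Real.sin (y 2) ^ 2) →
      coordDeriv (chart D) c (christoffel (chart D) g k i j) x =
        ![du D A (x 0, x 1) * Real.sin (x 2) ^ 2, dv D A (x 0, x 1) * Real.sin (x 2) ^ 2,
          A (x 0, x 1) * (2 * Real.sin (x 2) * Real.cos (x 2)), 0] c := fun A h =>
    coordDeriv_eq_of_eq (A := A) (B := fun θ => Real.sin θ ^ 2) hx h
      rfl rfl (by simp) c
  have h3 : (∀ y ∈ chart D, christoffel (chart D) g k i j y = Real.cos (y 2) / Real.sin (y 2)) →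
      coordDeriv (chart D) c (christoffel (chart D) g k i j) x =
        ![0, 0, -1 / Real.sin (x 2) ^ 2, 0] c := fun h =>
    coordDeriv_eq_of_eq (A := fun _ => 1) (B := fun θ => Real.cos θ / Real.sin θ) hx
      (fun y hy => by rw [h y hy, one_mul]) (by simp [du]) (by simp [dv]) (by
        have := (Real.hasDerivAt_cos (x 2)).div (Real.hasDerivAt_sin (x 2)) hs
        have e : deriv (fun θ => Real.cos θ / Real.sin θ) (x 2) = _ := this.deriv
        rw [e, one_mul]
        congr 1
        linear_combination -Real.sin_sq_add_cos_sq (x 2)) c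
  have h4 : (∀ y ∈ chart D, christoffel (chart D) g k i j y =
        -(Real.sin (y 2) * Real.cos (y 2))) →
      coordDeriv (chart D) c (christoffel (chart D) g k i j) x =
        ![0, 0, 2 * Real.sin (x 2) ^ 2 - 1, 0] c := fun h =>
    coordDeriv_eq_of_eq (A := fun _ => 1) (B := fun θ => -(Real.sin θ * Real.cos θ)) hx
      (fun y hy => by rw [h y hy, one_mul]) (by simp [du]) (by simp [dv]) (by
        have := ((Real.hasDerivAt_sin (x 2)).mul (Real.hasDerivAt_cos (x 2))).neg
        have e : deriv (fun θ => -(Real.sin θ * Real.cos θ)) (x 2) = _ := this.deriv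
        rw [e, one_mul]
        linear_combination -Real.sin_sq_add_cos_sq (x 2)) c
  have hΓ' := fun y hy => hΓ y hy i j k
  clear hΓ
  revert i j k
  refine forall_fin_four ?_ ?_ ?_ ?_ <;> refine forall_fin_four ?_ ?_ ?_ ?_ <;>
    refine forall_fin_four ?_ ?_ ?_ ?_ <;> intro h1 h0 h2 h3 h4 h
  exacts [h1 _ h, h0 h, h0 h, h0 h, h0 h, h0 h, h0 h, h0 h,
    h0 h, h0 h, h1 _ h, h0 h, h0 h, h0 h, h0 h, h1 _ h,
    h0 h, h0 h, h0 h, h0 h, h0 h, h1 _ h, h0 h, h0 h,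
    h0 h, h0 h, h1 _ h, h0 h, h0 h, h0 h, h0 h, h1 _ h,
    h0 h, h0 h, h1 _ h, h0 h, h0 h, h0 h, h1 _ h, h0 h,
    h1 _ h, h1 _ h, h0 h, h0 h, h0 h, h0 h, h0 h, h3 h,
    h0 h, h0 h, h0 h, h1 _ h, h0 h, h0 h, h0 h, h1 _ h,
    h0 h, h0 h, h0 h, h3 h, h2 _ h, h2 _ h, h4 h, h0 h]

/-! ### Riemann tensor and Kretschmann scalar of a spherically symmetric metric. -/

/-- The curvature forms `R_{ab}` of a spherically symmetric metric, with `s = sin² θ`. -/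
noncomputable def curvatureForm (r W huu huv hvv ω μ s : ℝ) :
    Fin 4 → Fin 4 → Matrix (Fin 4) (Fin 4) ℝ :=
  let R01 : Matrix (Fin 4) (Fin 4) ℝ :=
    !![0, -(W * ω) / 2, 0, 0; W * ω / 2, 0, 0, 0; 0, 0, 0, 0; 0, 0, 0, 0]
  let R02 : Matrix (Fin 4) (Fin 4) ℝ :=
    !![0, 0, -(r * huu), 0; 0, 0, -(r * huv), 0; r * huu, r * huv, 0, 0; 0, 0, 0, 0]
  let R12 : Matrix (Fin 4) (Fin 4) ℝ :=
    !![0, 0, -(r * huv), 0; 0, 0, -(r * hvv), 0; r * huv, r * hvv, 0, 0; 0, 0, 0, 0]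
  let R03 : Matrix (Fin 4) (Fin 4) ℝ :=
    !![0, 0, 0, -(r * huu * s); 0, 0, 0, -(r * huv * s); 0, 0, 0, 0;
      r * huu * s, r * huv * s, 0, 0]
  let R13 : Matrix (Fin 4) (Fin 4) ℝ :=
    !![0, 0, 0, -(r * huv * s); 0, 0, 0, -(r * hvv * s); 0, 0, 0, 0;
      r * huv * s, r * hvv * s, 0, 0]
  let R23 : Matrix (Fin 4) (Fin 4) ℝ :=
    !![0, 0, 0, 0; 0, 0, 0, 0; 0, 0, 0, r ^ 2 * s * μ; 0, 0, -(r ^ 2 * s * μ), 0]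
  ![![0, R01, R02, R03], ![-R01, 0, R12, R13], ![-R02, -R12, 0, R23], ![-R03, -R13, -R23, 0]]

section CurvatureForm

variable {W huu huv hvv ω μ s r : ℝ}

theorem curvatureForm_zero_one : curvatureForm r W huu huv hvv ω μ s 0 1 =
    !![0, -(W * ω) / 2, 0, 0; W * ω / 2, 0, 0, 0; 0, 0, 0, 0; 0, 0, 0, 0] := rfl

theorem curvatureForm_zero_two : curvatureForm r W huu huv hvv ω μ s 0 2 =
    !![0, 0, -(r * huu), 0; 0, 0, -(r * huv), 0; r * huu, r * huv, 0, 0; 0, 0, 0, 0] := rfl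

theorem curvatureForm_one_two : curvatureForm r W huu huv hvv ω μ s 1 2 =
    !![0, 0, -(r * huv), 0; 0, 0, -(r * hvv), 0; r * huv, r * hvv, 0, 0; 0, 0, 0, 0] := rfl

theorem curvatureForm_zero_three : curvatureForm r W huu huv hvv ω μ s 0 3 =
    !![0, 0, 0, -(r * huu * s); 0, 0, 0, -(r * huv * s); 0, 0, 0, 0;
      r * huu * s, r * huv * s, 0, 0] := rfl

theorem curvatureForm_one_three : curvatureForm r W huu huv hvv ω μ s 1 3 =
    !![0, 0, 0, -(r * huv * s); 0, 0, 0, -(r * hvv * s); 0, 0, 0, 0;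
      r * huv * s, r * hvv * s, 0, 0] := rfl

theorem curvatureForm_two_three : curvatureForm r W huu huv hvv ω μ s 2 3 =
    !![0, 0, 0, 0; 0, 0, 0, 0; 0, 0, 0, r ^ 2 * s * μ; 0, 0, -(r ^ 2 * s * μ), 0] := rfl

theorem curvatureForm_one_zero : curvatureForm r W huu huv hvv ω μ s 1 0 =
    -!![0, -(W * ω) / 2, 0, 0; W * ω / 2, 0, 0, 0; 0, 0, 0, 0; 0, 0, 0, 0] := rfl

theorem curvatureForm_two_zero : curvatureForm r W huu huv hvv ω μ s 2 0 =
    -!![0, 0, -(r * huu), 0; 0, 0, -(r * huv), 0; r * huu, r * huv, 0, 0; 0, 0, 0, 0] := rfl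

theorem curvatureForm_two_one : curvatureForm r W huu huv hvv ω μ s 2 1 =
    -!![0, 0, -(r * huv), 0; 0, 0, -(r * hvv), 0; r * huv, r * hvv, 0, 0; 0, 0, 0, 0] := rfl

theorem curvatureForm_three_zero : curvatureForm r W huu huv hvv ω μ s 3 0 =
    -!![0, 0, 0, -(r * huu * s); 0, 0, 0, -(r * huv * s); 0, 0, 0, 0;
      r * huu * s, r * huv * s, 0, 0] := rfl

theorem curvatureForm_three_one : curvatureForm r W huu huv hvv ω μ s 3 1 =
    -!![0, 0, 0, -(r * huv * s); 0, 0, 0, -(r * hvv * s); 0, 0, 0, 0;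
      r * huv * s, r * hvv * s, 0, 0] := rfl

theorem curvatureForm_three_two : curvatureForm r W huu huv hvv ω μ s 3 2 =
    -!![0, 0, 0, 0; 0, 0, 0, 0; 0, 0, 0, r ^ 2 * s * μ; 0, 0, -(r ^ 2 * s * μ), 0] := rfl

theorem curvatureForm_self (c : Fin 4) : curvatureForm r W huu huv hvv ω μ s c c = 0 := by
  revert c
  exact forall_fin_four rfl rfl rfl rfl

end CurvatureForm

/-- Reduces the computation to the six index pairs `c < d`. -/
theorem riemann_antisymm {U : Set (Fin 4 → ℝ)} {g : (Fin 4 → ℝ) → Matrix (Fin 4) (Fin 4) ℝ}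
    (a b c d : Fin 4) : riemann U g a b c d x = -riemann U g a b d c x := by
  simp only [riemann, riemannUp, ← Finset.sum_neg_distrib]
  refine Finset.sum_congr rfl fun e _ => ?_
  rw [← mul_neg]
  congr 1
  simp only [Finset.sum_sub_distrib]
  ring

section RiemannUp

variable {g : (Fin 4 → ℝ) → Matrix (Fin 4) (Fin 4) ℝ}
    {ρu ρv ωu ωv σu σv ρuu ρuv ρvu ρvv ωuu ωuv ωvu ωvv σuu σuv σvu σvv θ : ℝ}

theorem riemannUp_zero_one
    (hΓ : ∀ i j k, christoffel (chart D) g k i j x =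
      christoffelMatrix ρu ρv ωu ωv σu σv θ i k j)
    (hdΓ : ∀ c i j k, coordDeriv (chart D) c (christoffel (chart D) g k i j) x =
      christoffelDeriv σu σv ![ρuu, ρuv, 0, 0] ![ρvu, ρvv, 0, 0] ![ωuu, ωuv, 0, 0]
        ![ωvu, ωvv, 0, 0] ![σuu, σuv, 0, 0] ![σvu, σvv, 0, 0] θ c i k j)
    (a b : Fin 4) : riemannUp (chart D) g a b 0 1 x =
    (!![-ωuv, 0, 0, 0; 0, ωvu, 0, 0; 0, 0, ρvu - ρuv, 0; 0, 0, 0, ρvu - ρuv] : Matrix (Fin 4) (Fin 4) ℝ) a b := by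
  simp only [riemannUp, hΓ, hdΓ, Fin.sum_univ_four]
  clear hΓ hdΓ
  revert a b
  refine forall_fin_four ?_ ?_ ?_ ?_ <;> refine forall_fin_four ?_ ?_ ?_ ?_ <;>
    simp [christoffelMatrix, christoffelDeriv, -mul_eq_zero] <;> try ring

theorem riemannUp_zero_two
    (hΓ : ∀ i j k, christoffel (chart D) g k i j x =
      christoffelMatrix ρu ρv ωu ωv σu σv θ i k j)
    (hdΓ : ∀ c i j k, coordDeriv (chart D) c (christoffel (chart D) g k i j) x =
      christoffelDeriv σu σv ![ρuu, ρuv, 0, 0] ![ρvu, ρvv, 0, 0] ![ωuu, ωuv, 0, 0]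
        ![ωvu, ωvv, 0, 0] ![σuu, σuv, 0, 0] ![σvu, σvv, 0, 0] θ c i k j)
    (a b : Fin 4) : riemannUp (chart D) g a b 0 2 x =
    (!![0, 0, σvu + ωu * σv - σv * ρu, 0; 0, 0, σuu - σu * ρu, 0;
      ρuu + ρu * ρu - ρu * ωu, ρvu + ρu * ρv, 0, 0; 0, 0, 0, 0] : Matrix (Fin 4) (Fin 4) ℝ) a b := by
  simp only [riemannUp, hΓ, hdΓ, Fin.sum_univ_four]
  clear hΓ hdΓ
  revert a b
  refine forall_fin_four ?_ ?_ ?_ ?_ <;> refine forall_fin_four ?_ ?_ ?_ ?_ <;>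
    simp [christoffelMatrix, christoffelDeriv, -mul_eq_zero] <;> try ring

theorem riemannUp_one_two
    (hΓ : ∀ i j k, christoffel (chart D) g k i j x =
      christoffelMatrix ρu ρv ωu ωv σu σv θ i k j)
    (hdΓ : ∀ c i j k, coordDeriv (chart D) c (christoffel (chart D) g k i j) x =
      christoffelDeriv σu σv ![ρuu, ρuv, 0, 0] ![ρvu, ρvv, 0, 0] ![ωuu, ωuv, 0, 0]
        ![ωvu, ωvv, 0, 0] ![σuu, σuv, 0, 0] ![σvu, σvv, 0, 0] θ c i k j)
    (a b : Fin 4) : riemannUp (chart D) g a b 1 2 x =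
    (!![0, 0, σvv - σv * ρv, 0; 0, 0, σuv + ωv * σu - σu * ρv, 0;
      ρuv + ρv * ρu, ρvv + ρv * ρv - ρv * ωv, 0, 0; 0, 0, 0, 0] : Matrix (Fin 4) (Fin 4) ℝ) a b := by
  simp only [riemannUp, hΓ, hdΓ, Fin.sum_univ_four]
  clear hΓ hdΓ
  revert a b
  refine forall_fin_four ?_ ?_ ?_ ?_ <;> refine forall_fin_four ?_ ?_ ?_ ?_ <;>
    simp [christoffelMatrix, christoffelDeriv, -mul_eq_zero] <;> try ring

theorem riemannUp_zero_three
    (hΓ : ∀ i j k, christoffel (chart D) g k i j x =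
      christoffelMatrix ρu ρv ωu ωv σu σv θ i k j)
    (hdΓ : ∀ c i j k, coordDeriv (chart D) c (christoffel (chart D) g k i j) x =
      christoffelDeriv σu σv ![ρuu, ρuv, 0, 0] ![ρvu, ρvv, 0, 0] ![ωuu, ωuv, 0, 0]
        ![ωvu, ωvv, 0, 0] ![σuu, σuv, 0, 0] ![σvu, σvv, 0, 0] θ c i k j)
    (a b : Fin 4) : riemannUp (chart D) g a b 0 3 x =
    (!![0, 0, 0, Real.sin θ ^ 2 * (σvu + ωu * σv - σv * ρu);
      0, 0, 0, Real.sin θ ^ 2 * (σuu - σu * ρu); 0, 0, 0, 0;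
      ρuu + ρu * ρu - ρu * ωu, ρvu + ρu * ρv, 0, 0] : Matrix (Fin 4) (Fin 4) ℝ) a b := by
  simp only [riemannUp, hΓ, hdΓ, Fin.sum_univ_four]
  clear hΓ hdΓ
  revert a b
  refine forall_fin_four ?_ ?_ ?_ ?_ <;> refine forall_fin_four ?_ ?_ ?_ ?_ <;>
    simp [christoffelMatrix, christoffelDeriv, -mul_eq_zero] <;> try ring

theorem riemannUp_one_three
    (hΓ : ∀ i j k, christoffel (chart D) g k i j x =
      christoffelMatrix ρu ρv ωu ωv σu σv θ i k j)
    (hdΓ : ∀ c i j k, coordDeriv (chart D) c (christoffel (chart D) g k i j) x =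
      christoffelDeriv σu σv ![ρuu, ρuv, 0, 0] ![ρvu, ρvv, 0, 0] ![ωuu, ωuv, 0, 0]
        ![ωvu, ωvv, 0, 0] ![σuu, σuv, 0, 0] ![σvu, σvv, 0, 0] θ c i k j)
    (a b : Fin 4) : riemannUp (chart D) g a b 1 3 x =
    (!![0, 0, 0, Real.sin θ ^ 2 * (σvv - σv * ρv);
      0, 0, 0, Real.sin θ ^ 2 * (σuv + ωv * σu - σu * ρv); 0, 0, 0, 0;
      ρuv + ρv * ρu, ρvv + ρv * ρv - ρv * ωv, 0, 0] : Matrix (Fin 4) (Fin 4) ℝ) a b := by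
  simp only [riemannUp, hΓ, hdΓ, Fin.sum_univ_four]
  clear hΓ hdΓ
  revert a b
  refine forall_fin_four ?_ ?_ ?_ ?_ <;> refine forall_fin_four ?_ ?_ ?_ ?_ <;>
    simp [christoffelMatrix, christoffelDeriv, -mul_eq_zero] <;> try ring

theorem riemannUp_two_three (hs : Real.sin θ ≠ 0)
    (hΓ : ∀ i j k, christoffel (chart D) g k i j x =
      christoffelMatrix ρu ρv ωu ωv σu σv θ i k j)
    (hdΓ : ∀ c i j k, coordDeriv (chart D) c (christoffel (chart D) g k i j) x =
      christoffelDeriv σu σv ![ρuu, ρuv, 0, 0] ![ρvu, ρvv, 0, 0] ![ωuu, ωuv, 0, 0]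
        ![ωvu, ωvv, 0, 0] ![σuu, σuv, 0, 0] ![σvu, σvv, 0, 0] θ c i k j)
    (a b : Fin 4) : riemannUp (chart D) g a b 2 3 x =
    (!![0, 0, 0, 0; 0, 0, 0, 0; 0, 0, 0, Real.sin θ ^ 2 * (1 + ρu * σv + ρv * σu);
      0, 0, -(1 + ρu * σv + ρv * σu), 0] : Matrix (Fin 4) (Fin 4) ℝ) a b := by
  simp only [riemannUp, hΓ, hdΓ, Fin.sum_univ_four]
  clear hΓ hdΓ
  revert a b
  refine forall_fin_four ?_ ?_ ?_ ?_ <;> refine forall_fin_four ?_ ?_ ?_ ?_ <;>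
    simp [christoffelMatrix, christoffelDeriv, -mul_eq_zero] <;> field_simp <;>
    (try ring_nf) <;> (try simp only [Real.cos_sq']) <;> (try ring)

end RiemannUp

/-- The arguments passed to `curvatureForm` are geometric: `ruu - ru * Wu / W`, `ruv` and `rvv - rv
* Wv / W` form the Hessian of `r` in the two-dimensional quotient, `ω` is the common value of both
mixed derivatives of `log W`, and `1 + 4 * ru * rv / W` is `1 - g(∇r, ∇r)`. -/
theorem riemann_metric {g : (Fin 4 → ℝ) → Matrix (Fin 4) (Fin 4) ℝ}
    {r W ru rv Wu Wv ruu ruv rvv ω ωuu ωvv θ : ℝ}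
    (hr : r ≠ 0) (hW : W ≠ 0) (hs : Real.sin θ ≠ 0)
    (hg : g x = !![0, -W / 2, 0, 0; -W / 2, 0, 0, 0; 0, 0, r ^ 2, 0;
      0, 0, 0, r ^ 2 * Real.sin θ ^ 2])
    (hΓ : ∀ i j k, christoffel (chart D) g k i j x =
      christoffelMatrix (ru / r) (rv / r) (Wu / W) (Wv / W) (2 * r * ru / W) (2 * r * rv / W) θ
        i k j)
    (hdΓ : ∀ c i j k, coordDeriv (chart D) c (christoffel (chart D) g k i j) x =
      christoffelDeriv (2 * r * ru / W) (2 * r * rv / W)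
        ![ruu / r - ru ^ 2 / r ^ 2, ruv / r - ru * rv / r ^ 2, 0, 0]
        ![ruv / r - ru * rv / r ^ 2, rvv / r - rv ^ 2 / r ^ 2, 0, 0]
        ![ωuu, ω, 0, 0] ![ω, ωvv, 0, 0]
        ![2 * (ru ^ 2 + r * ruu) / W - 2 * r * ru * Wu / W ^ 2,
          2 * (ru * rv + r * ruv) / W - 2 * r * ru * Wv / W ^ 2, 0, 0]
        ![2 * (ru * rv + r * ruv) / W - 2 * r * rv * Wu / W ^ 2,
          2 * (rv ^ 2 + r * rvv) / W - 2 * r * rv * Wv / W ^ 2, 0, 0] θ c i k j)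
    (a b c d : Fin 4) :
    riemann (chart D) g a b c d x =
      curvatureForm r W (ruu - ru * Wu / W) ruv (rvv - rv * Wv / W) ω (1 + 4 * ru * rv / W)
        (Real.sin θ ^ 2) c d a b := by
  set R := curvatureForm r W (ruu - ru * Wu / W) ruv (rvv - rv * Wv / W) ω
    (1 + 4 * ru * rv / W) (Real.sin θ ^ 2) with hR
  have hself : ∀ c, riemann (chart D) g a b c c x = R c c a b := fun c => by
    have := riemann_antisymm (U := chart D) (g := g) (x := x) a b c c
    rw [hR, curvatureForm_self, Matrix.zero_apply]
    linarith
  have h01 : ∀ a b, riemann (chart D) g a b 0 1 x = R 0 1 a b := by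
    simp only [riemann, hg, Fin.sum_univ_four, riemannUp_zero_one hΓ hdΓ, hR,
      curvatureForm_zero_one]
    clear hΓ hdΓ hg hself hR
    refine forall_fin_four ?_ ?_ ?_ ?_ <;> refine forall_fin_four ?_ ?_ ?_ ?_ <;>
      simp [-mul_eq_zero] <;> try (field_simp; try ring)
  have h02 : ∀ a b, riemann (chart D) g a b 0 2 x = R 0 2 a b := by
    simp only [riemann, hg, Fin.sum_univ_four, riemannUp_zero_two hΓ hdΓ, hR,
      curvatureForm_zero_two]
    clear hΓ hdΓ hg hself hR
    refine forall_fin_four ?_ ?_ ?_ ?_ <;> refine forall_fin_four ?_ ?_ ?_ ?_ <;>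
      simp [-mul_eq_zero] <;> try (field_simp; try ring)
  have h03 : ∀ a b, riemann (chart D) g a b 0 3 x = R 0 3 a b := by
    simp only [riemann, hg, Fin.sum_univ_four, riemannUp_zero_three hΓ hdΓ, hR,
      curvatureForm_zero_three]
    clear hΓ hdΓ hg hself hR
    refine forall_fin_four ?_ ?_ ?_ ?_ <;> refine forall_fin_four ?_ ?_ ?_ ?_ <;>
      simp [-mul_eq_zero] <;> try (field_simp; try ring)
  have h12 : ∀ a b, riemann (chart D) g a b 1 2 x = R 1 2 a b := by
    simp only [riemann, hg, Fin.sum_univ_four, riemannUp_one_two hΓ hdΓ, hR,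
      curvatureForm_one_two]
    clear hΓ hdΓ hg hself hR
    refine forall_fin_four ?_ ?_ ?_ ?_ <;> refine forall_fin_four ?_ ?_ ?_ ?_ <;>
      simp [-mul_eq_zero] <;> try (field_simp; try ring)
  have h13 : ∀ a b, riemann (chart D) g a b 1 3 x = R 1 3 a b := by
    simp only [riemann, hg, Fin.sum_univ_four, riemannUp_one_three hΓ hdΓ, hR,
      curvatureForm_one_three]
    clear hΓ hdΓ hg hself hR
    refine forall_fin_four ?_ ?_ ?_ ?_ <;> refine forall_fin_four ?_ ?_ ?_ ?_ <;>
      simp [-mul_eq_zero] <;> try (field_simp; try ring)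
  have h23 : ∀ a b, riemann (chart D) g a b 2 3 x = R 2 3 a b := by
    simp only [riemann, hg, Fin.sum_univ_four, riemannUp_two_three hs hΓ hdΓ, hR,
      curvatureForm_two_three]
    clear hΓ hdΓ hg hself hR
    refine forall_fin_four ?_ ?_ ?_ ?_ <;> refine forall_fin_four ?_ ?_ ?_ ?_ <;>
      simp [-mul_eq_zero] <;> try (field_simp; try ring)
  have hneg : ∀ c d, R d c = -R c d → (∀ a b, riemann (chart D) g a b c d x = R c d a b) →
      riemann (chart D) g a b d c x = R d c a b := fun c d e h => by
    rw [riemann_antisymm, h, e, Matrix.neg_apply]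
  clear hΓ hdΓ hg
  revert c d
  refine forall_fin_four ?_ ?_ ?_ ?_ <;> refine forall_fin_four ?_ ?_ ?_ ?_
  exacts [hself 0, h01 a b, h02 a b, h03 a b, hneg 0 1 rfl h01, hself 1, h12 a b, h13 a b,
    hneg 0 2 rfl h02, hneg 1 2 rfl h12, hself 2, h23 a b, hneg 0 3 rfl h03, hneg 1 3 rfl h13,
    hneg 2 3 rfl h23, hself 3]

theorem kretschmann_eq {U : Set (Fin 4 → ℝ)} {g : (Fin 4 → ℝ) → Matrix (Fin 4) (Fin 4) ℝ}
    {r W huu huv hvv ω μ s : ℝ} (hr : r ≠ 0) (hW : W ≠ 0) (hs : s ≠ 0)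
    (hg : (g x)⁻¹ = !![0, -2 / W, 0, 0; -2 / W, 0, 0, 0; 0, 0, 1 / r ^ 2, 0;
      0, 0, 0, 1 / (r ^ 2 * s)])
    (hR : ∀ a b c d, riemann U g a b c d x = curvatureForm r W huu huv hvv ω μ s c d a b) :
    kretschmann U g x = 16 * ω ^ 2 / W ^ 2 +
      64 / (W ^ 2 * r ^ 2) * (huv ^ 2 + huu * hvv) + 4 * μ ^ 2 / r ^ 4 := by
  -- The inverse metric has a single nonzero entry in each row, at the column `σ a`, where `σ`
  -- exchanges the two null directions. Raising four indices thus permutes and rescales components,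
  -- and the eightfold sum collapses to a fourfold one.
  obtain ⟨σ, s0, s1, s2, s3⟩ : ∃ σ : Fin 4 → Fin 4, σ 0 = 1 ∧ σ 1 = 0 ∧ σ 2 = 2 ∧ σ 3 = 3 :=
    ⟨![1, 0, 2, 3], rfl, rfl, rfl, rfl⟩
  obtain ⟨h, h0, h1, h2, h3⟩ : ∃ h : Fin 4 → ℝ, h 0 = -2 / W ∧ h 1 = -2 / W ∧ h 2 = 1 / r ^ 2 ∧
      h 3 = 1 / (r ^ 2 * s) := ⟨![-2 / W, -2 / W, 1 / r ^ 2, 1 / (r ^ 2 * s)], rfl, rfl, rfl, rfl⟩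
  have hinv : ∀ (a : Fin 4) (f : Fin 4 → ℝ), ∑ a', (g x)⁻¹ a a' * f a' = h a * f (σ a) := by
    rw [hg]
    refine forall_fin_four ?_ ?_ ?_ ?_ <;> intro f <;>
      simp [Fin.sum_univ_four, s0, s1, s2, s3, h0, h1, h2, h3]
  have hsum : ∀ a b c d, ∑ a', ∑ b', ∑ c', ∑ d', (g x)⁻¹ a a' * (g x)⁻¹ b b' * (g x)⁻¹ c c' *
      (g x)⁻¹ d d' * riemann U g a' b' c' d' x =
      h a * (h b * (h c * (h d * riemann U g (σ a) (σ b) (σ c) (σ d) x))) := by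
    intro a b c d
    simp only [mul_assoc, ← Finset.mul_sum, hinv]
  have hV : ∀ a b, ∑ c, ∑ d, curvatureForm r W huu huv hvv ω μ s c d a b *
      (h a * (h b * (h c * (h d * curvatureForm r W huu huv hvv ω μ s (σ c) (σ d) (σ a) (σ b))))) =
      (!![0, 8 * ω ^ 2 / W ^ 2, 8 / (W ^ 2 * r ^ 2) * (huv ^ 2 + huu * hvv),
          8 / (W ^ 2 * r ^ 2) * (huv ^ 2 + huu * hvv);
        8 * ω ^ 2 / W ^ 2, 0, 8 / (W ^ 2 * r ^ 2) * (huv ^ 2 + huu * hvv),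
          8 / (W ^ 2 * r ^ 2) * (huv ^ 2 + huu * hvv);
        8 / (W ^ 2 * r ^ 2) * (huv ^ 2 + huu * hvv), 8 / (W ^ 2 * r ^ 2) * (huv ^ 2 + huu * hvv), 0,
          2 * μ ^ 2 / r ^ 4;
        8 / (W ^ 2 * r ^ 2) * (huv ^ 2 + huu * hvv), 8 / (W ^ 2 * r ^ 2) * (huv ^ 2 + huu * hvv),
          2 * μ ^ 2 / r ^ 4, 0] : Matrix (Fin 4) (Fin 4) ℝ) a b := by
    clear hsum hinv hR hg
    simp only [Fin.sum_univ_four, s0, s1, s2, s3, h0, h1, h2, h3, curvatureForm_self,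
      curvatureForm_zero_one, curvatureForm_zero_two, curvatureForm_zero_three,
      curvatureForm_one_two, curvatureForm_one_three, curvatureForm_two_three,
      curvatureForm_one_zero, curvatureForm_two_zero, curvatureForm_three_zero,
      curvatureForm_two_one, curvatureForm_three_one, curvatureForm_three_two,
      Matrix.zero_apply, zero_mul, Matrix.neg_apply, add_zero, zero_add]
    refine forall_fin_four ?_ ?_ ?_ ?_ <;> refine forall_fin_four ?_ ?_ ?_ ?_ <;>
      simp [s0, s1, s2, s3, h0, h1, h2, h3, -mul_eq_zero] <;> field_simp <;> ring
  simp only [kretschmann, hsum]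
  simp only [hR, hV]
  simp [Fin.sum_univ_four]
  ring

end Geometry

end EMSF

/-! ### Strongly singular developments -/

namespace EMSF

/-- The hypotheses on a strongly singular development. -/
structure SingularDevelopment (G : SingularRegion) (Q : ℝ) (r W φ : ℝ × ℝ → ℝ) (R₀ α : ℝ) :
    Prop where
  sing : IsStronglySingular G Q r W φ
  R₀_pos : 0 < R₀
  qts : QTS G.D r R₀
  α_pos : 0 < α
  α_lt : α < 1
  ske : SKE G.D r φ α

/-- The function `-r ∂_u r`. -/
noncomputable def areaU (D : Set (ℝ × ℝ)) (r : ℝ × ℝ → ℝ) (p : ℝ × ℝ) : ℝ := -(r p) * du D r p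

/-- The function `-r ∂_v r`. -/
noncomputable def areaV (D : Set (ℝ × ℝ)) (r : ℝ × ℝ → ℝ) (p : ℝ × ℝ) : ℝ := -(r p) * dv D r p

/-- The function `r² L̲ φ`. -/
noncomputable def kasnerU (D : Set (ℝ × ℝ)) (r φ : ℝ × ℝ → ℝ) (p : ℝ × ℝ) : ℝ :=
  r p ^ 2 * du D φ p / areaU D r p

/-- The function `r² L φ`. -/
noncomputable def kasnerV (D : Set (ℝ × ℝ)) (r φ : ℝ × ℝ → ℝ) (p : ℝ × ℝ) : ℝ :=
  r p ^ 2 * dv D φ p / areaV D r p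

/-- The common value of `∂_v (-r ∂_u r)` and `∂_u (-r ∂_v r)`. -/
noncomputable def areaSource (Q : ℝ) (r W : ℝ × ℝ → ℝ) (p : ℝ × ℝ) : ℝ :=
  W p / 4 * (1 - Q ^ 2 / r p ^ 2)

/-- The value of `∂_u ∂_v log Ω²`. -/
noncomputable def logSource (D : Set (ℝ × ℝ)) (Q : ℝ) (r W φ : ℝ × ℝ → ℝ) (p : ℝ × ℝ) : ℝ :=
  W p / (2 * r p ^ 2) + 2 * du D r p * dv D r p / r p ^ 2 - W p / r p ^ 4 * Q ^ 2
      - 2 * du D φ p * dv D φ p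

namespace SingularDevelopment

variable {G : SingularRegion} {Q : ℝ} {r W φ : ℝ × ℝ → ℝ} {R₀ α : ℝ} {p : ℝ × ℝ}
  (h : SingularDevelopment G Q r W φ R₀ α)

include h

theorem r_pos (hp : p ∈ G.D) : 0 < r p := h.sing.solution.r_pos p hp

theorem W_pos (hp : p ∈ G.D) : 0 < W p := h.sing.solution.W_pos p hp

theorem le_areaU (hp : p ∈ G.D) : R₀ ≤ areaU G.D r p := (h.qts p hp).2

theorem le_areaV (hp : p ∈ G.D) : R₀ ≤ areaV G.D r p := (h.qts p hp).1

theorem areaU_pos (hp : p ∈ G.D) : 0 < areaU G.D r p := h.R₀_pos.trans_le (h.le_areaU hp)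

theorem areaV_pos (hp : p ∈ G.D) : 0 < areaV G.D r p := h.R₀_pos.trans_le (h.le_areaV hp)

theorem du_r (hp : p ∈ G.D) : du G.D r p = -(areaU G.D r p / r p) := by
  have := (h.r_pos hp).ne'
  rw [areaU]; field_simp

theorem dv_r (hp : p ∈ G.D) : dv G.D r p = -(areaV G.D r p / r p) := by
  have := (h.r_pos hp).ne'
  rw [areaV]; field_simp

theorem du_φ (hp : p ∈ G.D) : du G.D φ p = areaU G.D r p * kasnerU G.D r φ p / r p ^ 2 := by
  have := (h.r_pos hp).ne'
  have := (h.areaU_pos hp).ne'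
  rw [kasnerU]; field_simp

theorem dv_φ (hp : p ∈ G.D) : dv G.D φ p = areaV G.D r p * kasnerV G.D r φ p / r p ^ 2 := by
  have := (h.r_pos hp).ne'
  have := (h.areaV_pos hp).ne'
  rw [kasnerV]; field_simp

theorem contDiffOn_r : ContDiffOn ℝ 2 r G.D := h.sing.solution.contDiff_r

theorem contDiffOn_W : ContDiffOn ℝ 2 W G.D := h.sing.solution.contDiff_W

theorem contDiffOn_φ : ContDiffOn ℝ 2 φ G.D := h.sing.solution.contDiff_φ

theorem contDiffOn_log : ContDiffOn ℝ 2 (fun q => Real.log (W q)) G.D :=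
  h.contDiffOn_W.log fun _ hq => (h.W_pos hq).ne'

theorem contDiffOn_du_r : ContDiffOn ℝ 1 (du G.D r) G.D :=
  SingularRegion.contDiffOn_du h.contDiffOn_r (by norm_num)

theorem contDiffOn_dv_r : ContDiffOn ℝ 1 (dv G.D r) G.D :=
  SingularRegion.contDiffOn_dv h.contDiffOn_r (by norm_num)

theorem contDiffOn_areaU : ContDiffOn ℝ 1 (areaU G.D r) G.D :=
  (h.contDiffOn_r.of_le (by norm_num)).neg.mul h.contDiffOn_du_r

theorem contDiffOn_areaV : ContDiffOn ℝ 1 (areaV G.D r) G.D :=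
  (h.contDiffOn_r.of_le (by norm_num)).neg.mul h.contDiffOn_dv_r

theorem contDiffOn_du_φ : ContDiffOn ℝ 1 (du G.D φ) G.D :=
  SingularRegion.contDiffOn_du h.contDiffOn_φ (by norm_num)

theorem contDiffOn_dv_φ : ContDiffOn ℝ 1 (dv G.D φ) G.D :=
  SingularRegion.contDiffOn_dv h.contDiffOn_φ (by norm_num)

theorem contDiffOn_kasnerU : ContDiffOn ℝ 1 (kasnerU G.D r φ) G.D :=
  (((h.contDiffOn_r.of_le (by norm_num)).pow 2).mul h.contDiffOn_du_φ).div h.contDiffOn_areaU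
    fun _ hq => (h.areaU_pos hq).ne'

theorem contDiffOn_kasnerV : ContDiffOn ℝ 1 (kasnerV G.D r φ) G.D :=
  (((h.contDiffOn_r.of_le (by norm_num)).pow 2).mul h.contDiffOn_dv_φ).div h.contDiffOn_areaV
    fun _ hq => (h.areaV_pos hq).ne'

theorem contDiffOn_areaSource : ContDiffOn ℝ 1 (areaSource Q r W) G.D :=
  ((h.contDiffOn_W.of_le (by norm_num)).div_const 4).mul (contDiffOn_const.sub
    (contDiffOn_const.div ((h.contDiffOn_r.of_le (by norm_num)).pow 2)
      fun _ hq => pow_ne_zero 2 (h.r_pos hq).ne'))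

theorem continuousOn_logSource : ContinuousOn (logSource G.D Q r W φ) G.D := by
  have hr := h.contDiffOn_r.continuousOn
  have hW := h.contDiffOn_W.continuousOn
  have h0 : ∀ q ∈ G.D, r q ≠ 0 := fun q hq => (h.r_pos hq).ne'
  have h1 := h.contDiffOn_du_r.continuousOn
  have h2 := h.contDiffOn_dv_r.continuousOn
  have h3 := h.contDiffOn_du_φ.continuousOn
  have h4 := h.contDiffOn_dv_φ.continuousOn
  unfold logSource
  refine ((ContinuousOn.add ?_ ?_).sub ?_).sub ?_
  · exact hW.div (continuousOn_const.mul (hr.pow 2)) fun q hq =>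
      mul_ne_zero two_ne_zero (pow_ne_zero 2 (h0 q hq))
  · exact ((continuousOn_const.mul h1).mul h2).div (hr.pow 2) fun q hq => pow_ne_zero 2 (h0 q hq)
  · exact (hW.div (hr.pow 4) fun q hq => pow_ne_zero 4 (h0 q hq)).mul continuousOn_const
  · exact (continuousOn_const.mul h3).mul h4

/-! ### First-order evolution equations for the areas, the Kasner exponents and `Ω²`. -/

theorem hasDu_r (hp : p ∈ G.D) : HasDu G.D r (-(areaU G.D r p / r p)) p :=
  (SingularRegion.hasDu_du (h.contDiffOn_r.of_le (by norm_num)) hp).congr_deriv (h.du_r hp)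

theorem hasDv_r (hp : p ∈ G.D) : HasDv G.D r (-(areaV G.D r p / r p)) p :=
  (SingularRegion.hasDv_dv (h.contDiffOn_r.of_le (by norm_num)) hp).congr_deriv (h.dv_r hp)

theorem hasDu_φ (hp : p ∈ G.D) :
    HasDu G.D φ (areaU G.D r p * kasnerU G.D r φ p / r p ^ 2) p :=
  (SingularRegion.hasDu_du (h.contDiffOn_φ.of_le (by norm_num)) hp).congr_deriv (h.du_φ hp)

theorem hasDv_φ (hp : p ∈ G.D) :
    HasDv G.D φ (areaV G.D r p * kasnerV G.D r φ p / r p ^ 2) p :=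
  (SingularRegion.hasDv_dv (h.contDiffOn_φ.of_le (by norm_num)) hp).congr_deriv (h.dv_φ hp)

theorem hasDu_dv_r (hp : p ∈ G.D) : HasDu G.D (dv G.D r) (-(W p) / (4 * r p)
    - du G.D r p * dv G.D r p / r p + W p / (4 * r p ^ 3) * Q ^ 2) p :=
  (SingularRegion.hasDu_du h.contDiffOn_dv_r hp).congr_deriv (h.sing.solution.wave_r p hp)

theorem hasDu_dv_φ (hp : p ∈ G.D) : HasDu G.D (dv G.D φ)
    (-(du G.D r p * dv G.D φ p / r p) - dv G.D r p * du G.D φ p / r p) p :=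
  (SingularRegion.hasDu_du h.contDiffOn_dv_φ hp).congr_deriv (h.sing.solution.wave_φ p hp)

theorem hasDv_du_r (hp : p ∈ G.D) : HasDv G.D (du G.D r) (-(W p) / (4 * r p)
    - du G.D r p * dv G.D r p / r p + W p / (4 * r p ^ 3) * Q ^ 2) p := by
  have hr := h.contDiffOn_r.continuousOn
  have h0 : ∀ q ∈ G.D, r q ≠ 0 := fun q hq => (h.r_pos hq).ne'
  refine G.isPast.hasDv_of_hasDu
    (fun q hq => SingularRegion.hasDu_du (h.contDiffOn_r.of_le (by norm_num)) hq)
    (fun q hq => SingularRegion.hasDv_dv (h.contDiffOn_r.of_le (by norm_num)) hq)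
    (fun q hq => h.hasDu_dv_r hq) ?_ (fun q hq => G.uniqueDiffWithinAt_u hq) p hp
  refine (ContinuousOn.sub ?_ ?_).add ?_
  · exact h.contDiffOn_W.continuousOn.neg.div (continuousOn_const.mul hr)
      fun q hq => mul_ne_zero four_ne_zero (h0 q hq)
  · exact (h.contDiffOn_du_r.continuousOn.mul h.contDiffOn_dv_r.continuousOn).div hr h0
  · exact (h.contDiffOn_W.continuousOn.div (continuousOn_const.mul (hr.pow 3))
      fun q hq => mul_ne_zero four_ne_zero (pow_ne_zero 3 (h0 q hq))).mul continuousOn_const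

theorem hasDv_du_φ (hp : p ∈ G.D) : HasDv G.D (du G.D φ)
    (-(du G.D r p * dv G.D φ p / r p) - dv G.D r p * du G.D φ p / r p) p := by
  have hr := h.contDiffOn_r.continuousOn
  have h0 : ∀ q ∈ G.D, r q ≠ 0 := fun q hq => (h.r_pos hq).ne'
  refine G.isPast.hasDv_of_hasDu
    (fun q hq => SingularRegion.hasDu_du (h.contDiffOn_φ.of_le (by norm_num)) hq)
    (fun q hq => SingularRegion.hasDv_dv (h.contDiffOn_φ.of_le (by norm_num)) hq)
    (fun q hq => h.hasDu_dv_φ hq) ?_ (fun q hq => G.uniqueDiffWithinAt_u hq) p hp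
  refine ContinuousOn.sub (ContinuousOn.neg ?_) ?_
  · exact (h.contDiffOn_du_r.continuousOn.mul h.contDiffOn_dv_φ.continuousOn).div hr h0
  · exact (h.contDiffOn_dv_r.continuousOn.mul h.contDiffOn_du_φ.continuousOn).div hr h0

theorem hasDu_log (hp : p ∈ G.D) : HasDu G.D (fun q => Real.log (W q))
    (du G.D (fun q => Real.log (W q)) p) p :=
  SingularRegion.hasDu_du (h.contDiffOn_log.of_le (by norm_num)) hp

theorem hasDv_log (hp : p ∈ G.D) : HasDv G.D (fun q => Real.log (W q))
    (dv G.D (fun q => Real.log (W q)) p) p :=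
  SingularRegion.hasDv_dv (h.contDiffOn_log.of_le (by norm_num)) hp

theorem hasDu_dv_log (hp : p ∈ G.D) :
    HasDu G.D (dv G.D (fun q => Real.log (W q))) (logSource G.D Q r W φ p) p :=
  (SingularRegion.hasDu_du (SingularRegion.contDiffOn_dv h.contDiffOn_log (by norm_num)) hp
    ).congr_deriv (h.sing.solution.wave_W p hp)

theorem hasDv_du_log (hp : p ∈ G.D) :
    HasDv G.D (du G.D (fun q => Real.log (W q))) (logSource G.D Q r W φ p) p :=
  G.isPast.hasDv_of_hasDu (fun _ hq => h.hasDu_log hq) (fun _ hq => h.hasDv_log hq)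
    (fun _ hq => h.hasDu_dv_log hq) h.continuousOn_logSource
    (fun _ hq => G.uniqueDiffWithinAt_u hq) p hp

theorem hasDu_W (hp : p ∈ G.D) :
    HasDu G.D W (W p * du G.D (fun q => Real.log (W q)) p) p := by
  have := (HasDu.comp (Real.hasDerivAt_exp _) (h.hasDu_log hp)).congr hp
    (g := W) (fun q hq => (Real.exp_log (h.W_pos hq)).symm)
  rwa [Real.exp_log (h.W_pos hp)] at this

theorem hasDv_W (hp : p ∈ G.D) :
    HasDv G.D W (W p * dv G.D (fun q => Real.log (W q)) p) p := by
  have := (HasDv.comp (Real.hasDerivAt_exp _) (h.hasDv_log hp)).congr hp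
    (g := W) (fun q hq => (Real.exp_log (h.W_pos hq)).symm)
  rwa [Real.exp_log (h.W_pos hp)] at this

/-- Multiplying the wave equation for `r` by `-r` produces exactly the term that cancels the product
`∂_u r ∂_v r`, so the right-hand side contains neither first derivative of `r`. -/
theorem hasDv_areaU (hp : p ∈ G.D) : HasDv G.D (areaU G.D r) (areaSource Q r W p) p := by
  have h0 := (h.r_pos hp).ne'
  refine ((h.hasDv_r hp).neg.mul (h.hasDv_du_r hp)).congr_deriv ?_
  rw [h.du_r hp, h.dv_r hp, areaSource]
  field_simp
  ring

theorem hasDu_areaV (hp : p ∈ G.D) : HasDu G.D (areaV G.D r) (areaSource Q r W p) p := by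
  have h0 := (h.r_pos hp).ne'
  refine ((h.hasDu_r hp).neg.mul (h.hasDu_dv_r hp)).congr_deriv ?_
  rw [h.du_r hp, h.dv_r hp, areaSource]
  field_simp
  ring

/-- The wave equation for `φ` in relaxation form: the singular coefficient `areaV / r²` is
nonnegative and multiplies only the difference of the two exponents. -/
theorem hasDv_kasnerU (hp : p ∈ G.D) : HasDv G.D (kasnerU G.D r φ)
    (areaV G.D r p / r p ^ 2 * (kasnerV G.D r φ p - kasnerU G.D r φ p)
      - kasnerU G.D r φ p * areaSource Q r W p / areaU G.D r p) p := by
  have h0 := (h.r_pos hp).ne'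
  have ha := (h.areaU_pos hp).ne'
  have hr2 := HasDv.comp (hasDerivAt_pow 2 (r p)) (h.hasDv_r hp)
  refine ((hr2.mul (h.hasDv_du_φ hp)).div (h.hasDv_areaU hp) ha).congr_deriv ?_
  rw [h.du_r hp, h.dv_r hp, h.du_φ hp, h.dv_φ hp]
  field_simp
  ring

theorem hasDu_kasnerV (hp : p ∈ G.D) : HasDu G.D (kasnerV G.D r φ)
    (areaU G.D r p / r p ^ 2 * (kasnerU G.D r φ p - kasnerV G.D r φ p)
      - kasnerV G.D r φ p * areaSource Q r W p / areaV G.D r p) p := by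
  have h0 := (h.r_pos hp).ne'
  have ha := (h.areaV_pos hp).ne'
  have hr2 := HasDu.comp (hasDerivAt_pow 2 (r p)) (h.hasDu_r hp)
  refine ((hr2.mul (h.hasDu_dv_φ hp)).div (h.hasDu_areaV hp) ha).congr_deriv ?_
  rw [h.du_r hp, h.dv_r hp, h.du_φ hp, h.dv_φ hp]
  field_simp
  ring

/-- Raychaudhuri's equation in `u`, solved for the second derivative of `r`. -/
theorem hasDu_du_r (hp : p ∈ G.D) : HasDu G.D (du G.D r)
    (du G.D r p * du G.D (fun q => Real.log (W q)) p - r p * du G.D φ p ^ 2) p := by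
  have hW := (h.W_pos hp).ne'
  have h1 := SingularRegion.hasDu_du h.contDiffOn_du_r hp
  refine h1.congr_deriv ?_
  have h2 := (HasDu.comp (hasDerivAt_inv hW) (h.hasDu_W hp)).neg.mul h1
  have h3 := SingularRegion.du_eq h2 hp
  rw [h.sing.solution.raych_u p hp] at h3
  field_simp at h3
  linarith

/-- Raychaudhuri's equation in `v`, solved for the second derivative of `r`. -/
theorem hasDv_dv_r (hp : p ∈ G.D) : HasDv G.D (dv G.D r)
    (dv G.D r p * dv G.D (fun q => Real.log (W q)) p - r p * dv G.D φ p ^ 2) p := by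
  have hW := (h.W_pos hp).ne'
  have h1 := SingularRegion.hasDv_dv h.contDiffOn_dv_r hp
  refine h1.congr_deriv ?_
  have h2 := (HasDv.comp (hasDerivAt_inv hW) (h.hasDv_W hp)).neg.mul h1
  have h3 := SingularRegion.dv_eq h2 hp
  rw [h.sing.solution.raych_v p hp] at h3
  field_simp at h3
  linarith

/-- The logarithmic form of Raychaudhuri's equation in `u`. -/
theorem hasDu_log_raych (hp : p ∈ G.D) :
    HasDu G.D (fun q => Real.log (areaU G.D r q / (r q * W q)))
      (areaU G.D r p * kasnerU G.D r φ p ^ 2 / r p ^ 2) p := by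
  have h0 := (h.r_pos hp).ne'
  have ha := (h.areaU_pos hp).ne'
  have hW := (h.W_pos hp).ne'
  have h1 := ((h.hasDu_r hp).neg.mul (h.hasDu_du_r hp)).div ((h.hasDu_r hp).mul (h.hasDu_W hp))
    (mul_ne_zero h0 hW)
  have h2 : HasDu G.D (fun q => areaU G.D r q / (r q * W q)) _ p := h1
  refine (HasDu.comp (Real.hasDerivAt_log (div_ne_zero ha (mul_ne_zero h0 hW))) h2
    ).congr_deriv ?_
  rw [h.du_r hp, h.du_φ hp]
  field_simp
  ring

/-- The logarithmic form of Raychaudhuri's equation in `v`. -/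
theorem hasDv_log_raych (hp : p ∈ G.D) :
    HasDv G.D (fun q => Real.log (areaV G.D r q / (r q * W q)))
      (areaV G.D r p * kasnerV G.D r φ p ^ 2 / r p ^ 2) p := by
  have h0 := (h.r_pos hp).ne'
  have ha := (h.areaV_pos hp).ne'
  have hW := (h.W_pos hp).ne'
  have h1 := ((h.hasDv_r hp).neg.mul (h.hasDv_dv_r hp)).div ((h.hasDv_r hp).mul (h.hasDv_W hp))
    (mul_ne_zero h0 hW)
  have h2 : HasDv G.D (fun q => areaV G.D r q / (r q * W q)) _ p := h1
  refine (HasDv.comp (Real.hasDerivAt_log (div_ne_zero ha (mul_ne_zero h0 hW))) h2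
    ).congr_deriv ?_
  rw [h.dv_r hp, h.dv_φ hp]
  field_simp
  ring

theorem le_kasnerU_sq (hp : p ∈ G.D) : 1 + α ≤ kasnerU G.D r φ p ^ 2 := by
  have := (h.ske p hp).2
  rwa [sq_abs, inL, ← mul_div_assoc] at this

end SingularDevelopment

end EMSF

namespace EMSF

/-! ### Bounds by powers of the area radius -/

/-- `f` is bounded by a multiple of `r ^ k` on `D`. -/
def PowBound (D : Set (ℝ × ℝ)) (r : ℝ × ℝ → ℝ) (k : ℝ) (f : ℝ × ℝ → ℝ) : Prop :=
  ∃ C, 0 ≤ C ∧ ∀ p ∈ D, |f p| ≤ C * r p ^ k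

section PowBound

variable {D : Set (ℝ × ℝ)} {r f g : ℝ × ℝ → ℝ} {k l : ℝ}

theorem PowBound.add (hf : PowBound D r k f) (hg : PowBound D r k g) :
    PowBound D r k (fun p => f p + g p) := by
  obtain ⟨C, hC, hf⟩ := hf
  obtain ⟨C', hC', hg⟩ := hg
  refine ⟨C + C', add_nonneg hC hC', fun p hp => (abs_add_le _ _).trans ?_⟩
  rw [add_mul]
  exact add_le_add (hf p hp) (hg p hp)

theorem PowBound.neg (hf : PowBound D r k f) : PowBound D r k (fun p => -f p) := by
  obtain ⟨C, hC, hf⟩ := hf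
  exact ⟨C, hC, fun p hp => by rw [abs_neg]; exact hf p hp⟩

theorem PowBound.sub (hf : PowBound D r k f) (hg : PowBound D r k g) :
    PowBound D r k (fun p => f p - g p) := by
  simpa only [sub_eq_add_neg] using hf.add hg.neg

theorem PowBound.mul (hr : ∀ p ∈ D, 0 < r p) (hf : PowBound D r k f) (hg : PowBound D r l g) :
    PowBound D r (k + l) (fun p => f p * g p) := by
  obtain ⟨C, hC, hf⟩ := hf
  obtain ⟨C', hC', hg⟩ := hg
  refine ⟨C * C', mul_nonneg hC hC', fun p hp => ?_⟩
  rw [abs_mul, Real.rpow_add (hr p hp)]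
  calc |f p| * |g p| ≤ (C * r p ^ k) * (C' * r p ^ l) :=
        mul_le_mul (hf p hp) (hg p hp) (abs_nonneg _)
          (mul_nonneg hC (Real.rpow_nonneg (hr p hp).le _))
    _ = _ := by ring

theorem PowBound.mul_of_eq (hr : ∀ p ∈ D, 0 < r p) {m : ℝ} (hf : PowBound D r k f)
    (hg : PowBound D r l g) (h : k + l = m) : PowBound D r m (fun p => f p * g p) :=
  h ▸ hf.mul hr hg

theorem PowBound.of_abs_le (hg : PowBound D r k g) (h : ∀ p ∈ D, |f p| ≤ |g p|) :
    PowBound D r k f := by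
  obtain ⟨C, hC, hg⟩ := hg
  exact ⟨C, hC, fun p hp => (h p hp).trans (hg p hp)⟩

theorem PowBound.congr (hg : PowBound D r k g) (h : ∀ p ∈ D, f p = g p) : PowBound D r k f :=
  hg.of_abs_le fun p hp => by rw [h p hp]

theorem PowBound.const (c : ℝ) : PowBound D r 0 (fun _ => c) :=
  ⟨|c|, abs_nonneg _, fun p _ => by simp⟩

theorem PowBound.rpow (hr : ∀ p ∈ D, 0 < r p) (k : ℝ) : PowBound D r k (fun p => r p ^ k) :=
  ⟨1, zero_le_one, fun p hp => by rw [one_mul, abs_of_pos (Real.rpow_pos_of_pos (hr p hp) _)]⟩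

theorem PowBound.mono {r₀ : ℝ} (hr : ∀ p ∈ D, 0 < r p) (hr₀ : ∀ p ∈ D, r p ≤ r₀)
    (hf : PowBound D r k f) (h : l ≤ k) : PowBound D r l f := by
  obtain ⟨C, hC, hf⟩ := hf
  refine ⟨C * |r₀| ^ (k - l), mul_nonneg hC (Real.rpow_nonneg (abs_nonneg _) _), fun p hp => ?_⟩
  refine (hf p hp).trans ?_
  have e : r p ^ k = r p ^ (k - l) * r p ^ l := by
    rw [← Real.rpow_add (hr p hp), sub_add_cancel]
  have h1 : r p ^ (k - l) ≤ |r₀| ^ (k - l) :=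
    Real.rpow_le_rpow (hr p hp).le ((hr₀ p hp).trans (le_abs_self _)) (sub_nonneg.2 h)
  rw [e, mul_assoc]
  exact mul_le_mul_of_nonneg_left
    (mul_le_mul_of_nonneg_right h1 (Real.rpow_nonneg (hr p hp).le _)) hC

theorem PowBound.div {c : ℝ} (hf : PowBound D r k f) (hc : 0 < c) (hg : ∀ p ∈ D, c ≤ g p) :
    PowBound D r k (fun p => f p / g p) := by
  obtain ⟨C, hC, hf⟩ := hf
  refine ⟨C / c, div_nonneg hC hc.le, fun p hp => ?_⟩
  have hgp := hc.trans_le (hg p hp)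
  rw [abs_div, abs_of_pos hgp, div_mul_eq_mul_div]
  exact div_le_div₀ ((abs_nonneg _).trans (hf p hp)) (hf p hp) hc (hg p hp)

end PowBound

namespace SingularDevelopment

variable {G : SingularRegion} {Q : ℝ} {r W φ : ℝ × ℝ → ℝ} {R₀ α : ℝ} {p : ℝ × ℝ}
  (h : SingularDevelopment G Q r W φ R₀ α)

include h

/-! ### Integration of powers of `r` along null segments. -/

theorem antitone_r {q q' : ℝ × ℝ} (hq : (G.u₀, G.v₀) ≤ q) (hqq : q ≤ q') (hq' : q' ∈ G.D) :
    r q' ≤ r q := by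
  obtain ⟨u, v⟩ := q
  obtain ⟨u', v'⟩ := q'
  have hm : (u', v) ∈ G.D := G.isPast.mem_of_le _ hq' _ ⟨hq.1.trans hqq.1, hq.2⟩ ⟨le_rfl, hqq.2⟩
  have h1 := G.isPast.abs_sub_le_u (fun p _ => HasDu.const (0 : ℝ) p)
    (fun p hp => (h.hasDu_r hp).neg) (fun p hp => by
      rw [abs_zero, neg_neg]; exact (div_pos (h.areaU_pos hp) (h.r_pos hp)).le) hq.1 hqq.1 hm
  have h2 := G.isPast.abs_sub_le_v (fun p _ => HasDv.const (0 : ℝ) p)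
    (fun p hp => (h.hasDv_r hp).neg) (fun p hp => by
      rw [abs_zero, neg_neg]; exact (div_pos (h.areaV_pos hp) (h.r_pos hp)).le) hq.2 hqq.2 hq'
  rw [sub_self, abs_zero] at h1 h2
  linarith

theorem r_le (hp : p ∈ G.D) : r p ≤ r (G.u₀, G.v₀) :=
  h.antitone_r le_rfl (G.isPast.lo_le p hp) hp

theorem r₀_pos : 0 < r (G.u₀, G.v₀) := h.r_pos G.lo_mem

/-- The change of variable from `u` to `r`: since `-∂_u r = areaU / r ≥ R₀ / r`, a derivative of
size `Φ' (r) / r` is dominated by `-R₀⁻¹ ∂_u (Φ ∘ r)`. -/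
theorem abs_sub_le_u {Φ Φ' : ℝ → ℝ} (hΦ : ∀ p ∈ G.D, HasDerivAt Φ (Φ' (r p)) (r p))
    {f fu : ℝ × ℝ → ℝ} {C : ℝ} (hfu : ∀ p ∈ G.D, HasDu G.D f (fu p) p)
    (hC : ∀ p ∈ G.D, |fu p| ≤ C * (Φ' (r p) / r p)) {u u' v : ℝ} (hlo : G.u₀ ≤ u) (huu : u ≤ u')
    (hm : (u', v) ∈ G.D) : |f (u', v) - f (u, v)| ≤ C / R₀ * (Φ (r (u, v)) - Φ (r (u', v))) := by
  have := G.isPast.abs_sub_le_u hfu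
    (fun p hp => (HasDu.const (-(C / R₀)) p).mul (HasDu.comp (hΦ p hp) (h.hasDu_r hp)))
    (fun p hp => ?_) hlo huu hm
  · refine this.trans_eq ?_
    ring
  · have h1 := hC p hp
    have h2 := h.le_areaU hp
    have h3 : 0 ≤ C * (Φ' (r p) / r p) := (abs_nonneg _).trans h1
    calc |fu p| ≤ C * (Φ' (r p) / r p) * 1 := by rw [mul_one]; exact h1
      _ ≤ C * (Φ' (r p) / r p) * (areaU G.D r p / R₀) :=
        mul_le_mul_of_nonneg_left ((one_le_div h.R₀_pos).2 h2) h3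
      _ = _ := by ring

theorem abs_sub_le_v {Φ Φ' : ℝ → ℝ} (hΦ : ∀ p ∈ G.D, HasDerivAt Φ (Φ' (r p)) (r p))
    {f fv : ℝ × ℝ → ℝ} {C : ℝ} (hfv : ∀ p ∈ G.D, HasDv G.D f (fv p) p)
    (hC : ∀ p ∈ G.D, |fv p| ≤ C * (Φ' (r p) / r p)) {u v v' : ℝ} (hlo : G.v₀ ≤ v) (hvv : v ≤ v')
    (hm : (u, v') ∈ G.D) : |f (u, v') - f (u, v)| ≤ C / R₀ * (Φ (r (u, v)) - Φ (r (u, v'))) := by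
  have := G.isPast.abs_sub_le_v hfv
    (fun p hp => (HasDv.const (-(C / R₀)) p).mul (HasDv.comp (hΦ p hp) (h.hasDv_r hp)))
    (fun p hp => ?_) hlo hvv hm
  · refine this.trans_eq ?_
    ring
  · have h1 := hC p hp
    have h2 := h.le_areaV hp
    have h3 : 0 ≤ C * (Φ' (r p) / r p) := (abs_nonneg _).trans h1
    calc |fv p| ≤ C * (Φ' (r p) / r p) * 1 := by rw [mul_one]; exact h1
      _ ≤ C * (Φ' (r p) / r p) * (areaV G.D r p / R₀) :=
        mul_le_mul_of_nonneg_left ((one_le_div h.R₀_pos).2 h2) h3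
      _ = _ := by ring

theorem hasDerivAt_rpow_div {k : ℝ} (hk : k ≠ 0) (hp : p ∈ G.D) :
    HasDerivAt (fun s => s ^ k / k) (r p ^ (k - 1)) (r p) := by
  refine ((Real.hasDerivAt_rpow_const (p := k) (Or.inl (h.r_pos hp).ne')).div_const k).congr_deriv ?_
  field_simp

theorem rpow_sub_two {k : ℝ} (hp : p ∈ G.D) :
    r p ^ (k - 1) / r p = r p ^ (k - 2) := by
  have h0 := h.r_pos hp
  rw [show k - 1 = (k - 2) + 1 by ring, Real.rpow_add_one h0.ne', mul_div_assoc, div_self h0.ne', mul_one]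

/-- Integration from the initial segment `v = v₀` gains two powers: with `dv` comparable to `r dr`,
the primitive is `r ^ k / k`. As `k < 0`, it is dominated by its value at the future endpoint, and
the bounded data are absorbed as well. -/
theorem PowBound_of_hasDv {k : ℝ} (hk : k < 0) {f fv : ℝ × ℝ → ℝ} (hf : ContinuousOn f G.D)
    (hfv : ∀ p ∈ G.D, HasDv G.D f (fv p) p) (hb : PowBound G.D r (k - 2) fv) :
    PowBound G.D r k f := by
  obtain ⟨C, hC, hb⟩ := hb
  obtain ⟨C₀, hC₀⟩ := SingularRegion.exists_bound_of_snd_eq hf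
  have hr₀ := h.r₀_pos
  refine ((PowBound.const |C₀|).mono (fun _ => h.r_pos) (fun _ => h.r_le) hk.le).add
    (((PowBound.const (C / R₀ / (-k))).mul (fun _ => h.r_pos)
    (PowBound.rpow (fun _ => h.r_pos) k)).mono (fun _ => h.r_pos) (fun _ => h.r_le)
    (zero_add k).ge) |>.of_abs_le ?_
  rintro ⟨u, v⟩ hp
  have hv := (G.isPast.lo_le _ hp)
  have hp0 : (u, G.v₀) ∈ G.D := G.isPast.mem_of_le _ hp _ ⟨hv.1, le_rfl⟩ ⟨le_rfl, hv.2⟩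
  have h1 := h.abs_sub_le_v (Φ := fun s => s ^ k / k) (Φ' := fun s => s ^ (k - 1))
    (fun p hp => h.hasDerivAt_rpow_div hk.ne hp) hfv (C := C)
    (fun p hp => by rw [h.rpow_sub_two hp]; exact hb p hp) le_rfl hv.2 hp
  have h2 := (hC₀ _ hp0 rfl).trans (le_abs_self _)
  have h3 : C / R₀ * (r (u, G.v₀) ^ k / k - r (u, v) ^ k / k) ≤ C / R₀ / (-k) * r (u, v) ^ k := by
    have e : C / R₀ / (-k) * r (u, v) ^ k = C / R₀ * (0 - r (u, v) ^ k / k) := by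
      have := hk.ne; field_simp; ring
    rw [e]
    refine mul_le_mul_of_nonneg_left (sub_le_sub_right ?_ _) (div_nonneg hC h.R₀_pos.le)
    exact div_nonpos_of_nonneg_of_nonpos (Real.rpow_nonneg (h.r_pos hp0).le _) hk.le
  refine le_trans ?_ (le_abs_self _)
  have h4 := abs_sub_abs_le_abs_sub (f (u, v)) (f (u, G.v₀))
  simp only at h1
  linarith

theorem PowBound_of_hasDu {k : ℝ} (hk : k < 0) {f fu : ℝ × ℝ → ℝ} (hf : ContinuousOn f G.D)
    (hfu : ∀ p ∈ G.D, HasDu G.D f (fu p) p) (hb : PowBound G.D r (k - 2) fu) :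
    PowBound G.D r k f := by
  obtain ⟨C, hC, hb⟩ := hb
  obtain ⟨C₀, hC₀⟩ := SingularRegion.exists_bound_of_fst_eq hf
  have hr₀ := h.r₀_pos
  refine ((PowBound.const |C₀|).mono (fun _ => h.r_pos) (fun _ => h.r_le) hk.le).add
    (((PowBound.const (C / R₀ / (-k))).mul (fun _ => h.r_pos)
    (PowBound.rpow (fun _ => h.r_pos) k)).mono (fun _ => h.r_pos) (fun _ => h.r_le)
    (zero_add k).ge) |>.of_abs_le ?_
  rintro ⟨u, v⟩ hp
  have hv := (G.isPast.lo_le _ hp)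
  have hp0 : (G.u₀, v) ∈ G.D := G.isPast.mem_of_le _ hp _ ⟨le_rfl, hv.2⟩ ⟨hv.1, le_rfl⟩
  have h1 := h.abs_sub_le_u (Φ := fun s => s ^ k / k) (Φ' := fun s => s ^ (k - 1))
    (fun p hp => h.hasDerivAt_rpow_div hk.ne hp) hfu (C := C)
    (fun p hp => by rw [h.rpow_sub_two hp]; exact hb p hp) le_rfl hv.1 hp
  have h2 := (hC₀ _ hp0 rfl).trans (le_abs_self _)
  have h3 : C / R₀ * (r (G.u₀, v) ^ k / k - r (u, v) ^ k / k) ≤ C / R₀ / (-k) * r (u, v) ^ k := by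
    have e : C / R₀ / (-k) * r (u, v) ^ k = C / R₀ * (0 - r (u, v) ^ k / k) := by
      have := hk.ne; field_simp; ring
    rw [e]
    refine mul_le_mul_of_nonneg_left (sub_le_sub_right ?_ _) (div_nonneg hC h.R₀_pos.le)
    exact div_nonpos_of_nonneg_of_nonpos (Real.rpow_nonneg (h.r_pos hp0).le _) hk.le
  refine le_trans ?_ (le_abs_self _)
  have h4 := abs_sub_abs_le_abs_sub (f (u, v)) (f (G.u₀, v))
  simp only at h1
  linarith

/-- For `k > 0` the primitive `r ^ k / k` stays bounded as `r → 0`, so the total variation is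
controlled by its value at `r₀`. -/
theorem PowBound_zero_of_hasDv {k : ℝ} (hk : 0 < k) {f fv : ℝ × ℝ → ℝ} (hf : ContinuousOn f G.D)
    (hfv : ∀ p ∈ G.D, HasDv G.D f (fv p) p) (hb : PowBound G.D r (k - 2) fv) :
    PowBound G.D r 0 f := by
  obtain ⟨C, hC, hb⟩ := hb
  obtain ⟨C₀, hC₀⟩ := SingularRegion.exists_bound_of_snd_eq hf
  refine (PowBound.const (|C₀| + C / R₀ * (r (G.u₀, G.v₀) ^ k / k))).of_abs_le ?_
  rintro ⟨u, v⟩ hp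
  have hv := (G.isPast.lo_le _ hp)
  have hp0 : (u, G.v₀) ∈ G.D := G.isPast.mem_of_le _ hp _ ⟨hv.1, le_rfl⟩ ⟨le_rfl, hv.2⟩
  have h1 := h.abs_sub_le_v (Φ := fun s => s ^ k / k) (Φ' := fun s => s ^ (k - 1))
    (fun p hp => h.hasDerivAt_rpow_div hk.ne' hp) hfv (C := C)
    (fun p hp => by rw [h.rpow_sub_two hp]; exact hb p hp) le_rfl hv.2 hp
  have h2 := (hC₀ _ hp0 rfl).trans (le_abs_self _)
  have h3 : C / R₀ * (r (u, G.v₀) ^ k / k - r (u, v) ^ k / k) ≤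
      C / R₀ * (r (G.u₀, G.v₀) ^ k / k) := by
    refine mul_le_mul_of_nonneg_left ?_ (div_nonneg hC h.R₀_pos.le)
    have := div_nonneg (Real.rpow_nonneg (h.r_pos hp).le k) hk.le
    have := div_le_div_of_nonneg_right (Real.rpow_le_rpow (h.r_pos hp0).le (h.r_le hp0) hk.le) hk.le
    linarith
  refine le_trans ?_ (le_abs_self _)
  have h4 := abs_sub_abs_le_abs_sub (f (u, v)) (f (u, G.v₀))
  simp only at h1
  linarith

theorem PowBound_zero_of_hasDu {k : ℝ} (hk : 0 < k) {f fu : ℝ × ℝ → ℝ} (hf : ContinuousOn f G.D)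
    (hfu : ∀ p ∈ G.D, HasDu G.D f (fu p) p) (hb : PowBound G.D r (k - 2) fu) :
    PowBound G.D r 0 f := by
  obtain ⟨C, hC, hb⟩ := hb
  obtain ⟨C₀, hC₀⟩ := SingularRegion.exists_bound_of_fst_eq hf
  refine (PowBound.const (|C₀| + C / R₀ * (r (G.u₀, G.v₀) ^ k / k))).of_abs_le ?_
  rintro ⟨u, v⟩ hp
  have hv := (G.isPast.lo_le _ hp)
  have hp0 : (G.u₀, v) ∈ G.D := G.isPast.mem_of_le _ hp _ ⟨le_rfl, hv.2⟩ ⟨hv.1, le_rfl⟩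
  have h1 := h.abs_sub_le_u (Φ := fun s => s ^ k / k) (Φ' := fun s => s ^ (k - 1))
    (fun p hp => h.hasDerivAt_rpow_div hk.ne' hp) hfu (C := C)
    (fun p hp => by rw [h.rpow_sub_two hp]; exact hb p hp) le_rfl hv.1 hp
  have h2 := (hC₀ _ hp0 rfl).trans (le_abs_self _)
  have h3 : C / R₀ * (r (G.u₀, v) ^ k / k - r (u, v) ^ k / k) ≤
      C / R₀ * (r (G.u₀, G.v₀) ^ k / k) := by
    refine mul_le_mul_of_nonneg_left ?_ (div_nonneg hC h.R₀_pos.le)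
    have := div_nonneg (Real.rpow_nonneg (h.r_pos hp).le k) hk.le
    have := div_le_div_of_nonneg_right (Real.rpow_le_rpow (h.r_pos hp0).le (h.r_le hp0) hk.le) hk.le
    linarith
  refine le_trans ?_ (le_abs_self _)
  have h4 := abs_sub_abs_le_abs_sub (f (u, v)) (f (G.u₀, v))
  simp only at h1
  linarith

/-- Two functions that are transported in the two null directions and relax towards each other
stay bounded by `r ^ (-m)`, provided the error terms are integrable relative to that power. -/
theorem PowBound_of_relaxation {X Y E₁ E₂ : ℝ × ℝ → ℝ} {m C : ℝ} (hm : 0 ≤ m) (hC : 0 ≤ C)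
    (hX : ContinuousOn X G.D) (hY : ContinuousOn Y G.D)
    (hdX : ∀ p ∈ G.D, HasDv G.D X (areaV G.D r p / r p ^ 2 * (Y p - X p) + E₁ p) p)
    (hdY : ∀ p ∈ G.D, HasDu G.D Y (areaU G.D r p / r p ^ 2 * (X p - Y p) + E₂ p) p)
    (hE₁ : ∀ p ∈ G.D, |E₁ p| ≤ C * r p ^ (α - 2) * |X p| + m * C * r p ^ (-m - 2))
    (hE₂ : ∀ p ∈ G.D, |E₂ p| ≤ C * r p ^ (α - 2) * |Y p| + m * C * r p ^ (-m - 2)) :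
    PowBound G.D r (-m) X ∧ PowBound G.D r (-m) Y := by
  obtain ⟨A, hA⟩ := SingularRegion.exists_bound_of_snd_eq hX
  obtain ⟨A', hA'⟩ := SingularRegion.exists_bound_of_fst_eq hY
  have hR := h.R₀_pos
  have hα := h.α_pos
  set r₀ := r (G.u₀, G.v₀) with hr₀
  have hr₀p : 0 < r₀ := h.r₀_pos
  -- Chosen so that `R₀ * lam * α = C + 1`: the growth of `exp (-lam r ^ α)` along null lines then
  -- beats the linear error `C r ^ (α - 2)`, with one unit to spare for strictness.
  set lam := (C + 1) / (α * R₀) with hlam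
  have hlam0 : 0 < lam := by positivity
  set e₀ := Real.exp (-(lam * r₀ ^ α)) with he₀
  have he₀p : 0 < e₀ := Real.exp_pos _
  -- The first summand lifts the barrier above the initial data. The second gives `C ≤ R₀ K exp
  -- (-lam r ^ α)`, so the growth of the factor `r ^ (-m)` absorbs the inhomogeneous term `m C r ^
  -- (-m - 2)`.
  set K := (|A| + |A'| + 1) * r₀ ^ m / e₀ + C / (R₀ * e₀) with hK
  have hKp : 0 < K := by positivity
  -- The exponential factor lies between `e₀` and `1`, so the barrier is comparable to `r ^ (-m)`.
  set B : ℝ × ℝ → ℝ := fun p => K * (Real.exp (-(lam * r p ^ α)) * r p ^ (-m)) with hB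
  have hBp : ∀ p ∈ G.D, 0 < B p := fun p hp =>
    mul_pos hKp (mul_pos (Real.exp_pos _) (Real.rpow_pos_of_pos (h.r_pos hp) _))
  have hexp : ∀ p ∈ G.D, e₀ ≤ Real.exp (-(lam * r p ^ α)) := fun p hp => by
    refine Real.exp_le_exp.2 (neg_le_neg (mul_le_mul_of_nonneg_left ?_ hlam0.le))
    exact Real.rpow_le_rpow (h.r_pos hp).le (h.r_le hp) hα.le
  have hBlow : ∀ p ∈ G.D, |A| + |A'| < B p := fun p hp => by
    have h1 : r₀ ^ (-m) ≤ r p ^ (-m) :=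
      Real.rpow_le_rpow_of_nonpos (h.r_pos hp) (h.r_le hp) (neg_nonpos.2 hm)
    have h2 : (|A| + |A'| + 1) * r₀ ^ m / e₀ * (e₀ * r₀ ^ (-m)) = |A| + |A'| + 1 := by
      have h3 : r₀ ^ m * r₀ ^ (-m) = 1 := by
        rw [← Real.rpow_add hr₀p, add_neg_cancel, Real.rpow_zero]
      calc _ = (|A| + |A'| + 1) * (r₀ ^ m * r₀ ^ (-m)) := by field_simp
        _ = _ := by rw [h3, mul_one]
    have h3 : (|A| + |A'| + 1) * r₀ ^ m / e₀ ≤ K := by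
      rw [hK]; have : 0 ≤ C / (R₀ * e₀) := by positivity
      linarith
    calc |A| + |A'| < |A| + |A'| + 1 := by linarith
      _ = (|A| + |A'| + 1) * r₀ ^ m / e₀ * (e₀ * r₀ ^ (-m)) := h2.symm
      _ ≤ K * (Real.exp (-(lam * r p ^ α)) * r p ^ (-m)) :=
        mul_le_mul h3 (mul_le_mul (hexp p hp) h1 (by positivity) (Real.exp_pos _).le)
          (by positivity) hKp.le
  have hKC : ∀ p ∈ G.D, m * C * r p ^ (-m - 2) ≤ R₀ * m * r p ^ (-2 : ℝ) * B p := fun p hp => by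
    have h1 : C ≤ R₀ * (K * Real.exp (-(lam * r p ^ α))) := by
      have h2 : C / (R₀ * e₀) ≤ K := by
        rw [hK]
        have : 0 ≤ (|A| + |A'| + 1) * r₀ ^ m / e₀ := by positivity
        linarith
      calc C = R₀ * (C / (R₀ * e₀) * e₀) := by field_simp
        _ ≤ _ := mul_le_mul_of_nonneg_left
          (mul_le_mul h2 (hexp p hp) he₀p.le hKp.le) hR.le
    have e : r p ^ (-m - 2) = r p ^ (-m) * r p ^ (-2 : ℝ) := by
      rw [← Real.rpow_add (h.r_pos hp)]; congr 1
    have hpos : 0 ≤ m * (r p ^ (-m) * r p ^ (-2 : ℝ)) :=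
      mul_nonneg hm (mul_nonneg (Real.rpow_nonneg (h.r_pos hp).le _)
        (Real.rpow_nonneg (h.r_pos hp).le _))
    rw [e, hB]
    nlinarith [mul_le_mul_of_nonneg_right h1 hpos]
  set dB : ℝ × ℝ → ℝ := fun p => (lam * α * r p ^ (α - 2) + m * r p ^ (-2 : ℝ)) * B p with hdB
  have hderiv : ∀ p ∈ G.D, ∀ c : ℝ,
      (K * ((Real.exp (-(lam * r p ^ α)) * -(lam * (α * r p ^ (α - 1)))) * r p ^ (-m) +
        Real.exp (-(lam * r p ^ α)) * (-m * r p ^ (-m - 1)))) * -(c / r p) = c * dB p := by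
    intro p hp c
    have h0 := h.r_pos hp
    have e1 : r p ^ (α - 1) = r p ^ (α - 2) * r p := by
      rw [← Real.rpow_add_one h0.ne']; congr 1; ring
    have e2 : r p ^ (-m - 1) = r p ^ (-m) * r p ^ (-2 : ℝ) * r p := by
      rw [← Real.rpow_add h0, ← Real.rpow_add_one h0.ne']; congr 1; ring
    rw [e1, e2, hdB, hB]
    field_simp
    ring
  have hBder : ∀ p ∈ G.D, HasDerivAt (fun s => K * (Real.exp (-(lam * s ^ α)) * s ^ (-m)))
      (K * ((Real.exp (-(lam * r p ^ α)) * -(lam * (α * r p ^ (α - 1)))) * r p ^ (-m) +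
        Real.exp (-(lam * r p ^ α)) * (-m * r p ^ (-m - 1)))) (r p) := fun p hp =>
    (((((Real.hasDerivAt_rpow_const (Or.inl (h.r_pos hp).ne')).const_mul lam).neg).exp).mul
      (Real.hasDerivAt_rpow_const (Or.inl (h.r_pos hp).ne'))).const_mul K
  have hBu : ∀ p ∈ G.D, HasDu G.D B (areaU G.D r p * dB p) p := fun p hp =>
    (HasDu.comp (hBder p hp) (h.hasDu_r hp)).congr_deriv (hderiv p hp _)
  have hBv : ∀ p ∈ G.D, HasDv G.D B (areaV G.D r p * dB p) p := fun p hp =>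
    (HasDv.comp (hBder p hp) (h.hasDv_r hp)).congr_deriv (hderiv p hp _)
  have hr := h.contDiffOn_r.continuousOn
  have hBc : ContinuousOn B G.D := fun p hp =>
    (hBder p hp).continuousAt.comp_continuousWithinAt (hr p hp)
  have herr : ∀ p ∈ G.D, ∀ x c e : ℝ, R₀ ≤ c → |x| ≤ B p →
      |e| ≤ C * r p ^ (α - 2) * |x| + m * C * r p ^ (-m - 2) → |e| < c * dB p := by
    intro p hp x c e hc hx he
    have h0 := h.r_pos hp
    have hp1 : 0 < r p ^ (α - 2) := Real.rpow_pos_of_pos h0 _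
    have hp2 : 0 < r p ^ (-2 : ℝ) := Real.rpow_pos_of_pos h0 _
    have hBp' := hBp p hp
    have h1 : C * r p ^ (α - 2) * |x| ≤ C * r p ^ (α - 2) * B p :=
      mul_le_mul_of_nonneg_left hx (mul_nonneg hC hp1.le)
    have h2 : R₀ * dB p ≤ c * dB p := by
      refine mul_le_mul_of_nonneg_right hc ?_
      rw [hdB]
      positivity
    have h3 : R₀ * dB p = (C + 1) * r p ^ (α - 2) * B p + R₀ * m * r p ^ (-2 : ℝ) * B p := by
      rw [hdB, hlam]; field_simp
    have h4 : 0 < r p ^ (α - 2) * B p := mul_pos hp1 hBp'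
    have h5 := hKC p hp
    nlinarith
  have hmain := G.isPast.abs_lt_barrier hX hY hBc hdX hdY hBu hBv
    (k := fun p => areaV G.D r p / r p ^ 2) (l := fun p => areaU G.D r p / r p ^ 2)
    (fun p hp => (div_pos (h.areaV_pos hp) (pow_pos (h.r_pos hp) 2)).le)
    (fun p hp => (div_pos (h.areaU_pos hp) (pow_pos (h.r_pos hp) 2)).le)
    (fun p hp hv => by
      have := (hA p hp hv).trans (le_abs_self _)
      have := hBlow p hp
      have := abs_nonneg A'
      linarith)
    (fun p hp hv => by
      have := (hA' p hp hv).trans (le_abs_self _)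
      have := hBlow p hp
      have := abs_nonneg A
      linarith)
    (fun p hp hx => by
      rw [add_sub_cancel_left]
      exact herr p hp (X p) _ _ (h.le_areaV hp) hx (hE₁ p hp))
    (fun p hp hx => by
      rw [add_sub_cancel_left]
      exact herr p hp (Y p) _ _ (h.le_areaU hp) hx (hE₂ p hp))
  have hBb : ∀ p ∈ G.D, B p ≤ K * r p ^ (-m) := fun p hp => by
    refine mul_le_mul_of_nonneg_left ?_ hKp.le
    refine mul_le_of_le_one_left (Real.rpow_nonneg (h.r_pos hp).le _) ?_
    rw [Real.exp_le_one_iff, neg_nonpos]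
    exact mul_nonneg hlam0.le (Real.rpow_nonneg (h.r_pos hp).le _)
  exact ⟨⟨K, hKp.le, fun p hp => (hmain p hp).1.le.trans (hBb p hp)⟩,
    ⟨K, hKp.le, fun p hp => (hmain p hp).2.le.trans (hBb p hp)⟩⟩

end SingularDevelopment

end EMSF

namespace EMSF

/-- The function `(L f) - (L̲ f)`, a derivative of `f` along the level sets of `r`. -/
noncomputable def tangential (D : Set (ℝ × ℝ)) (r f : ℝ × ℝ → ℝ) (p : ℝ × ℝ) : ℝ :=
  dv D f p / areaV D r p - du D f p / areaU D r p

/-- The structure function of the null frame: `[L, L̲] = shear • (L - L̲)`. -/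
noncomputable def shear (D : Set (ℝ × ℝ)) (Q : ℝ) (r W : ℝ × ℝ → ℝ) (p : ℝ × ℝ) : ℝ :=
  areaSource Q r W p / (areaU D r p * areaV D r p)

namespace SingularDevelopment

variable {G : SingularRegion} {Q : ℝ} {r W φ : ℝ × ℝ → ℝ} {R₀ α : ℝ} {p : ℝ × ℝ}
  (h : SingularDevelopment G Q r W φ R₀ α)

include h

/-! ### Bounds of order zero -/

theorem powBound_mul {f g : ℝ × ℝ → ℝ} {k l m : ℝ} (hf : PowBound G.D r k f)
    (hg : PowBound G.D r l g) (e : k + l = m) : PowBound G.D r m (fun p => f p * g p) :=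
  hf.mul_of_eq (fun _ => h.r_pos) hg e

theorem powBound_mono {f : ℝ × ℝ → ℝ} {k l : ℝ} (hf : PowBound G.D r k f) (hkl : l ≤ k) :
    PowBound G.D r l f := hf.mono (fun _ => h.r_pos) (fun _ => h.r_le) hkl

theorem powBound_div_pow {f : ℝ × ℝ → ℝ} {k l : ℝ} (hf : PowBound G.D r k f) (n : ℕ)
    (e : k - n = l) : PowBound G.D r l (fun p => f p / r p ^ n) :=
  (h.powBound_mul hf (PowBound.rpow (fun _ => h.r_pos) (-(n : ℝ))) (by rw [← e]; ring)).congr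
    fun p hp => by
      rw [Real.rpow_neg (h.r_pos hp).le, Real.rpow_natCast]; rfl

theorem powBound_divU {f : ℝ × ℝ → ℝ} {k : ℝ} (hf : PowBound G.D r k f) :
    PowBound G.D r k (fun p => f p / areaU G.D r p) := hf.div h.R₀_pos fun _ => h.le_areaU

theorem powBound_divV {f : ℝ × ℝ → ℝ} {k : ℝ} (hf : PowBound G.D r k f) :
    PowBound G.D r k (fun p => f p / areaV G.D r p) := hf.div h.R₀_pos fun _ => h.le_areaV

/-- This is where (SKE) enters: with `kasnerU ^ 2 ≥ 1 + α`, Raychaudhuri's equation makes `log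
(areaU / (r W)) + (1 + α) log r` nondecreasing in `u`. A lower bound on `u = u₀` thus persists and
is rearranged into the stated decay. -/
theorem powBound_W_div_areaU : PowBound G.D r α (fun p => W p / areaU G.D r p) := by
  have hcont : ContinuousOn (fun q => Real.log (areaU G.D r q / (r q * W q))
      + (1 + α) * Real.log (r q)) G.D := by
    have hr := h.contDiffOn_r.continuousOn
    have h1 : ContinuousOn (fun q => areaU G.D r q / (r q * W q)) G.D :=
      h.contDiffOn_areaU.continuousOn.div (hr.mul h.contDiffOn_W.continuousOn)
        fun q hq => (mul_pos (h.r_pos hq) (h.W_pos hq)).ne'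
    refine (h1.log fun q hq => ?_).add (continuousOn_const.mul (hr.log fun q hq => (h.r_pos hq).ne'))
    exact (div_pos (h.areaU_pos hq) (mul_pos (h.r_pos hq) (h.W_pos hq))).ne'
  obtain ⟨C, hC⟩ := SingularRegion.exists_bound_of_fst_eq hcont
  refine ⟨Real.exp C, (Real.exp_pos _).le, ?_⟩
  rintro ⟨u, v⟩ hp
  have hlo := G.isPast.lo_le _ hp
  have hp0 : (G.u₀, v) ∈ G.D := G.isPast.mem_of_le _ hp _ ⟨le_rfl, hlo.2⟩ ⟨hlo.1, le_rfl⟩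
  have hmono := G.isPast.abs_sub_le_u (fun p _ => HasDu.const (0 : ℝ) p)
    (fun p hp => (h.hasDu_log_raych hp).add ((HasDu.const (1 + α) p).mul
      (HasDu.comp (Real.hasDerivAt_log (h.r_pos hp).ne') (h.hasDu_r hp)))) (fun p hp => by
      have h0 := h.r_pos hp
      have e : areaU G.D r p * kasnerU G.D r φ p ^ 2 / r p ^ 2 +
          (0 * Real.log (r p) + (1 + α) * ((r p)⁻¹ * -(areaU G.D r p / r p))) =
          areaU G.D r p / r p ^ 2 * (kasnerU G.D r φ p ^ 2 - (1 + α)) := by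
        field_simp; ring
      rw [abs_zero, e]
      exact mul_nonneg (div_pos (h.areaU_pos hp) (pow_pos h0 2)).le
        (sub_nonneg.2 (h.le_kasnerU_sq hp))) le_rfl hlo.1 hp
  rw [sub_self, abs_zero] at hmono
  have h1 := (abs_le.1 (hC _ hp0 rfl)).1
  have h0 := h.r_pos hp
  have hW := h.W_pos hp
  have ha := h.areaU_pos hp
  have hlog : Real.log (W (u, v) / areaU G.D r (u, v)) ≤ C + α * Real.log (r (u, v)) := by
    rw [Real.log_div ha.ne' (mul_pos h0 hW).ne', Real.log_mul h0.ne' hW.ne'] at hmono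
    rw [Real.log_div hW.ne' ha.ne']
    linarith
  rw [abs_of_pos (div_pos hW ha), ← Real.exp_log (div_pos hW ha), Real.rpow_def_of_pos h0,
    ← Real.exp_add]
  exact Real.exp_le_exp.2 (hlog.trans_eq (by ring))

theorem powBound_one_sub : PowBound G.D r (-2) (fun p => 1 - Q ^ 2 / r p ^ 2) :=
  (h.powBound_mono (PowBound.const 1) (by norm_num)).sub
    (h.powBound_div_pow (PowBound.const (Q ^ 2)) 2 (by norm_num))

/-- The logarithm is used because only `W / areaU`, and not yet `W`, is under control. It turns the
evolution equation into `∂_v log areaU = areaSource / areaU = O(r ^ (α - 2))`, which is integrable.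
-/
theorem powBound_areaU : PowBound G.D r 0 (areaU G.D r) := by
  have hlog : PowBound G.D r 0 (fun p => Real.log (areaU G.D r p)) := by
    refine h.PowBound_zero_of_hasDv h.α_pos
      (h.contDiffOn_areaU.continuousOn.log fun q hq => (h.areaU_pos hq).ne')
      (fun p hp => HasDv.comp (Real.hasDerivAt_log (h.areaU_pos hp).ne') (h.hasDv_areaU hp)) ?_
    refine (h.powBound_mul (h.powBound_mul h.powBound_W_div_areaU (PowBound.const (1 / 4))
      (add_zero _)) h.powBound_one_sub (m := α - 2) (by ring)).congr fun p _ => ?_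
    rw [areaSource]; ring
  obtain ⟨C, hC, hlog⟩ := hlog
  refine (PowBound.const (Real.exp C)).of_abs_le fun p hp => ?_
  have := hlog p hp
  rw [Real.rpow_zero, mul_one] at this
  rw [abs_of_pos (h.areaU_pos hp), Real.abs_exp, ← Real.exp_log (h.areaU_pos hp)]
  exact Real.exp_le_exp.2 ((le_abs_self _).trans this)

theorem powBound_W : PowBound G.D r α W :=
  (h.powBound_mul h.powBound_W_div_areaU h.powBound_areaU (add_zero α)).congr fun p hp => by
    rw [div_mul_cancel₀ _ (h.areaU_pos hp).ne']

theorem powBound_areaSource : PowBound G.D r (α - 2) (areaSource Q r W) :=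
  (h.powBound_mul (h.powBound_mul h.powBound_W (PowBound.const (1 / 4)) (add_zero _))
    h.powBound_one_sub (m := α - 2) (by ring)).congr fun p _ => by rw [areaSource]; ring

theorem powBound_areaV : PowBound G.D r 0 (areaV G.D r) :=
  h.PowBound_zero_of_hasDu h.α_pos h.contDiffOn_areaV.continuousOn (fun _ => h.hasDu_areaV)
    h.powBound_areaSource

theorem powBound_shear : PowBound G.D r (α - 2) (shear G.D Q r W) :=
  (h.powBound_divV (h.powBound_divU h.powBound_areaSource)).congr fun p _ => by
    rw [shear, div_div]

/-- The case `m = 0` of the relaxation estimate: the errors are linear with the integrable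
coefficient `r ^ (α - 2)`, and there is no inhomogeneous term. -/
theorem powBound_kasner : PowBound G.D r 0 (kasnerU G.D r φ) ∧ PowBound G.D r 0 (kasnerV G.D r φ) := by
  obtain ⟨C₁, hC₁, h₁⟩ := h.powBound_divU h.powBound_areaSource
  obtain ⟨C₂, hC₂, h₂⟩ := h.powBound_divV h.powBound_areaSource
  have := h.PowBound_of_relaxation (X := kasnerU G.D r φ) (Y := kasnerV G.D r φ)
    (E₁ := fun p => -(kasnerU G.D r φ p * (areaSource Q r W p / areaU G.D r p)))
    (E₂ := fun p => -(kasnerV G.D r φ p * (areaSource Q r W p / areaV G.D r p)))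
    (m := 0) (C := C₁ + C₂) le_rfl (add_nonneg hC₁ hC₂)
    h.contDiffOn_kasnerU.continuousOn h.contDiffOn_kasnerV.continuousOn
    (fun p hp => (h.hasDv_kasnerU hp).congr_deriv (by ring))
    (fun p hp => (h.hasDu_kasnerV hp).congr_deriv (by ring))
    (fun p hp => by
      rw [abs_neg, abs_mul, zero_mul, zero_mul, add_zero, mul_comm]
      refine mul_le_mul_of_nonneg_right ((h₁ p hp).trans ?_) (abs_nonneg _)
      exact mul_le_mul_of_nonneg_right (by linarith) (Real.rpow_nonneg (h.r_pos hp).le _))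
    (fun p hp => by
      rw [abs_neg, abs_mul, zero_mul, zero_mul, add_zero, mul_comm]
      refine mul_le_mul_of_nonneg_right ((h₂ p hp).trans ?_) (abs_nonneg _)
      exact mul_le_mul_of_nonneg_right (by linarith) (Real.rpow_nonneg (h.r_pos hp).le _))
  rwa [neg_zero] at this

theorem powBound_kasnerU : PowBound G.D r 0 (kasnerU G.D r φ) := h.powBound_kasner.1

theorem powBound_kasnerV : PowBound G.D r 0 (kasnerV G.D r φ) := h.powBound_kasner.2

/-! ### Bounds of order one -/

/-- The terms in `∂_u r ∂_v r` and `∂_u φ ∂_v φ` are both of size `r ^ (-4)`, while those in `W` are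
smaller thanks to `W = O(r ^ α)`. No cancellation is needed at this order. -/
theorem powBound_logSource : PowBound G.D r (-4) (logSource G.D Q r W φ) := by
  have hα := h.α_pos
  have h1 := h.powBound_mono (h.powBound_mul (h.powBound_div_pow h.powBound_W 2 rfl)
    (PowBound.const (1 / 2)) (add_zero _)) (l := -4) (by push_cast; linarith)
  have h2 : PowBound G.D r (-4)
      (fun p => 2 * (areaU G.D r p * areaV G.D r p) / r p ^ 4) :=
    h.powBound_div_pow (h.powBound_mul (PowBound.const 2)
      (h.powBound_mul h.powBound_areaU h.powBound_areaV (add_zero 0)) (add_zero 0)) 4 (by norm_num)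
  have h3 := h.powBound_mono (h.powBound_mul (h.powBound_div_pow h.powBound_W 4 rfl)
    (PowBound.const (Q ^ 2)) (add_zero _)) (l := -4) (by push_cast; linarith)
  have h4 := h.powBound_mul h2 (h.powBound_mul h.powBound_kasnerU h.powBound_kasnerV (add_zero 0))
    (add_zero _)
  refine (((h1.add h2).sub h3).sub h4).congr fun p hp => ?_
  have h0 := (h.r_pos hp).ne'
  rw [logSource, h.du_r hp, h.dv_r hp, h.du_φ hp, h.dv_φ hp]
  field_simp

theorem powBound_du_log : PowBound G.D r (-2) (du G.D (fun q => Real.log (W q))) := by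
  refine h.PowBound_of_hasDv (by norm_num) (SingularRegion.contDiffOn_du (m := 1) h.contDiffOn_log
    (by norm_num)).continuousOn (fun _ => h.hasDv_du_log) ?_
  norm_num
  exact h.powBound_logSource

theorem powBound_dv_log : PowBound G.D r (-2) (dv G.D (fun q => Real.log (W q))) := by
  refine h.PowBound_of_hasDu (by norm_num) (SingularRegion.contDiffOn_dv (m := 1) h.contDiffOn_log
    (by norm_num)).continuousOn (fun _ => h.hasDu_dv_log) ?_
  norm_num
  exact h.powBound_logSource

theorem powBound_du_areaSource : PowBound G.D r (α - 4) (du G.D (areaSource Q r W)) := by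
  have h1 := h.powBound_mul (h.powBound_mul (h.powBound_mul h.powBound_W h.powBound_du_log rfl)
    (PowBound.const (1 / 4)) (add_zero _)) h.powBound_one_sub (m := α - 4) (by ring)
  have h2 := h.powBound_div_pow (h.powBound_mul (h.powBound_mul h.powBound_W h.powBound_areaU
    (add_zero _)) (PowBound.const (Q ^ 2 / 2)) (add_zero _)) 4 (l := α - 4) (by norm_num)
  refine (h1.sub h2).congr fun p hp => ?_
  have h0 := (h.r_pos hp).ne'
  have hd := ((h.hasDu_W hp).div (HasDu.const 4 p) four_ne_zero).mul ((HasDu.const 1 p).sub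
    ((HasDu.const (Q ^ 2) p).div (HasDu.comp (hasDerivAt_pow 2 (r p)) (h.hasDu_r hp))
      (pow_ne_zero 2 h0)))
  have hd' : HasDu G.D (areaSource Q r W) _ p := hd
  rw [SingularRegion.du_eq hd' hp]
  field_simp
  ring

theorem powBound_dv_areaSource : PowBound G.D r (α - 4) (dv G.D (areaSource Q r W)) := by
  have h1 := h.powBound_mul (h.powBound_mul (h.powBound_mul h.powBound_W h.powBound_dv_log rfl)
    (PowBound.const (1 / 4)) (add_zero _)) h.powBound_one_sub (m := α - 4) (by ring)
  have h2 := h.powBound_div_pow (h.powBound_mul (h.powBound_mul h.powBound_W h.powBound_areaV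
    (add_zero _)) (PowBound.const (Q ^ 2 / 2)) (add_zero _)) 4 (l := α - 4) (by norm_num)
  refine (h1.sub h2).congr fun p hp => ?_
  have h0 := (h.r_pos hp).ne'
  have hd := ((h.hasDv_W hp).div (HasDv.const 4 p) four_ne_zero).mul ((HasDv.const 1 p).sub
    ((HasDv.const (Q ^ 2) p).div (HasDv.comp (hasDerivAt_pow 2 (r p)) (h.hasDv_r hp))
      (pow_ne_zero 2 h0)))
  have hd' : HasDv G.D (areaSource Q r W) _ p := hd
  rw [SingularRegion.dv_eq hd' hp]
  field_simp
  ring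

/-- Differentiating `∂_v areaU = areaSource` in `u` costs two powers, and integrating back in `v`
recovers them. As `areaU` is only `C¹`, the derivative `∂_v ∂_u areaU` is obtained from
`IsPast.hasDv_of_hasDu`. -/
theorem powBound_du_areaU : PowBound G.D r (α - 2) (du G.D (areaU G.D r)) := by
  have hα := h.α_lt
  refine h.PowBound_of_hasDv (by linarith) (SingularRegion.contDiffOn_du (m := 0)
    h.contDiffOn_areaU (by norm_num)).continuousOn
    (G.isPast.hasDv_of_hasDu (fun _ => SingularRegion.hasDu_du h.contDiffOn_areaU)
      (fun _ => h.hasDv_areaU) (fun _ => SingularRegion.hasDu_du h.contDiffOn_areaSource)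
      (SingularRegion.contDiffOn_du (m := 0) h.contDiffOn_areaSource (by norm_num)).continuousOn
      (fun _ => G.uniqueDiffWithinAt_u)) ?_
  rw [show α - 2 - 2 = α - 4 by ring]
  exact h.powBound_du_areaSource

theorem powBound_dv_areaV : PowBound G.D r (α - 2) (dv G.D (areaV G.D r)) := by
  have hα := h.α_lt
  refine h.PowBound_of_hasDu (by linarith) (SingularRegion.contDiffOn_dv (m := 0)
    h.contDiffOn_areaV (by norm_num)).continuousOn
    (G.isPast.hasDu_of_hasDv (fun _ => SingularRegion.hasDv_dv h.contDiffOn_areaV)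
      (fun _ => h.hasDu_areaV) (fun _ => SingularRegion.hasDv_dv h.contDiffOn_areaSource)
      (SingularRegion.contDiffOn_dv (m := 0) h.contDiffOn_areaSource (by norm_num)).continuousOn
      (fun _ => G.uniqueDiffWithinAt_v)) ?_
  rw [show α - 2 - 2 = α - 4 by ring]
  exact h.powBound_dv_areaSource

theorem contDiffOn_shear : ContDiffOn ℝ 1 (shear G.D Q r W) G.D :=
  h.contDiffOn_areaSource.div (h.contDiffOn_areaU.mul h.contDiffOn_areaV)
    fun _ hq => (mul_pos (h.areaU_pos hq) (h.areaV_pos hq)).ne'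

theorem powBound_tangential_shear :
    PowBound G.D r (α - 4) (tangential G.D r (shear G.D Q r W)) := by
  have hα := h.α_pos
  have hu := h.powBound_divV (h.powBound_divU (h.powBound_divU h.powBound_du_areaSource))
  have hv := h.powBound_divV (h.powBound_divV (h.powBound_divU h.powBound_dv_areaSource))
  have h1 := h.powBound_mono (h.powBound_mul h.powBound_areaSource
    (h.powBound_divV (h.powBound_divU (h.powBound_divU (h.powBound_divU h.powBound_du_areaU)))) rfl)
    (l := α - 4) (by linarith)
  have h2 := h.powBound_mono (h.powBound_mul h.powBound_areaSource
    (h.powBound_divU (h.powBound_divV (h.powBound_divV (h.powBound_divV h.powBound_dv_areaV)))) rfl)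
    (l := α - 4) (by linarith)
  refine ((hv.sub hu).add (h1.sub h2)).congr fun p hp => ?_
  have ha := (h.areaU_pos hp).ne'
  have hb := (h.areaV_pos hp).ne'
  have hdu : HasDu G.D (shear G.D Q r W) _ p :=
    (SingularRegion.hasDu_du h.contDiffOn_areaSource hp).div
      ((SingularRegion.hasDu_du h.contDiffOn_areaU hp).mul (h.hasDu_areaV hp)) (mul_ne_zero ha hb)
  have hdv : HasDv G.D (shear G.D Q r W) _ p :=
    (SingularRegion.hasDv_dv h.contDiffOn_areaSource hp).div
      ((h.hasDv_areaU hp).mul (SingularRegion.hasDv_dv h.contDiffOn_areaV hp)) (mul_ne_zero ha hb)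
  rw [tangential, SingularRegion.du_eq hdu hp, SingularRegion.dv_eq hdv hp]
  field_simp
  ring

/-! ### The Kasner exponents agree to leading order -/

theorem areaSource_eq (hp : p ∈ G.D) :
    areaSource Q r W p = areaU G.D r p * areaV G.D r p * shear G.D Q r W p := by
  have ha := (h.areaU_pos hp).ne'
  have hb := (h.areaV_pos hp).ne'
  rw [shear]; field_simp

theorem dv_kasnerU (hp : p ∈ G.D) : dv G.D (kasnerU G.D r φ) p = areaV G.D r p *
    ((kasnerV G.D r φ p - kasnerU G.D r φ p) / r p ^ 2
      - shear G.D Q r W p * kasnerU G.D r φ p) := by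
  have ha := (h.areaU_pos hp).ne'
  rw [SingularRegion.dv_eq (h.hasDv_kasnerU hp) hp, h.areaSource_eq hp]
  field_simp

theorem du_kasnerV (hp : p ∈ G.D) : du G.D (kasnerV G.D r φ) p = areaU G.D r p *
    ((kasnerU G.D r φ p - kasnerV G.D r φ p) / r p ^ 2
      - shear G.D Q r W p * kasnerV G.D r φ p) := by
  have ha := (h.areaV_pos hp).ne'
  rw [SingularRegion.du_eq (h.hasDu_kasnerV hp) hp, h.areaSource_eq hp]
  field_simp

/-- The operator `L - L̲` annihilates `r`, so the singular coefficient `1 / r²` is not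
differentiated and the relaxation structure survives. One multiple of the shear comes from
differentiating the product with `kasnerU`, the other from the commutator `[L, L̲]`. -/
theorem hasDv_tangential_kasnerU (hp : p ∈ G.D) :
    HasDv G.D (tangential G.D r (kasnerU G.D r φ))
      (areaV G.D r p / r p ^ 2 * (tangential G.D r (kasnerV G.D r φ) p -
        tangential G.D r (kasnerU G.D r φ) p) -
        areaV G.D r p * (2 * shear G.D Q r W p * tangential G.D r (kasnerU G.D r φ) p +
          kasnerU G.D r φ p * tangential G.D r (shear G.D Q r W) p)) p := by
  set y : ℝ × ℝ → ℝ := fun q => (kasnerV G.D r φ q - kasnerU G.D r φ q) / r q ^ 2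
      - shear G.D Q r W q * kasnerU G.D r φ q with hy
  have hyC : ContDiffOn ℝ 1 y G.D :=
    ((h.contDiffOn_kasnerV.sub h.contDiffOn_kasnerU).div
      ((h.contDiffOn_r.of_le (by norm_num)).pow 2) fun q hq => pow_ne_zero 2 (h.r_pos hq).ne').sub
      (h.contDiffOn_shear.mul h.contDiffOn_kasnerU)
  have hbyC : ContDiffOn ℝ 1 (fun q => areaV G.D r q * y q) G.D := h.contDiffOn_areaV.mul hyC
  have hPv : ∀ q ∈ G.D, HasDv G.D (kasnerU G.D r φ) (areaV G.D r q * y q) q := fun q hq =>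
    (SingularRegion.hasDv_dv h.contDiffOn_kasnerU hq).congr_deriv (h.dv_kasnerU hq)
  -- `∂_u kasnerU` is only known to be continuous. Its `v`-derivative exists because `∂_v kasnerU`
  -- equals the `C¹` function `areaV * y`.
  have hswap := G.isPast.hasDv_of_hasDu
    (fun _ => SingularRegion.hasDu_du h.contDiffOn_kasnerU) hPv
    (fun _ => SingularRegion.hasDu_du hbyC)
    (SingularRegion.contDiffOn_du (m := 0) hbyC (by norm_num)).continuousOn
    (fun _ => G.uniqueDiffWithinAt_u) p hp
  have h0 := (h.r_pos hp).ne'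
  have ha := (h.areaU_pos hp).ne'
  have hb := (h.areaV_pos hp).ne'
  have hyu : HasDu G.D y _ p := (((SingularRegion.hasDu_du h.contDiffOn_kasnerV hp).sub
    (SingularRegion.hasDu_du h.contDiffOn_kasnerU hp)).div
    (HasDu.comp (hasDerivAt_pow 2 (r p)) (h.hasDu_r hp)) (pow_ne_zero 2 h0)).sub
    ((SingularRegion.hasDu_du h.contDiffOn_shear hp).mul
      (SingularRegion.hasDu_du h.contDiffOn_kasnerU hp))
  have hyv : HasDv G.D y _ p := (((SingularRegion.hasDv_dv h.contDiffOn_kasnerV hp).sub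
    (SingularRegion.hasDv_dv h.contDiffOn_kasnerU hp)).div
    (HasDv.comp (hasDerivAt_pow 2 (r p)) (h.hasDv_r hp)) (pow_ne_zero 2 h0)).sub
    ((SingularRegion.hasDv_dv h.contDiffOn_shear hp).mul
      (SingularRegion.hasDv_dv h.contDiffOn_kasnerU hp))
  have hby := SingularRegion.du_eq ((h.hasDu_areaV hp).mul (SingularRegion.hasDu_du hyC hp)) hp
  rw [hby] at hswap
  have hX : HasDv G.D (tangential G.D r (kasnerU G.D r φ)) _ p :=
    ((SingularRegion.hasDv_dv hyC hp).sub (hswap.div (h.hasDv_areaU hp) ha)).congr hp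
      fun q hq => by
        rw [tangential, h.dv_kasnerU hq, mul_div_cancel_left₀ _ (h.areaV_pos hq).ne']
  refine hX.congr_deriv ?_
  rw [SingularRegion.du_eq hyu hp, SingularRegion.dv_eq hyv hp, h.areaSource_eq hp]
  simp only [tangential, hy]
  field_simp
  rw [h.dv_kasnerU hp]
  field_simp
  ring

theorem hasDu_tangential_kasnerV (hp : p ∈ G.D) :
    HasDu G.D (tangential G.D r (kasnerV G.D r φ))
      (areaU G.D r p / r p ^ 2 * (tangential G.D r (kasnerU G.D r φ) p -
        tangential G.D r (kasnerV G.D r φ) p) -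
        areaU G.D r p * (2 * shear G.D Q r W p * tangential G.D r (kasnerV G.D r φ) p +
          kasnerV G.D r φ p * tangential G.D r (shear G.D Q r W) p)) p := by
  set y : ℝ × ℝ → ℝ := fun q => (kasnerU G.D r φ q - kasnerV G.D r φ q) / r q ^ 2
      - shear G.D Q r W q * kasnerV G.D r φ q with hy
  have hyC : ContDiffOn ℝ 1 y G.D :=
    ((h.contDiffOn_kasnerU.sub h.contDiffOn_kasnerV).div
      ((h.contDiffOn_r.of_le (by norm_num)).pow 2) fun q hq => pow_ne_zero 2 (h.r_pos hq).ne').sub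
      (h.contDiffOn_shear.mul h.contDiffOn_kasnerV)
  have hbyC : ContDiffOn ℝ 1 (fun q => areaU G.D r q * y q) G.D := h.contDiffOn_areaU.mul hyC
  have hPv : ∀ q ∈ G.D, HasDu G.D (kasnerV G.D r φ) (areaU G.D r q * y q) q := fun q hq =>
    (SingularRegion.hasDu_du h.contDiffOn_kasnerV hq).congr_deriv (h.du_kasnerV hq)
  have hswap := G.isPast.hasDu_of_hasDv
    (fun _ => SingularRegion.hasDv_dv h.contDiffOn_kasnerV) hPv
    (fun _ => SingularRegion.hasDv_dv hbyC)
    (SingularRegion.contDiffOn_dv (m := 0) hbyC (by norm_num)).continuousOn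
    (fun _ => G.uniqueDiffWithinAt_v) p hp
  have h0 := (h.r_pos hp).ne'
  have ha := (h.areaU_pos hp).ne'
  have hb := (h.areaV_pos hp).ne'
  have hyu : HasDu G.D y _ p := (((SingularRegion.hasDu_du h.contDiffOn_kasnerU hp).sub
    (SingularRegion.hasDu_du h.contDiffOn_kasnerV hp)).div
    (HasDu.comp (hasDerivAt_pow 2 (r p)) (h.hasDu_r hp)) (pow_ne_zero 2 h0)).sub
    ((SingularRegion.hasDu_du h.contDiffOn_shear hp).mul
      (SingularRegion.hasDu_du h.contDiffOn_kasnerV hp))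
  have hyv : HasDv G.D y _ p := (((SingularRegion.hasDv_dv h.contDiffOn_kasnerU hp).sub
    (SingularRegion.hasDv_dv h.contDiffOn_kasnerV hp)).div
    (HasDv.comp (hasDerivAt_pow 2 (r p)) (h.hasDv_r hp)) (pow_ne_zero 2 h0)).sub
    ((SingularRegion.hasDv_dv h.contDiffOn_shear hp).mul
      (SingularRegion.hasDv_dv h.contDiffOn_kasnerV hp))
  have hby := SingularRegion.dv_eq ((h.hasDv_areaU hp).mul (SingularRegion.hasDv_dv hyC hp)) hp
  rw [hby] at hswap
  have hX : HasDu G.D (tangential G.D r (kasnerV G.D r φ)) _ p :=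
    ((hswap.div (h.hasDu_areaV hp) hb).sub (SingularRegion.hasDu_du hyC hp)).congr hp
      fun q hq => by
        rw [tangential, h.du_kasnerV hq, mul_div_cancel_left₀ _ (h.areaU_pos hq).ne']
  refine hX.congr_deriv ?_
  rw [SingularRegion.du_eq hyu hp, SingularRegion.dv_eq hyv hp, h.areaSource_eq hp]
  simp only [tangential, hy]
  field_simp
  rw [h.du_kasnerV hp]
  field_simp
  ring

theorem continuousOn_tangential {f : ℝ × ℝ → ℝ} (hf : ContDiffOn ℝ 1 f G.D) :
    ContinuousOn (tangential G.D r f) G.D :=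
  ((SingularRegion.contDiffOn_dv (m := 0) hf (by norm_num)).continuousOn.div
    h.contDiffOn_areaV.continuousOn fun _ hq => (h.areaV_pos hq).ne').sub
  ((SingularRegion.contDiffOn_du (m := 0) hf (by norm_num)).continuousOn.div
    h.contDiffOn_areaU.continuousOn fun _ hq => (h.areaU_pos hq).ne')

/-- The relaxation estimate with `m = 2 - α`: the inhomogeneity, a Kasner exponent times the
tangential derivative of the shear, has size `r ^ (α - 4) = r ^ (-m - 2)`. -/
theorem powBound_tangential_kasner :
    PowBound G.D r (α - 2) (tangential G.D r (kasnerU G.D r φ)) ∧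
    PowBound G.D r (α - 2) (tangential G.D r (kasnerV G.D r φ)) := by
  have hα := h.α_lt
  obtain ⟨C₁, hC₁, h₁⟩ := h.powBound_mul (PowBound.const 2) (h.powBound_mul h.powBound_areaV
    h.powBound_shear (zero_add _)) (zero_add _)
  obtain ⟨C₂, hC₂, h₂⟩ := h.powBound_mul (PowBound.const 2) (h.powBound_mul h.powBound_areaU
    h.powBound_shear (zero_add _)) (zero_add _)
  obtain ⟨C₃, hC₃, h₃⟩ := h.powBound_mul h.powBound_areaV (h.powBound_mul h.powBound_kasnerU
    h.powBound_tangential_shear (zero_add _)) (zero_add _)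
  obtain ⟨C₄, hC₄, h₄⟩ := h.powBound_mul h.powBound_areaU (h.powBound_mul h.powBound_kasnerV
    h.powBound_tangential_shear (zero_add _)) (zero_add _)
  have hbound : ∀ p ∈ G.D, ∀ x s t c₁ c₂ : ℝ, 0 ≤ c₂ → |s| ≤ c₁ * r p ^ (α - 2) →
      |t| ≤ c₂ * r p ^ (α - 4) → c₁ + c₂ ≤ C₁ + C₂ + C₃ + C₄ →
      |s * x + t| ≤ (C₁ + C₂ + C₃ + C₄) * r p ^ (α - 2) * |x|
        + (2 - α) * (C₁ + C₂ + C₃ + C₄) * r p ^ (-(2 - α) - 2) := by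
    intro p hp x s t c₁ c₂ hc₂ hs ht hc
    rw [show -(2 - α) - 2 = α - 4 by ring]
    have e1 := Real.rpow_nonneg (h.r_pos hp).le (α - 2)
    have e2 := Real.rpow_nonneg (h.r_pos hp).le (α - 4)
    refine (abs_add_le _ _).trans (add_le_add ?_ (ht.trans ?_))
    · rw [abs_mul]
      have hc₁ : c₁ ≤ C₁ + C₂ + C₃ + C₄ := by linarith
      exact mul_le_mul_of_nonneg_right (hs.trans (mul_le_mul_of_nonneg_right hc₁ e1))
        (abs_nonneg _)
    · refine mul_le_mul_of_nonneg_right ?_ e2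
      -- Since `2 - α > 1`, the factor `m` in the required bound does no harm. A negative `c₁` is
      -- ruled out by `|s| ≤ c₁ * r p ^ (α - 2)`.
      by_cases hneg : 0 ≤ c₁
      · nlinarith
      · have h5 : 0 < r p ^ (α - 2) := Real.rpow_pos_of_pos (h.r_pos hp) _
        have := (abs_nonneg s).trans hs
        nlinarith
  have := h.PowBound_of_relaxation (X := tangential G.D r (kasnerU G.D r φ))
    (Y := tangential G.D r (kasnerV G.D r φ))
    (E₁ := fun p => -(2 * (areaV G.D r p * shear G.D Q r W p) *
      tangential G.D r (kasnerU G.D r φ) p + areaV G.D r p * (kasnerU G.D r φ p *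
        tangential G.D r (shear G.D Q r W) p)))
    (E₂ := fun p => -(2 * (areaU G.D r p * shear G.D Q r W p) *
      tangential G.D r (kasnerV G.D r φ) p + areaU G.D r p * (kasnerV G.D r φ p *
        tangential G.D r (shear G.D Q r W) p)))
    (m := 2 - α) (C := C₁ + C₂ + C₃ + C₄) (by linarith) (by positivity)
    (h.continuousOn_tangential h.contDiffOn_kasnerU)
    (h.continuousOn_tangential h.contDiffOn_kasnerV)
    (fun p hp => (h.hasDv_tangential_kasnerU hp).congr_deriv (by ring))
    (fun p hp => (h.hasDu_tangential_kasnerV hp).congr_deriv (by ring))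
    (fun p hp => by
      rw [abs_neg]
      exact hbound p hp _ _ _ C₁ C₃ hC₃ (h₁ p hp) (h₃ p hp) (by linarith))
    (fun p hp => by
      rw [abs_neg]
      exact hbound p hp _ _ _ C₂ C₄ hC₄ (h₂ p hp) (h₄ p hp) (by linarith))
  rwa [neg_sub] at this

/-- The decisive cancellation. Writing `∂_u kasnerV` as a tangential derivative plus `∂_v kasnerV`,
the two relaxation terms contribute `-2 areaV / r²` times the quotient to its `v`-derivative, and
differentiating `1 / r²` contributes `+2 areaV / r²` times it. Only `O(r ^ (α - 4))` remains. -/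
theorem powBound_kasner_sub_div :
    PowBound G.D r (α - 2) (fun p => (kasnerU G.D r φ p - kasnerV G.D r φ p) / r p ^ 2) := by
  have hα := h.α_lt
  have hα' := h.α_pos
  refine h.PowBound_of_hasDv (by linarith)
    ((h.contDiffOn_kasnerU.continuousOn.sub h.contDiffOn_kasnerV.continuousOn).div
      (h.contDiffOn_r.continuousOn.pow 2) fun q hq => pow_ne_zero 2 (h.r_pos hq).ne')
    (fun p hp => ((SingularRegion.hasDv_dv h.contDiffOn_kasnerU hp).sub
      (SingularRegion.hasDv_dv h.contDiffOn_kasnerV hp)).div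
      (HasDv.comp (hasDerivAt_pow 2 (r p)) (h.hasDv_r hp)) (pow_ne_zero 2 (h.r_pos hp).ne')) ?_
  have h1 := h.powBound_mul h.powBound_areaV (h.powBound_mul h.powBound_shear
    (h.powBound_kasnerU.sub h.powBound_kasnerV) (add_zero _)) (zero_add _)
  have h2 := h.powBound_mul h.powBound_areaV h.powBound_tangential_kasner.2 (zero_add _)
  refine (h.powBound_div_pow (h1.add h2).neg 2 (by push_cast; ring)).congr fun p hp => ?_
  have h0 := (h.r_pos hp).ne'
  have ha := (h.areaU_pos hp).ne'
  have hb := (h.areaV_pos hp).ne'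
  rw [h.dv_kasnerU hp, tangential, h.du_kasnerV hp]
  field_simp
  ring

theorem powBound_kasner_sub :
    PowBound G.D r α (fun p => kasnerU G.D r φ p - kasnerV G.D r φ p) := by
  refine (h.powBound_mul h.powBound_kasner_sub_div (PowBound.rpow (fun _ => h.r_pos) 2)
    (by ring)).congr fun p hp => ?_
  rw [Real.rpow_two, div_mul_cancel₀ _ (pow_ne_zero 2 (h.r_pos hp).ne')]

theorem powBound_dv_kasnerU : PowBound G.D r (α - 2) (dv G.D (kasnerU G.D r φ)) :=
  (h.powBound_mul h.powBound_areaV (h.powBound_kasner_sub_div.neg.sub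
    (h.powBound_mul h.powBound_shear h.powBound_kasnerU (add_zero _))) (zero_add _)).congr
    fun p hp => by rw [h.dv_kasnerU hp]; ring

/-- No transport equation gives `∂_u kasnerU`. It is recovered from the `v`-derivative and the
tangential derivative. -/
theorem powBound_du_kasnerU : PowBound G.D r (α - 2) (du G.D (kasnerU G.D r φ)) :=
  (h.powBound_mul h.powBound_areaU ((h.powBound_divV h.powBound_dv_kasnerU).sub
    h.powBound_tangential_kasner.1) (zero_add _)).congr fun p hp => by
      have ha := (h.areaU_pos hp).ne'
      rw [tangential]; field_simp; ring

end SingularDevelopment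

end EMSF

namespace EMSF

/-! ### Functions controlled by a gauge of the area radius -/

/-- A nonnegative function on `(0, r₀]` that tends to `0` at `0`. -/
structure IsGauge (r₀ : ℝ) (Φ : ℝ → ℝ) : Prop where
  nonneg : ∀ s, 0 < s → s ≤ r₀ → 0 ≤ Φ s
  tendsto : Tendsto Φ (𝓝[>] 0) (𝓝 0)

/-- The variation of `f` towards the future is bounded by the decrease of `Φ ∘ r`. -/
def GaugeBound (G : SingularRegion) (r : ℝ × ℝ → ℝ) (Φ : ℝ → ℝ) (f : ℝ × ℝ → ℝ) : Prop :=
  ∃ C, 0 ≤ C ∧ ∀ q q', (G.u₀, G.v₀) ≤ q → q ≤ q' → q' ∈ G.D →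
    |f q' - f q| ≤ C * (Φ (r q) - Φ (r q'))

/-- The antiderivative of `α s ^ (α - 1) * (1 + log (r₀ / s))`. -/
noncomputable def logGauge (r₀ α s : ℝ) : ℝ := s ^ α * (1 + 1 / α + Real.log (r₀ / s))

theorem isGauge_rpow {α : ℝ} (hα : 0 < α) (r₀ : ℝ) : IsGauge r₀ (fun s => s ^ α / α) where
  nonneg s hs _ := div_nonneg (Real.rpow_nonneg hs.le _) hα.le
  tendsto := by
    have := ((Real.continuousAt_rpow_const 0 α (Or.inr hα.le)).div_const α).tendsto
    rw [Real.zero_rpow hα.ne', zero_div] at this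
    exact this.mono_left nhdsWithin_le_nhds

theorem isGauge_logGauge {α r₀ : ℝ} (hα : 0 < α) (hr₀ : 0 < r₀) : IsGauge r₀ (logGauge r₀ α) where
  nonneg s hs hs' := by
    have : 0 ≤ Real.log (r₀ / s) := Real.log_nonneg ((one_le_div hs).2 hs')
    exact mul_nonneg (Real.rpow_nonneg hs.le _) (by positivity)
  tendsto := by
    have h1 := (Real.continuousAt_rpow_const 0 α (Or.inr hα.le)).tendsto.mono_left
      (nhdsWithin_le_nhds (s := Ioi 0))
    rw [Real.zero_rpow hα.ne'] at h1
    have h2 := tendsto_log_mul_rpow_nhdsGT_zero hα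
    have h3 := (h1.mul_const (1 + 1 / α + Real.log r₀)).sub h2
    rw [zero_mul, sub_zero] at h3
    refine h3.congr' ?_
    filter_upwards [self_mem_nhdsWithin] with s hs
    have hs : 0 < s := hs
    rw [logGauge, Real.log_div hr₀.ne' hs.ne']
    ring

theorem hasDerivAt_logGauge {α r₀ s : ℝ} (hα : 0 < α) (hr₀ : 0 < r₀) (hs : 0 < s) :
    HasDerivAt (logGauge r₀ α) (α * (s ^ (α - 1) * (1 + Real.log (r₀ / s)))) s := by
  have h1 := Real.hasDerivAt_rpow_const (p := α) (Or.inl hs.ne')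
  have h2 : HasDerivAt (fun s => 1 + 1 / α + Real.log (r₀ / s)) (-(1 / s)) s := by
    have h3 : HasDerivAt (fun s => 1 + 1 / α + (Real.log r₀ - Real.log s)) (-s⁻¹) s := by
      simpa using ((Real.hasDerivAt_log hs.ne').const_sub (Real.log r₀)).const_add (1 + 1 / α)
    rw [one_div s]
    refine h3.congr_of_eventuallyEq ?_
    filter_upwards [eventually_gt_nhds hs] with t ht
    rw [Real.log_div hr₀.ne' ht.ne']
  refine (h1.mul h2).congr_deriv ?_
  rw [show s ^ α = s ^ (α - 1) * s by rw [← Real.rpow_add_one hs.ne', sub_add_cancel]]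
  field_simp
  ring

/-- Powers below one are Hölder continuous functions of the square. -/
theorem rpow_sub_rpow_le {α s t : ℝ} (hα : 0 < α) (hα' : α < 1) (hs : 0 < s) (hst : s ≤ t) :
    t ^ α - s ^ α ≤ (t ^ 2 - s ^ 2) ^ (α / 2) := by
  have ht := hs.trans_le hst
  have h1 : 0 ≤ t ^ 2 - s ^ 2 := by nlinarith
  have h2 := Real.rpow_add_le_add_rpow (sq_nonneg s) h1 (p := α / 2) (by linarith) (by linarith)
  have e : ∀ x : ℝ, 0 < x → (x ^ 2) ^ (α / 2) = x ^ α := fun x hx => by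
    rw [← Real.rpow_natCast, ← Real.rpow_mul hx.le]; congr 1; push_cast; ring
  rw [add_sub_cancel, e t ht, e s hs] at h2
  linarith

theorem log_inv_mul_rpow_le {x β : ℝ} (hx : 0 < x) (hβ : 0 < β) :
    x ^ β * Real.log x⁻¹ ≤ 1 / β := by
  have h1 := Real.log_le_rpow_div (inv_pos.2 hx).le hβ
  have h2 := mul_le_mul_of_nonneg_left h1 (Real.rpow_nonneg hx.le β)
  rwa [mul_div, ← Real.mul_rpow hx.le (inv_pos.2 hx).le, mul_inv_cancel₀ hx.ne', Real.one_rpow] at h2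

/-- Put `δ = t² - s²` and `x = δ / (K d) ≤ 1`. The increment is bounded by `δ ^ (α / 2)` times a
logarithm of `1 / δ`, which splits into `log (1 / d)`, a constant and `log (1 / x)`. The last is
harmless because `x ^ (α / 2) log (1 / x)` is bounded. -/
theorem logGauge_sub_le {α r₀ K : ℝ} (hα : 0 < α) (hα' : α < 1) (hr₀ : 0 < r₀) (hK : 0 < K) :
    ∃ C, 0 ≤ C ∧ ∀ s t d : ℝ, 0 < s → s ≤ t → t ≤ r₀ → 0 < d → t ^ 2 - s ^ 2 ≤ K * d →
      logGauge r₀ α t - logGauge r₀ α s ≤ C * (d ^ (α / 2) * (1 + |Real.log d|)) := by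
  set L := |Real.log (r₀ ^ 2 / K)| with hL
  refine ⟨K ^ (α / 2) * (1 + 1 / α + (L + 1 + 2 / α)), by positivity, ?_⟩
  intro s t d hs hst ht hd hK'
  have ht0 := hs.trans_le hst
  have hlogt : 0 ≤ Real.log (r₀ / t) := Real.log_nonneg ((one_le_div ht0).2 ht)
  have e1 : Real.log (r₀ / s) = Real.log (r₀ / t) + Real.log (t / s) := by
    rw [← Real.log_mul (by positivity) (by positivity)]; congr 1; field_simp
  have h1 : logGauge r₀ α t - logGauge r₀ α s ≤
      (t ^ α - s ^ α) * (1 + 1 / α + Real.log (r₀ / t)) := by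
    have : 0 ≤ s ^ α * Real.log (t / s) :=
      mul_nonneg (Real.rpow_nonneg hs.le _) (Real.log_nonneg ((one_le_div hs).2 hst))
    rw [logGauge, logGauge, e1]; linarith
  have hl0 : 0 ≤ 1 + |Real.log d| := by positivity
  have hdp : 0 < d ^ (α / 2) := Real.rpow_pos_of_pos hd _
  rcases hst.eq_or_lt with rfl | hlt
  · rw [sub_self] at h1 ⊢; positivity
  set δ := t ^ 2 - s ^ 2 with hδ
  have hδ0 : 0 < δ := by rw [hδ]; nlinarith
  have hδt : δ ≤ t ^ 2 := by rw [hδ]; nlinarith [sq_nonneg s]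
  have h2 : logGauge r₀ α t - logGauge r₀ α s ≤ δ ^ (α / 2) * (1 + 1 / α + Real.log (r₀ / t)) :=
    h1.trans (mul_le_mul_of_nonneg_right (rpow_sub_rpow_le hα hα' hs hst) (by positivity))
  have h3 : Real.log (r₀ / t) ≤ Real.log (r₀ ^ 2 / δ) := by
    have h4 : Real.log (r₀ / t) ≤ 2 * Real.log (r₀ / t) := by linarith
    refine h4.trans ?_
    rw [show (2 : ℝ) * Real.log (r₀ / t) = Real.log ((r₀ / t) ^ 2) by rw [Real.log_pow]; norm_num,
      div_pow]
    refine Real.log_le_log (by positivity) ?_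
    gcongr
  set x := δ / (K * d) with hx
  have hx0 : 0 < x := by positivity
  have hx1 : x ≤ 1 := (div_le_one (by positivity)).2 hK'
  have e2 : Real.log (r₀ ^ 2 / δ) = Real.log (r₀ ^ 2 / K) - Real.log d + Real.log x⁻¹ := by
    rw [← Real.log_div (by positivity) hd.ne', ← Real.log_mul (by positivity) (by positivity)]
    congr 1; rw [hx]; field_simp
  have e3 : δ ^ (α / 2) = K ^ (α / 2) * d ^ (α / 2) * x ^ (α / 2) := by
    rw [← Real.mul_rpow hK.le hd.le, ← Real.mul_rpow (by positivity) hx0.le]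
    congr 1; rw [hx]; field_simp
  have h5 : x ^ (α / 2) ≤ 1 := Real.rpow_le_one hx0.le hx1 (by positivity)
  have h6 : x ^ (α / 2) * Real.log x⁻¹ ≤ 2 / α := by
    have := log_inv_mul_rpow_le hx0 (half_pos hα)
    rwa [one_div_div] at this
  have hx2 : 0 ≤ x ^ (α / 2) := Real.rpow_nonneg hx0.le _
  have h7 : x ^ (α / 2) * (1 + 1 / α + Real.log (r₀ / t)) ≤
      1 + 1 / α + (L + |Real.log d| + 2 / α) := by
    have h8 : Real.log (r₀ ^ 2 / K) - Real.log d ≤ L + |Real.log d| := by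
      have := le_abs_self (Real.log (r₀ ^ 2 / K)); have := neg_abs_le (Real.log d)
      rw [← hL] at *; linarith
    calc x ^ (α / 2) * (1 + 1 / α + Real.log (r₀ / t))
        ≤ x ^ (α / 2) * (1 + 1 / α + (L + |Real.log d| + Real.log x⁻¹)) := by
          refine mul_le_mul_of_nonneg_left ?_ hx2
          rw [e2] at h3; linarith
      _ = x ^ (α / 2) * (1 + 1 / α + L + |Real.log d|) + x ^ (α / 2) * Real.log x⁻¹ := by ring
      _ ≤ 1 * (1 + 1 / α + L + |Real.log d|) + 2 / α := by
          refine add_le_add (mul_le_mul_of_nonneg_right h5 ?_) h6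
          have : 0 ≤ L := abs_nonneg _
          positivity
      _ = _ := by ring
  have hc : 1 + 1 / α + (L + |Real.log d| + 2 / α) ≤
      (1 + 1 / α + (L + 1 + 2 / α)) * (1 + |Real.log d|) := by
    have : 0 ≤ (1 / α + L + 1 + 2 / α) * |Real.log d| := by positivity
    linarith
  calc _ ≤ δ ^ (α / 2) * (1 + 1 / α + Real.log (r₀ / t)) := h2
    _ = K ^ (α / 2) * d ^ (α / 2) * (x ^ (α / 2) * (1 + 1 / α + Real.log (r₀ / t))) := by
        rw [e3]; ring
    _ ≤ K ^ (α / 2) * d ^ (α / 2) * ((1 + 1 / α + (L + 1 + 2 / α)) * (1 + |Real.log d|)) :=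
        mul_le_mul_of_nonneg_left (h7.trans hc) (by positivity)
    _ = _ := by ring

/-! ### Boundary values and moduli of continuity deduced from gauge bounds. -/

namespace SingularDevelopment

variable {G : SingularRegion} {Q : ℝ} {r W φ : ℝ × ℝ → ℝ} {R₀ α : ℝ} {p : ℝ × ℝ}
  (h : SingularDevelopment G Q r W φ R₀ α) {Φ : ℝ → ℝ} {f : ℝ × ℝ → ℝ}

include h

/-- Two causally related points are joined by a `u`-segment followed by a `v`-segment, and the
differences of `Φ ∘ r` along the two telescope. -/
theorem gaugeBound_of_hasDu_hasDv {Φ' : ℝ → ℝ} (hΦ : ∀ p ∈ G.D, HasDerivAt Φ (Φ' (r p)) (r p))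
    {fu fv : ℝ × ℝ → ℝ} {C : ℝ} (hC : 0 ≤ C) (hfu : ∀ p ∈ G.D, HasDu G.D f (fu p) p)
    (hfv : ∀ p ∈ G.D, HasDv G.D f (fv p) p) (hu : ∀ p ∈ G.D, |fu p| ≤ C * (Φ' (r p) / r p))
    (hv : ∀ p ∈ G.D, |fv p| ≤ C * (Φ' (r p) / r p)) : GaugeBound G r Φ f := by
  refine ⟨C / R₀, div_nonneg hC h.R₀_pos.le, ?_⟩
  rintro ⟨u, v⟩ ⟨u', v'⟩ hq hqq hq'
  have hm : (u', v) ∈ G.D := G.isPast.mem_of_le _ hq' _ ⟨hq.1.trans hqq.1, hq.2⟩ ⟨le_rfl, hqq.2⟩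
  have h1 := h.abs_sub_le_u hΦ hfu hu hq.1 hqq.1 hm
  have h2 := h.abs_sub_le_v hΦ hfv hv hq.2 hqq.2 hq'
  have h3 := abs_add_le (f (u', v') - f (u', v)) (f (u', v) - f (u, v))
  rw [sub_add_sub_cancel] at h3
  linarith

theorem gaugeBound_rpow {fu fv : ℝ × ℝ → ℝ} (hfu : ∀ p ∈ G.D, HasDu G.D f (fu p) p)
    (hfv : ∀ p ∈ G.D, HasDv G.D f (fv p) p) (hu : PowBound G.D r (α - 2) fu)
    (hv : PowBound G.D r (α - 2) fv) : GaugeBound G r (fun s => s ^ α / α) f := by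
  obtain ⟨C, hC, hu⟩ := hu
  obtain ⟨C', hC', hv⟩ := hv
  refine h.gaugeBound_of_hasDu_hasDv (Φ' := fun s => s ^ (α - 1)) (C := C + C')
    (fun p hp => h.hasDerivAt_rpow_div h.α_pos.ne' hp)
    (add_nonneg hC hC') hfu hfv (fun p hp => ?_) (fun p hp => ?_)
  · rw [h.rpow_sub_two hp]
    refine (hu p hp).trans (mul_le_mul_of_nonneg_right (by linarith) (Real.rpow_nonneg (h.r_pos hp).le _))
  · rw [h.rpow_sub_two hp]
    refine (hv p hp).trans (mul_le_mul_of_nonneg_right (by linarith) (Real.rpow_nonneg (h.r_pos hp).le _))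

theorem log_nonneg (hp : p ∈ G.D) : 0 ≤ Real.log (r (G.u₀, G.v₀) / r p) :=
  Real.log_nonneg ((one_le_div (h.r_pos hp)).2 (h.r_le hp))

theorem gaugeBound_logGauge {gu gv ku kv : ℝ × ℝ → ℝ}
    (hfu : ∀ p ∈ G.D, HasDu G.D f (gu p + ku p * Real.log (r (G.u₀, G.v₀) / r p)) p)
    (hfv : ∀ p ∈ G.D, HasDv G.D f (gv p + kv p * Real.log (r (G.u₀, G.v₀) / r p)) p)
    (hgu : PowBound G.D r (α - 2) gu) (hgv : PowBound G.D r (α - 2) gv)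
    (hku : PowBound G.D r (α - 2) ku) (hkv : PowBound G.D r (α - 2) kv) :
    GaugeBound G r (logGauge (r (G.u₀, G.v₀)) α) f := by
  have hα := h.α_pos
  have key : ∀ {g k : ℝ × ℝ → ℝ}, PowBound G.D r (α - 2) g → PowBound G.D r (α - 2) k →
      ∃ C, 0 ≤ C ∧ ∀ p ∈ G.D, |g p + k p * Real.log (r (G.u₀, G.v₀) / r p)| ≤
        C * (α * (r p ^ (α - 1) * (1 + Real.log (r (G.u₀, G.v₀) / r p))) / r p) := by
    intro g k hg hk
    obtain ⟨C, hC, hg⟩ := hg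
    obtain ⟨C', hC', hk⟩ := hk
    refine ⟨(C + C') / α, by positivity, fun p hp => ?_⟩
    have hl := h.log_nonneg hp
    have hr : 0 ≤ r p ^ (α - 2) := Real.rpow_nonneg (h.r_pos hp).le _
    have e : (C + C') / α * (α * (r p ^ (α - 1) * (1 + Real.log (r (G.u₀, G.v₀) / r p))) / r p) =
        (C + C') * (r p ^ (α - 2) * (1 + Real.log (r (G.u₀, G.v₀) / r p))) := by
      rw [← h.rpow_sub_two hp]; field_simp
    rw [e]
    have h1 := abs_add_le (g p) (k p * Real.log (r (G.u₀, G.v₀) / r p))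
    rw [abs_mul, abs_of_nonneg hl] at h1
    have h2 := mul_le_mul_of_nonneg_right (hk p hp) hl
    have h3 := hg p hp
    have h4 : 0 ≤ C' * r p ^ (α - 2) := by positivity
    have h5 : 0 ≤ C * (r p ^ (α - 2) * Real.log (r (G.u₀, G.v₀) / r p)) := by positivity
    linarith
  obtain ⟨C, hC, hu⟩ := key hgu hku
  obtain ⟨C', hC', hv⟩ := key hgv hkv
  refine h.gaugeBound_of_hasDu_hasDv
    (Φ' := fun s => α * (s ^ (α - 1) * (1 + Real.log (r (G.u₀, G.v₀) / s)))) (C := C + C')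
    (fun p hp => hasDerivAt_logGauge hα h.r₀_pos (h.r_pos hp)) (add_nonneg hC hC') hfu hfv
    (fun p hp => ?_) (fun p hp => ?_)
  all_goals
    have hn : 0 ≤ α * (r p ^ (α - 1) * (1 + Real.log (r (G.u₀, G.v₀) / r p))) / r p := by
      have := h.log_nonneg hp
      have := h.r_pos hp
      positivity
  · exact (hu p hp).trans (mul_le_mul_of_nonneg_right (by linarith) hn)
  · exact (hv p hp).trans (mul_le_mul_of_nonneg_right (by linarith) hn)

theorem exists_abs_le (hΦ : IsGauge (r (G.u₀, G.v₀)) Φ) (hf : GaugeBound G r Φ f) :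
    ∃ B, ∀ p ∈ G.D, |f p| ≤ B := by
  obtain ⟨C, hC, hf⟩ := hf
  refine ⟨|f (G.u₀, G.v₀)| + C * Φ (r (G.u₀, G.v₀)), fun p hp => ?_⟩
  have h1 := hf _ p le_rfl (G.isPast.lo_le p hp) hp
  have h2 := mul_nonneg hC (hΦ.nonneg _ (h.r_pos hp) (h.r_le hp))
  have h3 := abs_sub_abs_le_abs_sub (f p) (f (G.u₀, G.v₀))
  linarith

theorem tendsto_r {p : ℝ × ℝ} (hp : p ∈ G.S) : Tendsto r (𝓝[G.D] p) (𝓝[>] 0) := by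
  refine tendsto_nhdsWithin_iff.2 ⟨h.sing.singular p hp, ?_⟩
  filter_upwards [self_mem_nhdsWithin] with q hq using h.r_pos hq

/-- Cauchy criterion. Two points near `p` need not be causally related, but both lie in the future
of their meet `q ⊓ q'`, which is again in the region and near `p`. The variation from the meet is at
most a multiple of `Φ (r)` there, which is small. -/
theorem exists_tendsto (hΦ : IsGauge (r (G.u₀, G.v₀)) Φ) (hf : GaugeBound G r Φ f) (hp : p ∈ G.S) :
    ∃ y, Tendsto f (𝓝[G.D] p) (𝓝 y) := by
  have hne : (𝓝[G.D] p).NeBot := by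
    obtain ⟨u, hu, rfl⟩ := hp
    exact G.neBot_nhdsWithin_pt hu
  obtain ⟨C, hC, hf⟩ := hf
  refine cauchy_map_iff_exists_tendsto.1 (Metric.cauchy_iff.2 ⟨inferInstance, fun ε hε => ?_⟩)
  have h1 : Tendsto (fun q => C * Φ (r q)) (𝓝[G.D] p) (𝓝 0) := by
    simpa using (hΦ.tendsto.comp (h.tendsto_r hp)).const_mul C
  obtain ⟨δ, hδ, hball⟩ := Metric.mem_nhdsWithin_iff.1 (h1 (Iio_mem_nhds (half_pos hε)))
  refine ⟨_, image_mem_map (inter_mem (mem_nhdsWithin_of_mem_nhds (Metric.ball_mem_nhds p hδ))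
    self_mem_nhdsWithin), ?_⟩
  rintro _ ⟨q, ⟨hqb, hq⟩, rfl⟩ _ ⟨q', ⟨hqb', hq'⟩, rfl⟩
  have hlo := G.isPast.lo_le q hq
  have hlo' := G.isPast.lo_le q' hq'
  have hc : q ⊓ q' ∈ G.D := G.isPast.mem_of_le q hq _ (le_inf hlo hlo') inf_le_left
  have hcb : q ⊓ q' ∈ Metric.ball p δ := by
    simp only [Metric.mem_ball, Prod.dist_eq, Real.dist_eq, max_lt_iff, abs_lt] at hqb hqb' ⊢
    simp only [Prod.fst_inf, Prod.snd_inf]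
    obtain ⟨⟨a1, a2⟩, a3, a4⟩ := hqb
    obtain ⟨⟨b1, b2⟩, b3, b4⟩ := hqb'
    refine ⟨⟨?_, ?_⟩, ?_, ?_⟩
    · rcases min_choice q.1 q'.1 with e | e <;> rw [e] <;> assumption
    · rcases min_choice q.1 q'.1 with e | e <;> rw [e] <;> assumption
    · rcases min_choice q.2 q'.2 with e | e <;> rw [e] <;> assumption
    · rcases min_choice q.2 q'.2 with e | e <;> rw [e] <;> assumption
  have h2 : C * Φ (r (q ⊓ q')) < ε / 2 := hball ⟨hcb, hc⟩
  have h3 := hf _ _ (le_inf hlo hlo') inf_le_left hq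
  have h4 := hf _ _ (le_inf hlo hlo') inf_le_right hq'
  have h5 := mul_nonneg hC (hΦ.nonneg _ (h.r_pos hq) (h.r_le hq))
  have h6 := mul_nonneg hC (hΦ.nonneg _ (h.r_pos hq') (h.r_le hq'))
  rw [abs_le] at h3 h4
  rw [Real.dist_eq, abs_lt]
  constructor <;> linarith

theorem tendsto_extendFrom (hΦ : IsGauge (r (G.u₀, G.v₀)) Φ) (hf : GaugeBound G r Φ f)
    (hp : p ∈ G.S) : Tendsto f (𝓝[G.D] p) (𝓝 (extendFrom G.D f p)) :=
  _root_.tendsto_extendFrom (h.exists_tendsto hΦ hf hp)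

omit h in
theorem extendFrom_eq_self (hf : ContinuousOn f G.D) (hp : p ∈ G.D) : extendFrom G.D f p = f p :=
  extendFrom_eq (subset_closure hp) (hf p hp)

theorem continuousOn_extendFrom (hΦ : IsGauge (r (G.u₀, G.v₀)) Φ) (hf : GaugeBound G r Φ f)
    (hc : ContinuousOn f G.D) : ContinuousOn (extendFrom G.D f) (G.D ∪ G.S) := by
  refine _root_.continuousOn_extendFrom (union_subset subset_closure ?_) ?_
  · rintro _ ⟨u, hu, rfl⟩
    exact mem_closure_iff_nhdsWithin_neBot.2 (G.neBot_nhdsWithin_pt hu)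
  · rintro p (hp | hp)
    · exact ⟨f p, hc p hp⟩
    · exact h.exists_tendsto hΦ hf hp

/-- Let `x → p` through the causal future of `q` and drop the nonnegative term `Φ (r x)`. The
constant does not depend on `p`, which is used for regularity along the curve. -/
theorem exists_abs_sub_extendFrom_le (hΦ : IsGauge (r (G.u₀, G.v₀)) Φ) (hf : GaugeBound G r Φ f) :
    ∃ C, 0 ≤ C ∧ ∀ p ∈ G.S, ∀ q ∈ G.past p, |f q - extendFrom G.D f p| ≤ C * Φ (r q) := by
  obtain ⟨C, hC, hb⟩ := id hf
  refine ⟨C, hC, ?_⟩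
  rintro _ ⟨u, hu, rfl⟩ q ⟨hq, hq'⟩
  have := G.neBot_nhdsWithin_future hu hq hq'
  have h1 := (h.tendsto_extendFrom hΦ hf ⟨u, hu, rfl⟩).mono_left
    (nhdsWithin_mono _ fun x (hx : x ∈ {x ∈ G.D | q ≤ x}) => hx.1)
  refine le_of_tendsto (h1.const_sub (f q)).abs ?_
  filter_upwards [self_mem_nhdsWithin] with x hx
  have h2 := hb q x (G.isPast.lo_le q hq) hx.2 hx.1
  have h3 := mul_nonneg hC (hΦ.nonneg _ (h.r_pos hx.1) (h.r_le hx.1))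
  rw [abs_sub_comm]
  linarith

theorem exists_area_le : ∃ R₁ > R₀, ∀ p ∈ G.D, areaU G.D r p ≤ R₁ ∧ areaV G.D r p ≤ R₁ := by
  obtain ⟨C, hC, hu⟩ := h.powBound_areaU
  obtain ⟨C', hC', hv⟩ := h.powBound_areaV
  refine ⟨R₀ + C + C' + 1, by linarith, fun p hp => ?_⟩
  have h1 := hu p hp
  have h2 := hv p hp
  rw [Real.rpow_zero, mul_one] at h1 h2
  have := h.R₀_pos
  constructor <;> linarith [le_abs_self (areaU G.D r p), le_abs_self (areaV G.D r p)]

theorem hasDu_r_sq (hp : p ∈ G.D) : HasDu G.D (fun q => r q ^ 2) (-2 * areaU G.D r p) p := by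
  have h0 := (h.r_pos hp).ne'
  refine (((h.hasDu_r hp).mul (h.hasDu_r hp)).congr hp fun q _ => sq _).congr_deriv ?_
  field_simp; ring

theorem hasDv_r_sq (hp : p ∈ G.D) : HasDv G.D (fun q => r q ^ 2) (-2 * areaV G.D r p) p := by
  have h0 := (h.r_pos hp).ne'
  refine (((h.hasDv_r hp).mul (h.hasDv_r hp)).congr hp fun q _ => sq _).congr_deriv ?_
  field_simp; ring

/-- A function whose variation is bounded by a gauge of `r` has the modulus of continuity of that
gauge, as a function of `r ^ 2`. -/
theorem hasModulus (hΦ : IsGauge (r (G.u₀, G.v₀)) Φ) (hf : GaugeBound G r Φ f) {ω : ℝ → ℝ}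
    (hω : ∀ d, 0 < d → 0 ≤ ω d)
    (hm : ∀ K > 0, ∃ C, 0 ≤ C ∧ ∀ s t d : ℝ, 0 < s → s ≤ t → t ≤ r (G.u₀, G.v₀) → 0 < d →
      t ^ 2 - s ^ 2 ≤ K * d → Φ t - Φ s ≤ C * ω d) : HasModulus G.D ω f := by
  obtain ⟨B, hB⟩ := h.exists_abs_le hΦ hf
  obtain ⟨C, hC, hf⟩ := hf
  obtain ⟨R₁, hR₁, hR⟩ := h.exists_area_le
  have hR₁' : 0 < R₁ := h.R₀_pos.trans hR₁
  -- `2 * R₁` is a Lipschitz constant of `r²` along both families of null segments.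
  obtain ⟨C', hC', hm⟩ := hm (2 * R₁) (by positivity)
  have hK : 0 ≤ C * C' := mul_nonneg hC hC'
  refine ⟨|B| + C * C', fun p hp => (hB p hp).trans ?_, ?_, ?_⟩
  · linarith [le_abs_self B]
  · intro u a b hab hs
    have ha : (u, a) ∈ G.D := hs ⟨rfl, le_rfl, hab.le⟩
    have hb : (u, b) ∈ G.D := hs ⟨rfl, hab.le, le_rfl⟩
    have hlo := G.isPast.lo_le _ ha
    have hle : ((u, a) : ℝ × ℝ) ≤ (u, b) := ⟨le_rfl, hab.le⟩
    have h1 := G.isPast.abs_sub_le_v (fun p hp => h.hasDv_r_sq hp)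
      (fun p _ => (HasDv.const (2 * R₁) p).mul (HasDv.snd p)) (fun p hp => by
        have h1 := (hR p hp).2
        have h2 := h.areaV_pos hp
        rw [abs_mul, abs_of_pos h2]; norm_num; linarith) hlo.2 hab.le hb
    have h2 := hm _ _ (b - a) (h.r_pos hb) (h.antitone_r hlo hle hb) (h.r_le ha) (sub_pos.2 hab)
      (by have := (abs_le.1 h1).1; simp only at this; linarith)
    have h3 := hf _ _ hlo hle hb
    have h4 := mul_le_mul_of_nonneg_left h2 hC
    have h5 := mul_nonneg (abs_nonneg B) (hω _ (sub_pos.2 hab))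
    rw [add_mul]; linarith
  · intro v a b hab hs
    have ha : (a, v) ∈ G.D := hs ⟨⟨le_rfl, hab.le⟩, rfl⟩
    have hb : (b, v) ∈ G.D := hs ⟨⟨hab.le, le_rfl⟩, rfl⟩
    have hlo := G.isPast.lo_le _ ha
    have hle : ((a, v) : ℝ × ℝ) ≤ (b, v) := ⟨hab.le, le_rfl⟩
    have h1 := G.isPast.abs_sub_le_u (fun p hp => h.hasDu_r_sq hp)
      (fun p _ => (HasDu.const (2 * R₁) p).mul (HasDu.fst p)) (fun p hp => by
        have h1 := (hR p hp).1
        have h2 := h.areaU_pos hp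
        rw [abs_mul, abs_of_pos h2]; norm_num; linarith) hlo.1 hab.le hb
    have h2 := hm _ _ (b - a) (h.r_pos hb) (h.antitone_r hlo hle hb) (h.r_le ha) (sub_pos.2 hab)
      (by have := (abs_le.1 h1).1; simp only at this; linarith)
    have h3 := hf _ _ hlo hle hb
    have h4 := mul_le_mul_of_nonneg_left h2 hC
    have h5 := mul_nonneg (abs_nonneg B) (hω _ (sub_pos.2 hab))
    rw [add_mul]; linarith

theorem isHolder (hf : GaugeBound G r (fun s => s ^ α / α) f) : IsHolder G.D (α / 2) f := by
  have hα := h.α_pos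
  refine h.hasModulus (isGauge_rpow hα _) hf (fun d hd => Real.rpow_nonneg hd.le _) fun K hK => ?_
  refine ⟨K ^ (α / 2) / α, by positivity, fun s t d hs hst _ hd hK' => ?_⟩
  have h1 := rpow_sub_rpow_le hα h.α_lt hs hst
  have h2 : (t ^ 2 - s ^ 2) ^ (α / 2) ≤ (K * d) ^ (α / 2) :=
    Real.rpow_le_rpow (by nlinarith) hK' (by positivity)
  rw [Real.mul_rpow hK.le hd.le] at h2
  rw [← sub_div, div_mul_eq_mul_div]
  exact div_le_div_of_nonneg_right (h1.trans h2) hα.le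

theorem isLogHolder (hf : GaugeBound G r (logGauge (r (G.u₀, G.v₀)) α) f) :
    IsLogHolder G.D (α / 2) f :=
  h.hasModulus (isGauge_logGauge h.α_pos h.r₀_pos) hf
    (fun d hd => mul_nonneg (Real.rpow_nonneg hd.le _) (by positivity))
    fun _ hK => logGauge_sub_le h.α_pos h.α_lt h.r₀_pos hK

end SingularDevelopment

theorem endpoints_mem_of_vertical {D : Set (ℝ × ℝ)} {u a b : ℝ} (hab : a < b)
    (hs : {u} ×ˢ Icc a b ⊆ D) : (u, a) ∈ D ∧ (u, b) ∈ D :=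
  ⟨hs ⟨rfl, le_rfl, hab.le⟩, hs ⟨rfl, hab.le, le_rfl⟩⟩

theorem endpoints_mem_of_horizontal {D : Set (ℝ × ℝ)} {v a b : ℝ} (hab : a < b)
    (hs : Icc a b ×ˢ {v} ⊆ D) : (a, v) ∈ D ∧ (b, v) ∈ D :=
  ⟨hs ⟨⟨le_rfl, hab.le⟩, rfl⟩, hs ⟨⟨hab.le, le_rfl⟩, rfl⟩⟩

theorem HasModulus.congr {D : Set (ℝ × ℝ)} {ω : ℝ → ℝ} {f g : ℝ × ℝ → ℝ} (hf : HasModulus D ω f)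
    (h : ∀ p ∈ D, g p = f p) : HasModulus D ω g := by
  obtain ⟨C, h0, h1, h2⟩ := hf
  refine ⟨C, fun p hp => by rw [h p hp]; exact h0 p hp, fun u a b hab hs => ?_,
    fun v a b hab hs => ?_⟩
  · rw [h _ ((endpoints_mem_of_vertical hab hs).2), h _ ((endpoints_mem_of_vertical hab hs).1)]; exact h1 u a b hab hs
  · rw [h _ ((endpoints_mem_of_horizontal hab hs).2), h _ ((endpoints_mem_of_horizontal hab hs).1)]; exact h2 v a b hab hs

/-- Locally Lipschitz functions preserve moduli of continuity. -/
theorem HasModulus.comp {D : Set (ℝ × ℝ)} {ω : ℝ → ℝ} {f : ℝ × ℝ → ℝ} {k : ℝ → ℝ}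
    (hf : HasModulus D ω f) (hω : ∀ d, 0 < d → 0 ≤ ω d)
    (hk : ∀ C, ∃ K, 0 ≤ K ∧ ∀ x y, |x| ≤ C → |y| ≤ C → |k x - k y| ≤ K * |x - y|) :
    HasModulus D ω (fun p => k (f p)) := by
  obtain ⟨C, h0, h1, h2⟩ := hf
  obtain ⟨K, hK, hk⟩ := hk |C|
  have hC : ∀ p ∈ D, |f p| ≤ |C| := fun p hp => (h0 p hp).trans (le_abs_self C)
  refine ⟨|k 0| + K * |C| , fun p hp => ?_, fun u a b hab hs => ?_, fun v a b hab hs => ?_⟩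
  · have h3 := hk (f p) 0 (hC p hp) (by rw [abs_zero]; exact abs_nonneg C)
    rw [sub_zero] at h3
    have h4 := abs_sub_abs_le_abs_sub (k (f p)) (k 0)
    have h5 := mul_le_mul_of_nonneg_left (hC p hp) hK
    linarith
  · refine (hk _ _ (hC _ ((endpoints_mem_of_vertical hab hs).2)) (hC _ ((endpoints_mem_of_vertical hab hs).1))).trans ?_
    have h3 := mul_le_mul_of_nonneg_left (h1 u a b hab hs) hK
    have h4 := hω _ (sub_pos.2 hab)
    have h5 := mul_le_mul_of_nonneg_left (mul_le_mul_of_nonneg_right (le_abs_self C) h4) hK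
    have h6 := mul_nonneg (abs_nonneg (k 0)) h4
    linarith
  · refine (hk _ _ (hC _ ((endpoints_mem_of_horizontal hab hs).2)) (hC _ ((endpoints_mem_of_horizontal hab hs).1))).trans ?_
    have h3 := mul_le_mul_of_nonneg_left (h2 v a b hab hs) hK
    have h4 := hω _ (sub_pos.2 hab)
    have h5 := mul_le_mul_of_nonneg_left (mul_le_mul_of_nonneg_right (le_abs_self C) h4) hK
    have h6 := mul_nonneg (abs_nonneg (k 0)) h4
    linarith

end EMSF

/-! ### The renormalized scalar field and mass, and regularity up to the singularity. -/

namespace EMSF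

/-- The scalar field with its leading logarithmic part removed. -/
noncomputable def scalarRemainder (G : SingularRegion) (r φ : ℝ × ℝ → ℝ) (p : ℝ × ℝ) : ℝ :=
  φ p - kasnerU G.D r φ p * Real.log (r (G.u₀, G.v₀) / r p)

/-- The logarithm of the renormalized mass. -/
noncomputable def logMass (G : SingularRegion) (r W φ : ℝ × ℝ → ℝ) (p : ℝ × ℝ) : ℝ :=
  Real.log (4 * areaU G.D r p * areaV G.D r p / (W p * r p ^ 2))
    - (kasnerU G.D r φ p ^ 2 + 1) * Real.log (r (G.u₀, G.v₀) / r p)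

namespace SingularDevelopment

variable {G : SingularRegion} {Q : ℝ} {r W φ : ℝ × ℝ → ℝ} {R₀ α : ℝ} {p : ℝ × ℝ}
  (h : SingularDevelopment G Q r W φ R₀ α)

include h

theorem gaugeBound_areaU : GaugeBound G r (fun s => s ^ α / α) (areaU G.D r) :=
  h.gaugeBound_rpow (fun _ => SingularRegion.hasDu_du h.contDiffOn_areaU)
    (fun _ => h.hasDv_areaU) h.powBound_du_areaU h.powBound_areaSource

theorem gaugeBound_areaV : GaugeBound G r (fun s => s ^ α / α) (areaV G.D r) :=
  h.gaugeBound_rpow (fun _ => h.hasDu_areaV)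
    (fun _ => SingularRegion.hasDv_dv h.contDiffOn_areaV) h.powBound_areaSource h.powBound_dv_areaV

theorem gaugeBound_kasnerU : GaugeBound G r (fun s => s ^ α / α) (kasnerU G.D r φ) :=
  h.gaugeBound_rpow (fun _ => SingularRegion.hasDu_du h.contDiffOn_kasnerU)
    (fun _ => SingularRegion.hasDv_dv h.contDiffOn_kasnerU) h.powBound_du_kasnerU
    h.powBound_dv_kasnerU

theorem hasDerivAt_log_div (hp : p ∈ G.D) :
    HasDerivAt (fun s => Real.log (r (G.u₀, G.v₀) / s)) (-(r p)⁻¹) (r p) := by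
  have h0 := h.r_pos hp
  refine ((Real.hasDerivAt_log h0.ne').const_sub (Real.log (r (G.u₀, G.v₀)))).congr_of_eventuallyEq ?_
  filter_upwards [eventually_gt_nhds h0] with t ht
  rw [Real.log_div h.r₀_pos.ne' ht.ne']

theorem hasDu_log_div (hp : p ∈ G.D) : HasDu G.D (fun q => Real.log (r (G.u₀, G.v₀) / r q))
    (areaU G.D r p / r p ^ 2) p :=
  (HasDu.comp (h.hasDerivAt_log_div hp) (h.hasDu_r hp)).congr_deriv (by
    have := (h.r_pos hp).ne'; field_simp)

theorem hasDv_log_div (hp : p ∈ G.D) : HasDv G.D (fun q => Real.log (r (G.u₀, G.v₀) / r q))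
    (areaV G.D r p / r p ^ 2) p :=
  (HasDv.comp (h.hasDerivAt_log_div hp) (h.hasDv_r hp)).congr_deriv (by
    have := (h.r_pos hp).ne'; field_simp)

/-- Since `∂_u φ = kasnerU ∂_u log (r₀ / r)`, the leading terms cancel exactly in `u`. In `v` they
leave `areaV (kasnerU - kasnerV) / r²` up to sign, of size `r ^ (α - 2)` by
`powBound_kasner_sub_div`. The only other term is a derivative of `kasnerU` times the logarithm. -/
theorem gaugeBound_scalarRemainder :
    GaugeBound G r (logGauge (r (G.u₀, G.v₀)) α) (scalarRemainder G r φ) := by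
  refine h.gaugeBound_logGauge (gu := fun _ => 0) (ku := fun p => -du G.D (kasnerU G.D r φ) p)
    (gv := fun p => -(areaV G.D r p * ((kasnerU G.D r φ p - kasnerV G.D r φ p) / r p ^ 2)))
    (kv := fun p => -dv G.D (kasnerU G.D r φ) p) (fun p hp => ?_) (fun p hp => ?_)
    ⟨0, le_rfl, fun p _ => by simp⟩
    (h.powBound_mul h.powBound_areaV h.powBound_kasner_sub_div (zero_add _)).neg
    h.powBound_du_kasnerU.neg h.powBound_dv_kasnerU.neg
  · exact ((h.hasDu_φ hp).sub ((SingularRegion.hasDu_du h.contDiffOn_kasnerU hp).mul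
      (h.hasDu_log_div hp))).congr_deriv (by ring)
  · exact ((h.hasDv_φ hp).sub ((SingularRegion.hasDv_dv h.contDiffOn_kasnerU hp).mul
      (h.hasDv_log_div hp))).congr_deriv (by ring)

theorem log_mass_eq_u (hp : p ∈ G.D) :
    Real.log (4 * areaU G.D r p * areaV G.D r p / (W p * r p ^ 2)) = Real.log 4 +
      Real.log (areaU G.D r p / (r p * W p)) + Real.log (areaV G.D r p) - Real.log (r p) := by
  have := h.r_pos hp
  have := h.W_pos hp
  have := h.areaU_pos hp
  have := h.areaV_pos hp
  rw [← Real.log_mul (by positivity) (by positivity), ← Real.log_mul (by positivity) (by positivity),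
    ← Real.log_div (by positivity) (by positivity)]
  congr 1; field_simp

theorem log_mass_eq_v (hp : p ∈ G.D) :
    Real.log (4 * areaU G.D r p * areaV G.D r p / (W p * r p ^ 2)) = Real.log 4 +
      Real.log (areaV G.D r p / (r p * W p)) + Real.log (areaU G.D r p) - Real.log (r p) := by
  have := h.r_pos hp
  have := h.W_pos hp
  have := h.areaU_pos hp
  have := h.areaV_pos hp
  rw [← Real.log_mul (by positivity) (by positivity), ← Real.log_mul (by positivity) (by positivity),
    ← Real.log_div (by positivity) (by positivity)]
  congr 1; field_simp

/-- The mass aspect is factored in two ways, each adapted to one Raychaudhuri equation. In `u` the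
terms with `kasnerU ^ 2 + 1` cancel exactly. In `v` the equation brings `kasnerV ^ 2`, and the
mismatch `kasnerV ^ 2 - kasnerU ^ 2` is small through the factor `kasnerU - kasnerV`. -/
theorem gaugeBound_logMass :
    GaugeBound G r (logGauge (r (G.u₀, G.v₀)) α) (logMass G r W φ) := by
  have hPu := h.powBound_mul (h.powBound_mul (PowBound.const (-2)) h.powBound_kasnerU (add_zero _))
    h.powBound_du_kasnerU (zero_add _)
  have hPv := h.powBound_mul (h.powBound_mul (PowBound.const (-2)) h.powBound_kasnerU (add_zero _))
    h.powBound_dv_kasnerU (zero_add _)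
  refine h.gaugeBound_logGauge (gu := fun p => areaSource Q r W p / areaV G.D r p)
    (gv := fun p => -(areaV G.D r p * ((kasnerU G.D r φ p - kasnerV G.D r φ p) / r p ^ 2) *
      (kasnerU G.D r φ p + kasnerV G.D r φ p)) + areaSource Q r W p / areaU G.D r p)
    (fun p hp => ?_) (fun p hp => ?_)
    (h.powBound_divV h.powBound_areaSource)
    ((h.powBound_mul (h.powBound_mul h.powBound_areaV h.powBound_kasner_sub_div (zero_add _))
      (h.powBound_kasnerU.add h.powBound_kasnerV) (add_zero _)).neg.add
      (h.powBound_divU h.powBound_areaSource)) hPu hPv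
  · have h0 := (h.r_pos hp).ne'
    have hb := (h.areaV_pos hp).ne'
    have hP := SingularRegion.hasDu_du h.contDiffOn_kasnerU hp
    refine (((((HasDu.const (Real.log 4) p).add (h.hasDu_log_raych hp)).add
      (HasDu.comp (Real.hasDerivAt_log hb) (h.hasDu_areaV hp))).sub
      (HasDu.comp (Real.hasDerivAt_log h0) (h.hasDu_r hp))).sub
      (((hP.mul hP).add (HasDu.const 1 p)).mul (h.hasDu_log_div hp))).congr hp
      (fun q hq => ?_) |>.congr_deriv ?_
    · rw [logMass, h.log_mass_eq_u hq, sq]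
    · field_simp; ring
  · have h0 := (h.r_pos hp).ne'
    have ha := (h.areaU_pos hp).ne'
    have hP := SingularRegion.hasDv_dv h.contDiffOn_kasnerU hp
    refine (((((HasDv.const (Real.log 4) p).add (h.hasDv_log_raych hp)).add
      (HasDv.comp (Real.hasDerivAt_log ha) (h.hasDv_areaU hp))).sub
      (HasDv.comp (Real.hasDerivAt_log h0) (h.hasDv_r hp))).sub
      (((hP.mul hP).add (HasDv.const 1 p)).mul (h.hasDv_log_div hp))).congr hp
      (fun q hq => ?_) |>.congr_deriv ?_
    · rw [logMass, h.log_mass_eq_v hq, sq]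
    · field_simp; ring

theorem continuousOn_log_div : ContinuousOn (fun q => Real.log (r (G.u₀, G.v₀) / r q)) G.D :=
  (continuousOn_const.div h.contDiffOn_r.continuousOn fun _ hq => (h.r_pos hq).ne').log
    fun _ hq => (div_pos h.r₀_pos (h.r_pos hq)).ne'

theorem continuousOn_scalarRemainder : ContinuousOn (scalarRemainder G r φ) G.D :=
  h.contDiffOn_φ.continuousOn.sub (h.contDiffOn_kasnerU.continuousOn.mul h.continuousOn_log_div)

theorem continuousOn_logMass : ContinuousOn (logMass G r W φ) G.D := by
  refine ContinuousOn.sub (ContinuousOn.log ?_ fun q hq => ?_)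
    (((h.contDiffOn_kasnerU.continuousOn.pow 2).add continuousOn_const).mul h.continuousOn_log_div)
  · exact ((continuousOn_const.mul h.contDiffOn_areaU.continuousOn).mul
      h.contDiffOn_areaV.continuousOn).div (h.contDiffOn_W.continuousOn.mul
      (h.contDiffOn_r.continuousOn.pow 2))
      fun q hq => (mul_pos (h.W_pos hq) (pow_pos (h.r_pos hq) 2)).ne'
  · have := h.r_pos hq
    have := h.W_pos hq
    have := h.areaU_pos hq
    have := h.areaV_pos hq
    positivity

theorem rpow_div_r₀ (hp : p ∈ G.D) (x : ℝ) :
    (r p / r (G.u₀, G.v₀)) ^ x = Real.exp (-(x * Real.log (r (G.u₀, G.v₀) / r p))) := by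
  rw [Real.rpow_def_of_pos (div_pos (h.r_pos hp) h.r₀_pos), ← inv_div, Real.log_inv]
  congr 1; ring

theorem mass_eq (hp : p ∈ G.D) : 4 * (W p)⁻¹ * du G.D r p * dv G.D r p =
    Real.exp (logMass G r W φ p) * (r p / r (G.u₀, G.v₀)) ^ (-(kasnerU G.D r φ p ^ 2 + 1)) := by
  have := h.r_pos hp
  have := h.W_pos hp
  have := h.areaU_pos hp
  have := h.areaV_pos hp
  rw [h.rpow_div_r₀ hp, ← Real.exp_add, logMass, h.du_r hp, h.dv_r hp, neg_mul, neg_neg,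
    sub_add_cancel, Real.exp_log (by positivity)]
  field_simp

theorem isC1Holder_r_sq : IsC1Holder G.D (α / 2) (fun p => r p ^ 2) := by
  have key : ∀ C : ℝ, ∃ K : ℝ, 0 ≤ K ∧
      ∀ x y : ℝ, |x| ≤ C → |y| ≤ C → |-2 * x - -2 * y| ≤ K * |x - y| := fun _ =>
    ⟨2, by norm_num, fun x y _ _ => by rw [← mul_sub, abs_mul]; norm_num⟩
  refine ⟨(h.contDiffOn_r.of_le (by norm_num)).pow 2, ?_, ?_⟩
  · exact (HasModulus.comp (k := fun x => -2 * x) (h.isHolder h.gaugeBound_areaU)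
      (fun d hd => Real.rpow_nonneg hd.le _) key).congr
      fun p hp => SingularRegion.du_eq (h.hasDu_r_sq hp) hp
  · exact (HasModulus.comp (k := fun x => -2 * x) (h.isHolder h.gaugeBound_areaV)
      (fun d hd => Real.rpow_nonneg hd.le _) key).congr
      fun p hp => SingularRegion.dv_eq (h.hasDv_r_sq hp) hp

theorem isLogHolder_mass : IsLogHolder G.D (α / 2) (fun p => Real.exp (logMass G r W φ p)) := by
  refine HasModulus.comp (h.isLogHolder h.gaugeBound_logMass)
    (fun d hd => mul_nonneg (Real.rpow_nonneg hd.le _) (by positivity)) fun C =>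
    ⟨Real.exp C, (Real.exp_pos C).le, ?_⟩
  have key : ∀ x y : ℝ, |x| ≤ C → Real.exp x - Real.exp y ≤ Real.exp C * |x - y| := by
    intro x y hx
    have h1 := Real.add_one_le_exp (y - x)
    have h2 : Real.exp y = Real.exp x * Real.exp (y - x) := by rw [← Real.exp_add]; ring_nf
    calc Real.exp x - Real.exp y ≤ Real.exp x * (x - y) := by
          rw [h2]; nlinarith [Real.exp_pos x]
      _ ≤ Real.exp x * |x - y| := mul_le_mul_of_nonneg_left (le_abs_self _) (Real.exp_pos x).le
      _ ≤ _ := mul_le_mul_of_nonneg_right (Real.exp_le_exp.2 ((le_abs_self x).trans hx))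
        (abs_nonneg _)
  intro x y hx hy
  rw [abs_sub_le_iff]
  refine ⟨key x y hx, ?_⟩
  rw [abs_sub_comm]
  exact key y x hy

/-! ### Regularity of the singular curve -/

omit h in
theorem corner_mem {u t : ℝ} (hu : u ∈ Icc G.uS G.u₁) (ht : t ∈ Icc G.uS G.u₁) (hut : u < t) :
    (u, G.vs t) ∈ G.D :=
  G.mem_of_mem_curve ht ⟨G.hu₀.le.trans hu.1, hut.le⟩ ⟨(G.vs_mem ht).1.le, le_rfl⟩ (Or.inl hut)

/-- The area of the corner sphere below a chord of the singular curve, as an ingoing increment. -/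
theorem exists_corner_u {u t : ℝ} (hu : u ∈ Icc G.uS G.u₁) (ht : t ∈ Icc G.uS G.u₁) (hut : u < t) :
    ∃ s ∈ Ioo u t, (s, G.vs t) ∈ G.D ∧
      r (u, G.vs t) ^ 2 = 2 * areaU G.D r (s, G.vs t) * (t - u) := by
  have hmem : ∀ s ∈ Ico u t, (s, G.vs t) ∈ G.D := fun s hs =>
    corner_mem ⟨hu.1.trans hs.1, hs.2.le.trans ht.2⟩ ht hs.2
  have hc := hmem u ⟨le_rfl, hut⟩
  have hfa : Tendsto (fun s => r (s, G.vs t) ^ 2) (𝓝[>] u) (𝓝 (r (u, G.vs t) ^ 2)) := by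
    refine (h.hasDu_r_sq hc).continuousWithinAt.tendsto.mono_left ?_
    rw [← nhdsWithin_Ioo_eq_nhdsGT hut]
    exact nhdsWithin_mono _ fun x hx => hmem x ⟨hx.1.le, hx.2⟩
  have hfb : Tendsto (fun s => r (s, G.vs t) ^ 2) (𝓝[<] t) (𝓝 0) := by
    have h1 : Tendsto (fun s => (s, G.vs t)) (𝓝[<] t) (𝓝[G.D] (G.pt t)) := by
      refine tendsto_nhdsWithin_iff.2 ⟨?_, ?_⟩
      · exact ((continuous_id.prodMk continuous_const).tendsto' t (G.pt t) rfl).mono_left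
          nhdsWithin_le_nhds
      · filter_upwards [Ico_mem_nhdsLT hut] with x hx using hmem x hx
    simpa using ((h.sing.singular _ ⟨t, ht, rfl⟩).comp h1).pow 2
  -- The value of `r` on the curve itself is arbitrary. Hence the mean value theorem is used in the
  -- form with one-sided limits at the endpoints.
  obtain ⟨s, hs, e⟩ := exists_ratio_hasDerivAt_eq_ratio_slope' (fun s => r (s, G.vs t) ^ 2)
    (fun s => -2 * areaU G.D r (s, G.vs t)) hut id (fun _ => 1)
    (lfa := r (u, G.vs t) ^ 2) (lfb := 0) (lga := u) (lgb := t)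
    (fun s hs => (h.hasDu_r_sq (hmem s ⟨hs.1.le, hs.2⟩)).hasDerivAt
      (mem_of_superset (Ioo_mem_nhds hs.1 hs.2) fun x hx => hmem x ⟨hx.1.le, hx.2⟩))
    (fun s _ => hasDerivAt_id s) hfa (tendsto_id.mono_left nhdsWithin_le_nhds) hfb
    (tendsto_id.mono_left nhdsWithin_le_nhds)
  refine ⟨s, hs, hmem s ⟨hs.1.le, hs.2⟩, ?_⟩
  linarith

/-- The area of the corner sphere below a chord of the singular curve, as an outgoing increment. -/
theorem exists_corner_v {u t : ℝ} (hu : u ∈ Icc G.uS G.u₁) (ht : t ∈ Icc G.uS G.u₁) (hut : u < t) :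
    ∃ s ∈ Ioo (G.vs t) (G.vs u), (u, s) ∈ G.D ∧
      r (u, G.vs t) ^ 2 = 2 * areaV G.D r (u, s) * (G.vs u - G.vs t) := by
  have hvs : G.vs t < G.vs u := G.strictAntiOn_vs hu ht hut
  have hmem : ∀ s ∈ Ico (G.vs t) (G.vs u), (u, s) ∈ G.D := fun s hs =>
    G.mem_of_mem_curve hu ⟨G.hu₀.le.trans hu.1, le_rfl⟩ ⟨(G.vs_mem ht).1.le.trans hs.1, hs.2.le⟩
      (Or.inr hs.2)
  have hc := hmem _ ⟨le_rfl, hvs⟩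
  have hfa : Tendsto (fun s => r (u, s) ^ 2) (𝓝[>] G.vs t) (𝓝 (r (u, G.vs t) ^ 2)) := by
    refine (h.hasDv_r_sq hc).continuousWithinAt.tendsto.mono_left ?_
    rw [← nhdsWithin_Ioo_eq_nhdsGT hvs]
    exact nhdsWithin_mono _ fun x hx => hmem x ⟨hx.1.le, hx.2⟩
  have hfb : Tendsto (fun s => r (u, s) ^ 2) (𝓝[<] G.vs u) (𝓝 0) := by
    have h1 : Tendsto (fun s => (u, s)) (𝓝[<] G.vs u) (𝓝[G.D] (G.pt u)) := by
      refine tendsto_nhdsWithin_iff.2 ⟨?_, ?_⟩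
      · exact ((continuous_const.prodMk continuous_id).tendsto' (G.vs u) (G.pt u) rfl).mono_left
          nhdsWithin_le_nhds
      · filter_upwards [Ico_mem_nhdsLT hvs] with x hx using hmem x hx
    simpa using ((h.sing.singular _ ⟨u, hu, rfl⟩).comp h1).pow 2
  obtain ⟨s, hs, e⟩ := exists_ratio_hasDerivAt_eq_ratio_slope' (fun s => r (u, s) ^ 2)
    (fun s => -2 * areaV G.D r (u, s)) hvs id (fun _ => 1)
    (lfa := r (u, G.vs t) ^ 2) (lfb := 0) (lga := G.vs t) (lgb := G.vs u)
    (fun s hs => (h.hasDv_r_sq (hmem s ⟨hs.1.le, hs.2⟩)).hasDerivAt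
      (mem_of_superset (Ioo_mem_nhds hs.1 hs.2) fun x hx => hmem x ⟨hx.1.le, hx.2⟩))
    (fun s _ => hasDerivAt_id s) hfa (tendsto_id.mono_left nhdsWithin_le_nhds) hfb
    (tendsto_id.mono_left nhdsWithin_le_nhds)
  refine ⟨s, hs, hmem s ⟨hs.1.le, hs.2⟩, ?_⟩
  linarith

/-- The two expressions for `r²` at the corner `(u, vs t)` are equated. The areas are evaluated at
different intermediate points, both in the box spanned by the endpoints of the chord. -/
theorem exists_slope_vs {u t : ℝ} (hu : u ∈ Icc G.uS G.u₁) (ht : t ∈ Icc G.uS G.u₁) (hut : u ≠ t) :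
    ∃ x y, x ∈ G.D ∧ y ∈ G.D ∧ x ∈ uIcc (G.pt u) (G.pt t) ∧ y ∈ uIcc (G.pt u) (G.pt t) ∧
      slope G.vs u t = -(areaU G.D r x / areaV G.D r y) := by
  wlog hlt : u < t generalizing u t with H
  · obtain ⟨x, y, h1, h2, h3, h4, h5⟩ := H ht hu hut.symm (lt_of_le_of_ne (not_lt.1 hlt) hut.symm)
    exact ⟨x, y, h1, h2, by rwa [uIcc_comm], by rwa [uIcc_comm], by rwa [slope_comm]⟩
  obtain ⟨s, hs, hsD, e⟩ := h.exists_corner_u hu ht hlt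
  obtain ⟨s', hs', hsD', e'⟩ := h.exists_corner_v hu ht hlt
  have hvs : G.vs t < G.vs u := G.strictAntiOn_vs hu ht hlt
  refine ⟨_, _, hsD, hsD', ?_, ?_, ?_⟩
  · rw [uIcc, mem_Icc]
    exact ⟨⟨inf_le_left.trans hs.1.le, inf_le_right⟩, ⟨hs.2.le.trans le_sup_right, le_sup_right⟩⟩
  · rw [uIcc, mem_Icc]
    exact ⟨⟨inf_le_left, inf_le_right.trans hs'.1.le⟩, ⟨le_sup_left, hs'.2.le.trans le_sup_left⟩⟩
  · have hb := h.areaV_pos hsD'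
    rw [slope_def_field, div_eq_iff (sub_pos.2 hlt).ne', neg_mul, div_mul_eq_mul_div, eq_comm,
      neg_eq_iff_eq_neg, div_eq_iff hb.ne']
    linarith

theorem le_extendFrom_areaV (hp : p ∈ G.S) : R₀ ≤ extendFrom G.D (areaV G.D r) p := by
  have hne : (𝓝[G.D] p).NeBot := by
    obtain ⟨u, hu, rfl⟩ := hp
    exact G.neBot_nhdsWithin_pt hu
  refine ge_of_tendsto (h.tendsto_extendFrom (isGauge_rpow h.α_pos _) h.gaugeBound_areaV hp) ?_
  filter_upwards [self_mem_nhdsWithin] with q hq using h.le_areaV hq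

/-- As the chord shrinks, its box shrinks to `pt u`, so both intermediate points converge to it
within the region and the areas tend to their boundary values. -/
theorem hasDerivWithinAt_vs {u : ℝ} (hu : u ∈ Icc G.uS G.u₁) :
    HasDerivWithinAt G.vs (-(extendFrom G.D (areaU G.D r) (G.pt u) /
      extendFrom G.D (areaV G.D r) (G.pt u))) (Icc G.uS G.u₁) u := by
  have hS : G.pt u ∈ G.S := ⟨u, hu, rfl⟩
  rw [hasDerivWithinAt_iff_tendsto_slope]
  set F := 𝓝[Icc G.uS G.u₁ \ {u}] u with hF
  have hex : ∀ t, ∃ x y, t ∈ Icc G.uS G.u₁ \ {u} → x ∈ G.D ∧ y ∈ G.D ∧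
      x ∈ uIcc (G.pt u) (G.pt t) ∧ y ∈ uIcc (G.pt u) (G.pt t) ∧
      slope G.vs u t = -(areaU G.D r x / areaV G.D r y) := fun t => by
    by_cases ht : t ∈ Icc G.uS G.u₁ \ {u}
    · obtain ⟨x, y, hxy⟩ := h.exists_slope_vs hu ht.1 (fun e => ht.2 e.symm)
      exact ⟨x, y, fun _ => hxy⟩
    -- A dummy choice for parameters at which no chord exists. It makes `choose` yield functions
    -- defined everywhere.
    · exact ⟨0, 0, fun h => absurd h ht⟩
  choose x y hxy using hex
  have hself : ∀ᶠ t in F, t ∈ Icc G.uS G.u₁ \ {u} := self_mem_nhdsWithin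
  have hpt : Tendsto G.pt F (𝓝 (G.pt u)) :=
    (continuousWithinAt_id.prodMk (G.continuousOn_vs u hu)).tendsto.mono_left
      (nhdsWithin_mono _ sdiff_subset)
  have hinf : Tendsto (fun t => G.pt u ⊓ G.pt t) F (𝓝 (G.pt u)) := by
    have h1 := tendsto_const_nhds.min ((continuous_fst.tendsto _).comp hpt) (a₁ := u)
    have h2 := tendsto_const_nhds.min ((continuous_snd.tendsto _).comp hpt) (a₁ := G.vs u)
    simpa [SingularRegion.pt] using h1.prodMk_nhds h2
  have hsup : Tendsto (fun t => G.pt u ⊔ G.pt t) F (𝓝 (G.pt u)) := by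
    have h1 := tendsto_const_nhds.max ((continuous_fst.tendsto _).comp hpt) (a₁ := u)
    have h2 := tendsto_const_nhds.max ((continuous_snd.tendsto _).comp hpt) (a₁ := G.vs u)
    simpa [SingularRegion.pt] using h1.prodMk_nhds h2
  have hlim : ∀ {z : ℝ → ℝ × ℝ}, (∀ᶠ t in F, z t ∈ uIcc (G.pt u) (G.pt t) ∧ z t ∈ G.D) →
      Tendsto z F (𝓝[G.D] (G.pt u)) := fun {z} hz => by
    refine tendsto_nhdsWithin_iff.2 ⟨?_, hz.mono fun _ h => h.2⟩
    rw [Prod.tendsto_iff]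
    constructor
    · exact tendsto_of_tendsto_of_tendsto_of_le_of_le' ((continuous_fst.tendsto _).comp hinf)
        ((continuous_fst.tendsto _).comp hsup) (hz.mono fun _ h => h.1.1.1)
        (hz.mono fun _ h => h.1.2.1)
    · exact tendsto_of_tendsto_of_tendsto_of_le_of_le' ((continuous_snd.tendsto _).comp hinf)
        ((continuous_snd.tendsto _).comp hsup) (hz.mono fun _ h => h.1.1.2)
        (hz.mono fun _ h => h.1.2.2)
  have h1 := (h.tendsto_extendFrom (isGauge_rpow h.α_pos _) h.gaugeBound_areaU hS).comp
    (hlim (z := x) (hself.mono fun t ht => ⟨(hxy t ht).2.2.1, (hxy t ht).1⟩))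
  have h2 := (h.tendsto_extendFrom (isGauge_rpow h.α_pos _) h.gaugeBound_areaV hS).comp
    (hlim (z := y) (hself.mono fun t ht => ⟨(hxy t ht).2.2.2.1, (hxy t ht).2.1⟩))
  refine ((h1.div h2 (h.R₀_pos.trans_le (h.le_extendFrom_areaV hS)).ne').neg).congr' ?_
  filter_upwards [hself] with t ht
  exact (hxy t ht).2.2.2.2.symm

/-- Boundary values of a function controlled by `r ^ α` are Hölder continuous along the curve. -/
theorem exists_extendFrom_sub_le {f : ℝ × ℝ → ℝ} (hf : GaugeBound G r (fun s => s ^ α / α) f) :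
    ∃ C, 0 ≤ C ∧ ∀ s ∈ Icc G.uS G.u₁, ∀ t ∈ Icc G.uS G.u₁,
      |extendFrom G.D f (G.pt s) - extendFrom G.D f (G.pt t)| ≤ C * |s - t| ^ (α / 2) := by
  have hα := h.α_pos
  obtain ⟨C, hC, hb⟩ := h.exists_abs_sub_extendFrom_le (isGauge_rpow hα _) hf
  obtain ⟨R₁, hR₁, hR⟩ := h.exists_area_le
  have hR₁' : 0 < R₁ := h.R₀_pos.trans hR₁
  refine ⟨2 * C / α * (2 * R₁) ^ (α / 2), by positivity, ?_⟩
  have key : ∀ s ∈ Icc G.uS G.u₁, ∀ t ∈ Icc G.uS G.u₁, s < t →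
      |extendFrom G.D f (G.pt s) - extendFrom G.D f (G.pt t)| ≤
        2 * C / α * (2 * R₁) ^ (α / 2) * |s - t| ^ (α / 2) := by
    intro s hs t ht hst
    -- The corner below the chord is in the past of both boundary points, so both boundary values
    -- are compared with `f` there. At that point `r²` is at most `2 R₁ |s - t|`.
    have hc := corner_mem hs ht hst
    have hvs : G.vs t < G.vs s := G.strictAntiOn_vs hs ht hst
    have h0 := h.r_pos hc
    have h1 := hb _ ⟨s, hs, rfl⟩ (s, G.vs t) ⟨hc, le_rfl, hvs.le⟩
    have h2 := hb _ ⟨t, ht, rfl⟩ (s, G.vs t) ⟨hc, hst.le, le_rfl⟩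
    obtain ⟨x, hx, hxD, e⟩ := h.exists_corner_u hs ht hst
    have h3 : r (s, G.vs t) ^ 2 ≤ 2 * R₁ * |s - t| := by
      rw [e, abs_sub_comm, abs_of_pos (sub_pos.2 hst)]
      have := (hR _ hxD).1
      have := sub_pos.2 hst
      gcongr
    have h4 : r (s, G.vs t) ^ α ≤ (2 * R₁) ^ (α / 2) * |s - t| ^ (α / 2) := by
      rw [← Real.mul_rpow (by positivity) (abs_nonneg _)]
      refine le_trans (le_of_eq ?_) (Real.rpow_le_rpow (sq_nonneg _) h3 (by positivity))
      rw [← Real.rpow_natCast, ← Real.rpow_mul h0.le]; congr 1; push_cast; ring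
    have h5 := mul_le_mul_of_nonneg_left h4 (div_nonneg (mul_nonneg two_pos.le hC) hα.le)
    have e1 : 2 * C / α * r (s, G.vs t) ^ α = 2 * (C * (r (s, G.vs t) ^ α / α)) := by ring
    have h6 := abs_sub_le (extendFrom G.D f (G.pt s)) (f (s, G.vs t)) (extendFrom G.D f (G.pt t))
    rw [abs_sub_comm] at h1
    linarith
  intro s hs t ht
  rcases lt_trichotomy s t with hst | rfl | hst
  · exact key s hs t ht hst
  · rw [sub_self, abs_zero]; positivity
  · rw [abs_sub_comm, abs_sub_comm s t]; exact key t ht s hs hst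

theorem isC1HolderOn_vs : IsC1HolderOn G.uS G.u₁ (α / 2) G.vs := by
  have hα := h.α_pos
  have hR₀ := h.R₀_pos
  set A := fun u => extendFrom G.D (areaU G.D r) (G.pt u) with hA
  set B := fun u => extendFrom G.D (areaV G.D r) (G.pt u) with hB
  have hder : ∀ u ∈ Icc G.uS G.u₁, derivWithin G.vs (Icc G.uS G.u₁) u = -(A u / B u) := fun u hu =>
    (h.hasDerivWithinAt_vs hu).derivWithin (uniqueDiffOn_Icc G.hu₁ u hu)
  have hptS : MapsTo G.pt (Icc G.uS G.u₁) (G.D ∪ G.S) := fun u hu => Or.inr ⟨u, hu, rfl⟩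
  have hptc : ContinuousOn G.pt (Icc G.uS G.u₁) := continuousOn_id.prodMk G.continuousOn_vs
  have hAc : ContinuousOn A (Icc G.uS G.u₁) := (h.continuousOn_extendFrom (isGauge_rpow hα _)
    h.gaugeBound_areaU h.contDiffOn_areaU.continuousOn).comp hptc hptS
  have hBc : ContinuousOn B (Icc G.uS G.u₁) := (h.continuousOn_extendFrom (isGauge_rpow hα _)
    h.gaugeBound_areaV h.contDiffOn_areaV.continuousOn).comp hptc hptS
  have hBR : ∀ u ∈ Icc G.uS G.u₁, R₀ ≤ B u := fun u hu => h.le_extendFrom_areaV ⟨u, hu, rfl⟩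
  have hB0 : ∀ u ∈ Icc G.uS G.u₁, 0 < B u := fun u hu => hR₀.trans_le (hBR u hu)
  refine ⟨?_, ?_⟩
  · rw [show (1 : WithTop ℕ∞) = 0 + 1 by norm_num,
      contDiffOn_succ_iff_derivWithin (uniqueDiffOn_Icc G.hu₁)]
    refine ⟨fun u hu => (h.hasDerivWithinAt_vs hu).differentiableWithinAt, by simp, ?_⟩
    rw [contDiffOn_zero]
    exact (hAc.div hBc fun u hu => (hB0 u hu).ne').neg.congr hder
  · obtain ⟨C, hC, hAh⟩ := h.exists_extendFrom_sub_le h.gaugeBound_areaU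
    obtain ⟨C', hC', hBh⟩ := h.exists_extendFrom_sub_le h.gaugeBound_areaV
    obtain ⟨K, hK⟩ := isCompact_Icc.exists_bound_of_continuousOn hAc
    refine ⟨C / R₀ + |K| * C' / R₀ ^ 2, fun s hs t ht => ?_⟩
    rw [hder s hs, hder t ht]
    have h1 : |A s - A t| ≤ C * |s - t| ^ (α / 2) := hAh s hs t ht
    have h2 : |B s - B t| ≤ C' * |s - t| ^ (α / 2) := hBh s hs t ht
    have h3 : |A t| ≤ |K| := (hK t ht).trans (le_abs_self K)
    have hs0 := hB0 s hs
    have ht0 := hB0 t ht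
    have e : -(A s / B s) - -(A t / B t) = -((A s - A t) / B s) + A t * (B s - B t) / (B s * B t) := by
      field_simp; ring
    have hx : 0 ≤ |s - t| ^ (α / 2) := Real.rpow_nonneg (abs_nonneg _) _
    have h4 : |(A s - A t) / B s| ≤ C / R₀ * |s - t| ^ (α / 2) := by
      rw [abs_div, abs_of_pos hs0, div_mul_eq_mul_div]
      exact div_le_div₀ (by positivity) h1 hR₀ (hBR s hs)
    have h5 : |A t * (B s - B t) / (B s * B t)| ≤ |K| * C' / R₀ ^ 2 * |s - t| ^ (α / 2) := by
      rw [abs_div, abs_of_pos (mul_pos hs0 ht0), div_mul_eq_mul_div, abs_mul, mul_assoc |K|]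
      refine div_le_div₀ (by positivity) (mul_le_mul h3 h2 (abs_nonneg _) (abs_nonneg _))
        (by positivity) ?_
      rw [sq]
      exact mul_le_mul (hBR s hs) (hBR t ht) hR₀.le hs0.le
    rw [e]
    refine (abs_add_le _ _).trans ?_
    rw [abs_neg]
    linarith

end SingularDevelopment

end EMSF

namespace EMSF

/-! ### Convergence at a given rate -/

/-- The deviation of `f` from the constant `c` on `A` is bounded by a multiple of `e`. -/
def HasRate (A : Set (ℝ × ℝ)) (e f : ℝ × ℝ → ℝ) (c : ℝ) : Prop :=
  ∃ C, 0 ≤ C ∧ ∀ q ∈ A, |f q - c| ≤ C * e q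

section HasRate

variable {A : Set (ℝ × ℝ)} {e f g : ℝ × ℝ → ℝ} {c d : ℝ}

theorem HasRate.congr (hf : HasRate A e f c) (h : ∀ q ∈ A, g q = f q) : HasRate A e g c := by
  obtain ⟨C, hC, hf⟩ := hf
  exact ⟨C, hC, fun q hq => by rw [h q hq]; exact hf q hq⟩

theorem HasRate.mono {e' : ℝ × ℝ → ℝ} (hf : HasRate A e f c) (h : ∀ q ∈ A, e q ≤ e' q) :
    HasRate A e' f c := by
  obtain ⟨C, hC, hf⟩ := hf
  exact ⟨C, hC, fun q hq => (hf q hq).trans (mul_le_mul_of_nonneg_left (h q hq) hC)⟩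

theorem HasRate.const (he : ∀ q ∈ A, 0 ≤ e q) (c : ℝ) : HasRate A e (fun _ => c) c :=
  ⟨1, zero_le_one, fun q hq => by simpa using he q hq⟩

theorem HasRate.add (hf : HasRate A e f c) (hg : HasRate A e g d) :
    HasRate A e (fun q => f q + g q) (c + d) := by
  obtain ⟨C, hC, hf⟩ := hf
  obtain ⟨C', hC', hg⟩ := hg
  refine ⟨C + C', add_nonneg hC hC', fun q hq => ?_⟩
  rw [add_sub_add_comm, add_mul]
  exact (abs_add_le _ _).trans (add_le_add (hf q hq) (hg q hq))

theorem HasRate.neg (hf : HasRate A e f c) : HasRate A e (fun q => -f q) (-c) := by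
  obtain ⟨C, hC, hf⟩ := hf
  exact ⟨C, hC, fun q hq => by rw [neg_sub_neg, abs_sub_comm]; exact hf q hq⟩

theorem HasRate.sub (hf : HasRate A e f c) (hg : HasRate A e g d) :
    HasRate A e (fun q => f q - g q) (c - d) := by
  simpa only [sub_eq_add_neg] using hf.add hg.neg

theorem HasRate.mul {B : ℝ} (he : ∀ q ∈ A, 0 ≤ e q) (hB : ∀ q ∈ A, e q ≤ B)
    (hf : HasRate A e f c) (hg : HasRate A e g d) : HasRate A e (fun q => f q * g q) (c * d) := by
  obtain ⟨C, hC, hf⟩ := hf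
  obtain ⟨C', hC', hg⟩ := hg
  refine ⟨C * (|d| + C' * |B|) + |c| * C', by positivity, fun q hq => ?_⟩
  have h1 : |g q| ≤ |d| + C' * |B| := by
    have h2 := abs_sub_abs_le_abs_sub (g q) d
    have h3 := mul_le_mul_of_nonneg_left ((hB q hq).trans (le_abs_self B)) hC'
    linarith [hg q hq]
  rw [show f q * g q - c * d = (f q - c) * g q + c * (g q - d) by ring]
  refine (abs_add_le _ _).trans ?_
  rw [abs_mul, abs_mul, add_mul]
  refine add_le_add ?_ ?_
  · calc |f q - c| * |g q| ≤ (C * e q) * (|d| + C' * |B|) :=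
          mul_le_mul (hf q hq) h1 (abs_nonneg _) (mul_nonneg hC (he q hq))
      _ = _ := by ring
  · rw [mul_assoc]; exact mul_le_mul_of_nonneg_left (hg q hq) (abs_nonneg c)

theorem abs_exp_sub_one_le_mul (x : ℝ) : |Real.exp x - 1| ≤ Real.exp |x| * |x| := by
  rcases le_or_gt 0 x with hx | hx
  · rw [abs_of_nonneg hx, abs_of_nonneg (sub_nonneg.2 (Real.one_le_exp hx))]
    have h1 := Real.add_one_le_exp (-x)
    have h2 : Real.exp x * Real.exp (-x) = 1 := by rw [← Real.exp_add]; simp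
    nlinarith [Real.exp_pos x]
  · rw [abs_of_neg hx, abs_of_nonpos (sub_nonpos.2 (Real.exp_le_one_iff.2 hx.le))]
    have h1 := Real.add_one_le_exp x
    have h2 : (1 : ℝ) ≤ Real.exp (-x) := Real.one_le_exp (by linarith)
    nlinarith

theorem HasRate.exp {B : ℝ} (hB : ∀ q ∈ A, e q ≤ B) (hf : HasRate A e f 0) :
    HasRate A e (fun q => Real.exp (f q)) 1 := by
  obtain ⟨C, hC, hf⟩ := hf
  refine ⟨Real.exp (C * B) * C, by positivity, fun q hq => ?_⟩
  have h1 := hf q hq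
  rw [sub_zero] at h1
  refine (abs_exp_sub_one_le_mul (f q)).trans ?_
  rw [mul_assoc]
  exact mul_le_mul (Real.exp_le_exp.2 (h1.trans (mul_le_mul_of_nonneg_left (hB q hq) hC))) h1
    (abs_nonneg _) (Real.exp_pos _).le

/-- Functions with a common factor differ by that factor times the rate. -/
theorem HasRate.exists_abs_sub_le {F T k : ℝ × ℝ → ℝ} (hf : HasRate A e f c)
    (hF : ∀ q ∈ A, F q = k q * f q) (hT : ∀ q ∈ A, T q = k q * c) :
    ∃ C, 0 ≤ C ∧ ∀ q ∈ A, |F q - T q| ≤ C * (|k q| * e q) := by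
  obtain ⟨C, hC, hf⟩ := hf
  refine ⟨C, hC, fun q hq => ?_⟩
  rw [hF q hq, hT q hq, ← mul_sub, abs_mul, mul_left_comm]
  exact mul_le_mul_of_nonneg_left (hf q hq) (abs_nonneg _)

end HasRate

/-- The rate `r ^ α * (1 + |log r|)`. -/
noncomputable def logRate (r : ℝ × ℝ → ℝ) (α : ℝ) (q : ℝ × ℝ) : ℝ :=
  r q ^ α * (1 + |Real.log (r q)|)

/-- The function `4 Ω⁻² ∂_u r ∂_v r`. -/
noncomputable def massAspect (D : Set (ℝ × ℝ)) (r W : ℝ × ℝ → ℝ) (p : ℝ × ℝ) : ℝ :=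
  4 * areaU D r p * areaV D r p / (W p * r p ^ 2)

namespace SingularDevelopment

variable {G : SingularRegion} {Q : ℝ} {r W φ : ℝ × ℝ → ℝ} {R₀ α : ℝ} {p : ℝ × ℝ}
  (h : SingularDevelopment G Q r W φ R₀ α)

include h

/-! ### Geometric quantities in terms of the renormalized unknowns -/

theorem two_mul_hawkingMass (hp : p ∈ G.D) {θ : ℝ} (hθ : θ ∈ Ioo 0 Real.pi) (ϕ : ℝ) :
    2 * hawkingMass G.D r W ![p.1, p.2, θ, ϕ] = r p * (1 + massAspect G.D r W p) := by
  have h0 := (h.r_pos hp).ne'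
  have hW := (h.W_pos hp).ne'
  have hx : ![p.1, p.2, θ, ϕ] ∈ chart G.D := ⟨hp, hθ⟩
  rw [hawkingMass, gradSq_lift hx h0 hW]
  change 2 * (r p / 2 * (1 - -4 * (W p)⁻¹ * du G.D r p * dv G.D r p)) = _
  rw [h.du_r hp, h.dv_r hp, massAspect]
  field_simp
  ring

theorem gradSq_scalar (hp : p ∈ G.D) {θ : ℝ} (hθ : θ ∈ Ioo 0 Real.pi) (ϕ : ℝ) :
    gradSq (chart G.D) (metric r W) (lift φ) ![p.1, p.2, θ, ϕ] =
      -(massAspect G.D r W p / r p ^ 2 * (kasnerU G.D r φ p * kasnerV G.D r φ p)) := by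
  have h0 := (h.r_pos hp).ne'
  have hW := (h.W_pos hp).ne'
  have hx : ![p.1, p.2, θ, ϕ] ∈ chart G.D := ⟨hp, hθ⟩
  rw [gradSq_lift hx h0 hW]
  change -4 * (W p)⁻¹ * du G.D φ p * dv G.D φ p = _
  rw [h.du_φ hp, h.dv_φ hp, massAspect]
  field_simp

theorem christoffel_eq {x : Fin 4 → ℝ} (hx : x ∈ chart G.D) (i j k : Fin 4) :
    christoffel (chart G.D) (metric r W) k i j x =
      christoffelMatrix (du G.D r (x 0, x 1) / r (x 0, x 1)) (dv G.D r (x 0, x 1) / r (x 0, x 1))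
        (du G.D (fun q => Real.log (W q)) (x 0, x 1)) (dv G.D (fun q => Real.log (W q)) (x 0, x 1))
        (2 * r (x 0, x 1) * du G.D r (x 0, x 1) / W (x 0, x 1))
        (2 * r (x 0, x 1) * dv G.D r (x 0, x 1) / W (x 0, x 1)) (x 2) i k j := by
  set p := (x 0, x 1) with hp'
  have hp : p ∈ G.D := hx.1
  have hr : lift r x = r p := rfl
  have hWx : lift W x = W p := rfl
  have h0 := (h.r_pos hp).ne'
  have hW := (h.W_pos hp).ne'
  rw [christoffel_metric (ru := du G.D r p) (rv := dv G.D r p)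
    (Wu := W p * du G.D (fun q => Real.log (W q)) p)
    (Wv := W p * dv G.D (fun q => Real.log (W q)) p) hx h0 hW, hr, hWx,
    mul_div_cancel_left₀ _ hW, mul_div_cancel_left₀ _ hW]
  · rw [← hp', SingularRegion.du_eq (h.hasDu_r_sq hp) hp, h.du_r hp, hr]; field_simp
  · rw [← hp', SingularRegion.dv_eq (h.hasDv_r_sq hp) hp, h.dv_r hp, hr]; field_simp
  · exact SingularRegion.du_eq (((h.hasDu_W hp).neg.div (HasDu.const 2 p) two_ne_zero).congr_deriv
      (by ring)) hp
  · exact SingularRegion.dv_eq (((h.hasDv_W hp).neg.div (HasDv.const 2 p) two_ne_zero).congr_deriv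
      (by ring)) hp

/-- Used with `ψ` equal to `∂_u r` and to `∂_v r`, for the symbols of the form `2 r ψ / W` in
`christoffelMatrix`. -/
theorem hasDu_mul_div {ψ : ℝ × ℝ → ℝ} {ψ' : ℝ} (hp : p ∈ G.D) (hψ : HasDu G.D ψ ψ' p) :
    HasDu G.D (fun q => 2 * r q * ψ q / W q) (2 * (du G.D r p * ψ p + r p * ψ') / W p
      - 2 * r p * ψ p * (W p * du G.D (fun q => Real.log (W q)) p) / W p ^ 2) p := by
  have hW := (h.W_pos hp).ne'
  have hr := SingularRegion.hasDu_du (h.contDiffOn_r.of_le (by norm_num)) hp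
  refine ((((HasDu.const 2 p).mul hr).mul hψ).div (h.hasDu_W hp) hW).congr_deriv ?_
  field_simp
  ring

theorem hasDv_mul_div {ψ : ℝ × ℝ → ℝ} {ψ' : ℝ} (hp : p ∈ G.D) (hψ : HasDv G.D ψ ψ' p) :
    HasDv G.D (fun q => 2 * r q * ψ q / W q) (2 * (dv G.D r p * ψ p + r p * ψ') / W p
      - 2 * r p * ψ p * (W p * dv G.D (fun q => Real.log (W q)) p) / W p ^ 2) p := by
  have hW := (h.W_pos hp).ne'
  have hr := SingularRegion.hasDv_dv (h.contDiffOn_r.of_le (by norm_num)) hp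
  refine ((((HasDv.const 2 p).mul hr).mul hψ).div (h.hasDv_W hp) hW).congr_deriv ?_
  field_simp
  ring

theorem coordDeriv_christoffel_eq {x : Fin 4 → ℝ} (hx : x ∈ chart G.D) (hp2 : (x 0, x 1) = p)
    {ru rv ωu ωv ruu ruv rvv : ℝ} (hru : du G.D r p = ru) (hrv : dv G.D r p = rv)
    (hωu : du G.D (fun q => Real.log (W q)) p = ωu) (hωv : dv G.D (fun q => Real.log (W q)) p = ωv)
    (hruu : HasDu G.D (du G.D r) ruu p) (hruv : HasDv G.D (du G.D r) ruv p)
    (hrvu : HasDu G.D (dv G.D r) ruv p) (hrvv : HasDv G.D (dv G.D r) rvv p) (c i j k : Fin 4) :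
    coordDeriv (chart G.D) c (christoffel (chart G.D) (metric r W) k i j) x =
      christoffelDeriv (2 * r p * ru / W p) (2 * r p * rv / W p)
        ![ruu / r p - ru ^ 2 / r p ^ 2, ruv / r p - ru * rv / r p ^ 2, 0, 0]
        ![ruv / r p - ru * rv / r p ^ 2, rvv / r p - rv ^ 2 / r p ^ 2, 0, 0]
        ![du G.D (du G.D (fun q => Real.log (W q))) p, logSource G.D Q r W φ p, 0, 0]
        ![logSource G.D Q r W φ p, dv G.D (dv G.D (fun q => Real.log (W q))) p, 0, 0]
        ![2 * (ru ^ 2 + r p * ruu) / W p - 2 * r p * ru * (W p * ωu) / W p ^ 2,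
          2 * (ru * rv + r p * ruv) / W p - 2 * r p * ru * (W p * ωv) / W p ^ 2, 0, 0]
        ![2 * (ru * rv + r p * ruv) / W p - 2 * r p * rv * (W p * ωu) / W p ^ 2,
          2 * (rv ^ 2 + r p * rvv) / W p - 2 * r p * rv * (W p * ωv) / W p ^ 2, 0, 0]
        (x 2) c i k j := by
  subst hru hrv hωu hωv
  have hp : p ∈ G.D := hp2 ▸ hx.1
  have h0 := (h.r_pos hp).ne'
  have hrU := SingularRegion.hasDu_du (h.contDiffOn_r.of_le (by norm_num)) hp
  have hrV := SingularRegion.hasDv_dv (h.contDiffOn_r.of_le (by norm_num)) hp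
  have e1 := SingularRegion.du_eq ((hruu.div hrU h0).congr_deriv
    (g' := ruu / r p - du G.D r p ^ 2 / r p ^ 2) (by field_simp)) hp
  have e2 := SingularRegion.dv_eq ((hruv.div hrV h0).congr_deriv
    (g' := ruv / r p - du G.D r p * dv G.D r p / r p ^ 2) (by field_simp)) hp
  have e3 := SingularRegion.du_eq ((hrvu.div hrU h0).congr_deriv
    (g' := ruv / r p - du G.D r p * dv G.D r p / r p ^ 2) (by field_simp)) hp
  have e4 := SingularRegion.dv_eq ((hrvv.div hrV h0).congr_deriv
    (g' := rvv / r p - dv G.D r p ^ 2 / r p ^ 2) (by field_simp)) hp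
  have e5 := SingularRegion.dv_eq (h.hasDv_du_log hp) hp
  have e6 := SingularRegion.du_eq (h.hasDu_dv_log hp) hp
  have e7 := SingularRegion.du_eq (h.hasDu_mul_div hp hruu) hp
  have e8 := SingularRegion.dv_eq (h.hasDv_mul_div hp hruv) hp
  have e9 := SingularRegion.du_eq (h.hasDu_mul_div hp hrvu) hp
  have e10 := SingularRegion.dv_eq (h.hasDv_mul_div hp hrvv) hp
  rw [← sq] at e7 e10
  rw [mul_comm (dv G.D r p)] at e8
  rw [coordDeriv_christoffel (ρu := fun q => du G.D r q / r q) (ρv := fun q => dv G.D r q / r q)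
    (ωu := du G.D (fun q => Real.log (W q))) (ωv := dv G.D (fun q => Real.log (W q)))
    (σu := fun q => 2 * r q * du G.D r q / W q) (σv := fun q => 2 * r q * dv G.D r q / W q) hx
    (fun y hy i j k => h.christoffel_eq hy i j k), hp2, e1, e2, e3, e4, e5, e6, e7, e8, e9, e10]

theorem kretschmann_eq (hp : p ∈ G.D) {θ : ℝ} (hθ : θ ∈ Ioo 0 Real.pi) (ϕ : ℝ) :
    kretschmann (chart G.D) (metric r W) ![p.1, p.2, θ, ϕ] =
      16 * logSource G.D Q r W φ p ^ 2 / W p ^ 2 +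
      64 / (W p ^ 2 * r p ^ 2) *
        ((-(W p) / (4 * r p) - du G.D r p * dv G.D r p / r p + W p / (4 * r p ^ 3) * Q ^ 2) ^ 2
          + (r p * du G.D φ p ^ 2) * (r p * dv G.D φ p ^ 2)) +
      4 * (1 + 4 * du G.D r p * dv G.D r p / W p) ^ 2 / r p ^ 4 := by
  have h0 := (h.r_pos hp).ne'
  have hW := (h.W_pos hp).ne'
  have hx : ![p.1, p.2, θ, ϕ] ∈ chart G.D := ⟨hp, hθ⟩
  have hs : Real.sin θ ≠ 0 := (sin_pos_of_mem_chart hx).ne'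
  have hR := riemann_metric (D := G.D) (g := metric r W) (x := ![p.1, p.2, θ, ϕ]) (r := r p) (W := W p)
    (ru := du G.D r p) (rv := dv G.D r p) (Wu := W p * du G.D (fun q => Real.log (W q)) p)
    (Wv := W p * dv G.D (fun q => Real.log (W q)) p) h0 hW hs rfl
    (fun i j k => by
      rw [mul_div_cancel_left₀ _ hW, mul_div_cancel_left₀ _ hW]; exact h.christoffel_eq hx i j k)
    (h.coordDeriv_christoffel_eq (p := p) hx rfl rfl rfl rfl rfl (h.hasDu_du_r hp) (h.hasDv_du_r hp)
      (h.hasDu_dv_r hp) (h.hasDv_dv_r hp))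
  have hinv : (metric r W ![p.1, p.2, θ, ϕ])⁻¹ = _ :=
    metric_inv (r := r) (W := W) (x := ![p.1, p.2, θ, ϕ]) h0 hW hs
  rw [EMSF.kretschmann_eq h0 hW (pow_ne_zero 2 hs) hinv hR]
  congr 3
  -- Raychaudhuri's equation: in the Hessian component `∂_u² r - ∂_u r ∂_u log W` the derivative of
  -- `log W` cancels, leaving `-r (∂_u φ)²`, and likewise in `v`.
  have e : ∀ x y z : ℝ, x * y - z - x * (W p * y) / W p = -z := fun x y z => by
    field_simp; ring
  rw [e, e, neg_mul_neg]

/-- The blow-up is factored out as `massAspect² / r⁴`. In the bracket all terms with the inverse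
mass aspect tend to zero, and the four squares tend to `(1 - Ψ²)² + 1 + Ψ⁴ + 1 = 3 - 2 Ψ² + 2 Ψ⁴`.
-/
theorem kretschmann_eq_massAspect (hp : p ∈ G.D) {θ : ℝ} (hθ : θ ∈ Ioo 0 Real.pi) (ϕ : ℝ) :
    kretschmann (chart G.D) (metric r W) ![p.1, p.2, θ, ϕ] =
      4 * massAspect G.D r W p ^ 2 / r p ^ 4 *
      ((1 - kasnerU G.D r φ p * kasnerV G.D r φ p
          + (massAspect G.D r W p)⁻¹ * (1 - 2 * (Q ^ 2 / r p ^ 2))) ^ 2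
        + (1 + (massAspect G.D r W p)⁻¹ * (1 - Q ^ 2 / r p ^ 2)) ^ 2
        + (kasnerU G.D r φ p * kasnerV G.D r φ p) ^ 2 + (1 + (massAspect G.D r W p)⁻¹) ^ 2) := by
  have h0 := (h.r_pos hp).ne'
  have hW := (h.W_pos hp).ne'
  have ha := (h.areaU_pos hp).ne'
  have hb := (h.areaV_pos hp).ne'
  rw [h.kretschmann_eq hp hθ, logSource, h.du_r hp, h.dv_r hp, h.du_φ hp, h.dv_φ hp, massAspect]
  field_simp
  ring

end SingularDevelopment

end EMSF

namespace EMSF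

/-! ### Asymptotics in the past of a point of the singularity -/

theorem logRate_nonneg {r : ℝ × ℝ → ℝ} {q : ℝ × ℝ} (hq : 0 < r q) (α : ℝ) : 0 ≤ logRate r α q :=
  mul_nonneg (Real.rpow_nonneg hq.le _) (by positivity)

theorem rpow_le_logRate {r : ℝ × ℝ → ℝ} {q : ℝ × ℝ} (hq : 0 < r q) (α : ℝ) :
    r q ^ α ≤ logRate r α q :=
  le_mul_of_one_le_right (Real.rpow_nonneg hq.le _) (by linarith [abs_nonneg (Real.log (r q))])

theorem log_div_le {r₀ s : ℝ} (hr₀ : 0 < r₀) (hs : 0 < s) :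
    Real.log (r₀ / s) ≤ (1 + |Real.log r₀|) * (1 + |Real.log s|) - 1 := by
  rw [Real.log_div hr₀.ne' hs.ne']
  have h1 := le_abs_self (Real.log r₀)
  have h2 := neg_abs_le (Real.log s)
  have h3 := mul_nonneg (abs_nonneg (Real.log r₀)) (abs_nonneg (Real.log s))
  linarith

namespace SingularDevelopment

variable {G : SingularRegion} {Q : ℝ} {r W φ : ℝ × ℝ → ℝ} {R₀ α : ℝ} {p q : ℝ × ℝ}
  (h : SingularDevelopment G Q r W φ R₀ α)

include h

theorem rpow_le (hp : p ∈ G.D) : r p ^ α ≤ r (G.u₀, G.v₀) ^ α :=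
  Real.rpow_le_rpow (h.r_pos hp).le (h.r_le hp) h.α_pos.le

theorem exists_logRate_le : ∃ B, ∀ p ∈ G.D, logRate r α p ≤ B := by
  have hα := h.α_pos
  have hr₀ := h.r₀_pos
  set r₀ := r (G.u₀, G.v₀) with hr
  refine ⟨r₀ ^ α * (1 + |Real.log r₀|) + r₀ ^ α / α, fun p hp => ?_⟩
  have h0 := h.r_pos hp
  have h1 : |Real.log (r p)| ≤ |Real.log r₀| + Real.log (r₀ / r p) := by
    have h2 := h.log_nonneg hp
    have h3 : Real.log (r p) = Real.log r₀ - Real.log (r₀ / r p) := by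
      rw [Real.log_div hr₀.ne' h0.ne']; ring
    rw [h3]
    refine (abs_sub _ _).trans ?_
    rw [abs_of_nonneg h2]
  have h4 : r p ^ α * Real.log (r₀ / r p) ≤ r₀ ^ α / α := by
    have h5 := mul_le_mul_of_nonneg_left (Real.log_le_rpow_div (div_pos hr₀ h0).le hα)
      (Real.rpow_nonneg h0.le α)
    rwa [Real.div_rpow hr₀.le h0.le, mul_div, mul_div_cancel₀ _ (Real.rpow_pos_of_pos h0 α).ne'] at h5
  have h6 := mul_le_mul_of_nonneg_right (h.rpow_le hp)
    (show 0 ≤ 1 + |Real.log r₀| by positivity)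
  have h7 := mul_le_mul_of_nonneg_left h1 (Real.rpow_nonneg h0.le α)
  rw [logRate]
  linarith

theorem hasRate_of_gaugeBound {f : ℝ × ℝ → ℝ} (hf : GaugeBound G r (fun s => s ^ α / α) f)
    (hp : p ∈ G.S) : HasRate (G.past p) (fun q => r q ^ α) f (extendFrom G.D f p) := by
  have hα := h.α_pos
  obtain ⟨C, hC, hb⟩ := h.exists_abs_sub_extendFrom_le (isGauge_rpow hα _) hf
  exact ⟨C / α, by positivity, fun q hq => (hb p hp q hq).trans_eq (by ring)⟩

theorem hasRate_of_gaugeBound_logGauge {f : ℝ × ℝ → ℝ}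
    (hf : GaugeBound G r (logGauge (r (G.u₀, G.v₀)) α) f) (hp : p ∈ G.S) :
    HasRate (G.past p) (logRate r α) f (extendFrom G.D f p) := by
  have hα := h.α_pos
  obtain ⟨C, hC, hb⟩ := h.exists_abs_sub_extendFrom_le (isGauge_logGauge hα h.r₀_pos) hf
  refine ⟨C * (1 / α + (1 + |Real.log (r (G.u₀, G.v₀))|)), by positivity, fun q hq =>
    (hb p hp q hq).trans ?_⟩
  rw [mul_assoc]
  refine mul_le_mul_of_nonneg_left ?_ hC
  have h0 := h.r_pos hq.1
  have h1 := log_div_le h.r₀_pos h0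
  have h2 : 0 ≤ 1 / α * |Real.log (r q)| := by positivity
  rw [logGauge, logRate, mul_left_comm]
  refine mul_le_mul_of_nonneg_left ?_ (Real.rpow_nonneg h0.le α)
  linarith

theorem hasRate_of_powBound {f : ℝ × ℝ → ℝ} {k : ℝ} (hf : PowBound G.D r k f) (hk : α ≤ k) :
    HasRate (G.past p) (fun q => r q ^ α) f 0 := by
  obtain ⟨C, hC, hb⟩ := h.powBound_mono hf hk
  exact ⟨C, hC, fun q hq => by rw [sub_zero]; exact hb q hq.1⟩

theorem hasRate_logRate {f : ℝ × ℝ → ℝ} {c : ℝ} (hf : HasRate (G.past p) (fun q => r q ^ α) f c) :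
    HasRate (G.past p) (logRate r α) f c :=
  hf.mono fun _ hq => rpow_le_logRate (h.r_pos hq.1) α

theorem hasRate_rpow_mul {f g : ℝ × ℝ → ℝ} {c d : ℝ}
    (hf : HasRate (G.past p) (fun q => r q ^ α) f c)
    (hg : HasRate (G.past p) (fun q => r q ^ α) g d) :
    HasRate (G.past p) (fun q => r q ^ α) (fun q => f q * g q) (c * d) :=
  hf.mul (fun _ hq => Real.rpow_nonneg (h.r_pos hq.1).le _) (fun _ hq => h.rpow_le hq.1) hg

theorem hasRate_logRate_mul {f g : ℝ × ℝ → ℝ} {c d : ℝ}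
    (hf : HasRate (G.past p) (logRate r α) f c) (hg : HasRate (G.past p) (logRate r α) g d) :
    HasRate (G.past p) (logRate r α) (fun q => f q * g q) (c * d) := by
  obtain ⟨B, hB⟩ := h.exists_logRate_le
  exact hf.mul (fun _ hq => logRate_nonneg (h.r_pos hq.1) α) (fun _ hq => hB _ hq.1) hg

theorem hasRate_logRate_const (c : ℝ) : HasRate (G.past p) (logRate r α) (fun _ => c) c :=
  HasRate.const (fun _ hq => logRate_nonneg (h.r_pos hq.1) α) c

/-- Freezing an exponent at its limit, in front of `log (r₀ / r)`, costs one logarithm. -/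
theorem hasRate_mul_log {f : ℝ × ℝ → ℝ} (hf : HasRate (G.past p) (fun q => r q ^ α) f 0) :
    HasRate (G.past p) (logRate r α) (fun q => f q * Real.log (r (G.u₀, G.v₀) / r q)) 0 := by
  obtain ⟨C, hC, hf⟩ := hf
  refine ⟨C * (1 + |Real.log (r (G.u₀, G.v₀))|), by positivity, fun q hq => ?_⟩
  have h0 := h.r_pos hq.1
  have h1 := hf q hq
  have h2 := h.log_nonneg hq.1
  have h3 := log_div_le h.r₀_pos h0
  rw [sub_zero] at h1 ⊢
  rw [abs_mul, abs_of_nonneg h2, logRate]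
  calc |f q| * Real.log (r (G.u₀, G.v₀) / r q)
      ≤ (C * r q ^ α) * ((1 + |Real.log (r (G.u₀, G.v₀))|) * (1 + |Real.log (r q)|)) :=
        mul_le_mul h1 (by linarith) h2 (mul_nonneg hC (Real.rpow_nonneg h0.le _))
    _ = _ := by ring

theorem hasRate_areaU (hp : p ∈ G.S) :
    HasRate (G.past p) (fun q => r q ^ α) (areaU G.D r) (extendFrom G.D (areaU G.D r) p) :=
  h.hasRate_of_gaugeBound h.gaugeBound_areaU hp

theorem hasRate_areaV (hp : p ∈ G.S) :
    HasRate (G.past p) (fun q => r q ^ α) (areaV G.D r) (extendFrom G.D (areaV G.D r) p) :=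
  h.hasRate_of_gaugeBound h.gaugeBound_areaV hp

theorem hasRate_kasnerU (hp : p ∈ G.S) : HasRate (G.past p) (fun q => r q ^ α) (kasnerU G.D r φ)
    (extendFrom G.D (kasnerU G.D r φ) p) :=
  h.hasRate_of_gaugeBound h.gaugeBound_kasnerU hp

theorem hasRate_kasnerV (hp : p ∈ G.S) : HasRate (G.past p) (fun q => r q ^ α) (kasnerV G.D r φ)
    (extendFrom G.D (kasnerU G.D r φ) p) := by
  have h1 := (h.hasRate_kasnerU hp).sub (h.hasRate_of_powBound h.powBound_kasner_sub le_rfl)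
  rw [sub_zero] at h1
  exact h1.congr fun q _ => by ring

/-- Replacing `kasnerU q` by its boundary value changes `φ` by `O(r ^ α)` times a logarithm, which
has the same rate as the remainder itself. -/
theorem hasRate_scalar (hp : p ∈ G.S) : HasRate (G.past p) (logRate r α)
    (fun q => φ q - extendFrom G.D (kasnerU G.D r φ) p * Real.log (r (G.u₀, G.v₀) / r q))
    (extendFrom G.D (scalarRemainder G r φ) p) := by
  have hP : HasRate (G.past p) (fun q => r q ^ α)
      (fun q => kasnerU G.D r φ q - extendFrom G.D (kasnerU G.D r φ) p) 0 := by
    obtain ⟨C, hC, hb⟩ := h.hasRate_kasnerU hp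
    exact ⟨C, hC, fun q hq => by rw [sub_zero]; exact hb q hq⟩
  have h1 := (h.hasRate_mul_log hP).add
    (h.hasRate_of_gaugeBound_logGauge h.gaugeBound_scalarRemainder hp)
  rw [zero_add] at h1
  exact h1.congr fun q _ => by rw [scalarRemainder]; ring

theorem massAspect_pos (hp : p ∈ G.D) : 0 < massAspect G.D r W p := by
  have := h.r_pos hp
  have := h.W_pos hp
  have := h.areaU_pos hp
  have := h.areaV_pos hp
  rw [massAspect]; positivity

/-- The mass aspect is asymptotic to a multiple of a power of `r`. -/
theorem exists_massAspect_eq (hp : p ∈ G.S) : ∃ δ : ℝ × ℝ → ℝ,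
    HasRate (G.past p) (logRate r α) δ 0 ∧ ∀ q ∈ G.past p, massAspect G.D r W q =
      Real.exp (δ q) * (Real.exp (extendFrom G.D (logMass G r W φ) p) *
        (r (G.u₀, G.v₀) / r q) ^ (extendFrom G.D (kasnerU G.D r φ) p ^ 2 + 1)) := by
  set Ψ := extendFrom G.D (kasnerU G.D r φ) p with hΨ
  set m := extendFrom G.D (logMass G r W φ) p with hm
  have hP : HasRate (G.past p) (fun q => r q ^ α) (fun q => kasnerU G.D r φ q ^ 2 - Ψ ^ 2) 0 := by
    obtain ⟨C, hC, hb⟩ := h.hasRate_rpow_mul (h.hasRate_kasnerU hp) (h.hasRate_kasnerU hp)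
    exact ⟨C, hC, fun q hq => by rw [sub_zero]; simpa only [sq] using hb q hq⟩
  have hM : HasRate (G.past p) (logRate r α) (fun q => logMass G r W φ q - m) 0 := by
    obtain ⟨C, hC, hb⟩ := h.hasRate_of_gaugeBound_logGauge h.gaugeBound_logMass hp
    exact ⟨C, hC, fun q hq => by rw [sub_zero]; exact hb q hq⟩
  have hδ := hM.add (h.hasRate_mul_log hP)
  rw [add_zero] at hδ
  refine ⟨_, hδ, fun q hq => ?_⟩
  rw [Real.rpow_def_of_pos (div_pos h.r₀_pos (h.r_pos hq.1)), ← Real.exp_add, ← Real.exp_add,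
    ← Real.exp_log (h.massAspect_pos hq.1)]
  congr 1
  rw [logMass, massAspect]
  ring

/-- Explicitly, the inverse is `W r² / (4 areaU areaV) = O(r ^ (α + 2))`. The two spare powers
absorb `Q² / r²`. -/
theorem hasRate_inv_massAspect : HasRate (G.past p) (logRate r α)
    (fun q => (massAspect G.D r W q)⁻¹) 0 ∧ ∀ c : ℝ, HasRate (G.past p) (logRate r α)
    (fun q => (massAspect G.D r W q)⁻¹ * (1 - c * (Q ^ 2 / r q ^ 2))) 0 := by
  have hα := h.α_pos
  have h1 : PowBound G.D r (α + 2) (fun q => (massAspect G.D r W q)⁻¹) := by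
    refine (h.powBound_divU (h.powBound_divV (h.powBound_mul (h.powBound_mul h.powBound_W
      (PowBound.rpow (fun _ => h.r_pos) 2) rfl) (PowBound.const (1 / 4)) (add_zero _)))).congr
      fun q hq => ?_
    have := h.areaU_pos hq
    have := h.areaV_pos hq
    have := h.W_pos hq
    have := h.r_pos hq
    rw [massAspect, Real.rpow_two]
    field_simp
  have h2 : ∀ c : ℝ, PowBound G.D r (-2) (fun q => 1 - c * (Q ^ 2 / r q ^ 2)) := fun c =>
    (h.powBound_mono (PowBound.const 1) (by norm_num)).sub
      (h.powBound_mul (PowBound.const c) (h.powBound_div_pow (PowBound.const (Q ^ 2)) 2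
        (l := -2) (by norm_num)) (zero_add _))
  exact ⟨h.hasRate_logRate (h.hasRate_of_powBound h1 (by linarith)), fun c =>
    h.hasRate_logRate (h.hasRate_of_powBound (h.powBound_mul h1 (h2 c) rfl) (by linarith))⟩

/-- Common scheme for all the power-law asymptotics: the quantity and its model share the prefactor
`K r ^ x`, and the remaining factor converges at the logarithmic rate. -/
theorem exists_bound_of_hasRate {F T f : ℝ × ℝ → ℝ} {c K x y : ℝ} (hK : 0 ≤ K)
    (hf : HasRate (G.past p) (logRate r α) f c) (hF : ∀ q ∈ G.past p, F q = K * r q ^ x * f q)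
    (hT : ∀ q ∈ G.past p, T q = K * r q ^ x * c) (hxy : x + α = y) :
    ∃ C, 0 ≤ C ∧ ∀ q ∈ G.past p, |F q - T q| ≤ C * (r q ^ y * (1 + |Real.log (r q)|)) := by
  obtain ⟨C, hC, hb⟩ := hf.exists_abs_sub_le hF hT
  refine ⟨C * K, mul_nonneg hC hK, fun q hq => (hb q hq).trans_eq ?_⟩
  have h0 := h.r_pos hq.1
  rw [abs_of_nonneg (mul_nonneg hK (Real.rpow_nonneg h0.le _)), logRate, ← hxy, Real.rpow_add h0]
  ring

theorem exists_W_bound (hp : p ∈ G.S) : ∃ C, 0 ≤ C ∧ ∀ q ∈ G.past p,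
    |W q - 4 * extendFrom G.D (areaU G.D r) p * extendFrom G.D (areaV G.D r) p /
      r (G.u₀, G.v₀) ^ 2 * (Real.exp (extendFrom G.D (logMass G r W φ) p))⁻¹ *
      (r q / r (G.u₀, G.v₀)) ^ (extendFrom G.D (kasnerU G.D r φ) p ^ 2 - 1)| ≤
      C * (r q ^ (extendFrom G.D (kasnerU G.D r φ) p ^ 2 - 1 + α) * (1 + |Real.log (r q)|)) := by
  obtain ⟨B, hB⟩ := h.exists_logRate_le
  obtain ⟨δ, hδ, hμ⟩ := h.exists_massAspect_eq hp
  have hr₀ := h.r₀_pos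
  set r₀ := r (G.u₀, G.v₀)
  set M := Real.exp (extendFrom G.D (logMass G r W φ) p)
  have hM : 0 < M := Real.exp_pos _
  set x := extendFrom G.D (kasnerU G.D r φ) p ^ 2
  have hy₀ : 0 < r₀ ^ x := Real.rpow_pos_of_pos hr₀ x
  have hδ' := hδ.neg
  rw [neg_zero] at hδ'
  have he := HasRate.exp (fun q hq => hB q hq.1) hδ'
  have hf := h.hasRate_logRate_mul (h.hasRate_logRate_mul (h.hasRate_logRate (h.hasRate_areaU hp))
    (h.hasRate_logRate (h.hasRate_areaV hp))) he
  rw [mul_one] at hf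
  -- From `W = 4 areaU areaV / (massAspect r²)` and the asymptotics of `massAspect`: the power `(r₀
  -- / r) ^ (x + 1)` in the denominator supplies `r₀ ^ (-x - 1)` to `K` and leaves `r ^ (x - 1)`.
  refine h.exists_bound_of_hasRate (K := 4 / r₀ * M⁻¹ * (r₀ ^ x)⁻¹) (x := x - 1) (by positivity) hf
    (fun q hq => ?_) (fun q hq => ?_) rfl
  · have h0 := h.r_pos hq.1
    have ha := h.areaU_pos hq.1
    have hb := h.areaV_pos hq.1
    have hW := h.W_pos hq.1
    have hy : 0 < r q ^ x := Real.rpow_pos_of_pos h0 x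
    have e := hμ q hq
    rw [Real.div_rpow hr₀.le h0.le, Real.rpow_add_one hr₀.ne', Real.rpow_add_one h0.ne',
      massAspect] at e
    rw [Real.rpow_sub_one h0.ne', Real.exp_neg]
    have hE := Real.exp_pos (δ q)
    field_simp at e ⊢
    linarith
  · have h0 := h.r_pos hq.1
    have hy : 0 < r q ^ x := Real.rpow_pos_of_pos h0 x
    rw [Real.div_rpow h0.le hr₀.le, Real.rpow_sub_one hr₀.ne', Real.rpow_sub_one h0.ne']
    field_simp

theorem exists_hawkingMass_bound (hp : p ∈ G.S) : ∃ C, 0 ≤ C ∧ ∀ q ∈ G.past p,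
    |r q * (1 + massAspect G.D r W q) - Real.exp (extendFrom G.D (logMass G r W φ) p) *
      r (G.u₀, G.v₀) * (r (G.u₀, G.v₀) / r q) ^ (extendFrom G.D (kasnerU G.D r φ) p ^ 2)| ≤
      C * (r q ^ (-(extendFrom G.D (kasnerU G.D r φ) p ^ 2) + α) * (1 + |Real.log (r q)|)) := by
  obtain ⟨B, hB⟩ := h.exists_logRate_le
  obtain ⟨δ, hδ, hμ⟩ := h.exists_massAspect_eq hp
  have hr₀ := h.r₀_pos
  set r₀ := r (G.u₀, G.v₀)
  set M := Real.exp (extendFrom G.D (logMass G r W φ) p)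
  have hM : 0 < M := Real.exp_pos _
  set x := extendFrom G.D (kasnerU G.D r φ) p ^ 2
  have hy₀ : 0 < r₀ ^ x := Real.rpow_pos_of_pos hr₀ x
  have hf := h.hasRate_logRate_mul (HasRate.exp (fun q hq => hB q hq.1) hδ)
    ((h.hasRate_logRate_const 1).add h.hasRate_inv_massAspect.1)
  rw [add_zero, mul_one] at hf
  refine h.exists_bound_of_hasRate (K := M * r₀ * r₀ ^ x) (x := -x) (by positivity) hf
    (fun q hq => ?_) (fun q hq => ?_) rfl
  · have h0 := h.r_pos hq.1
    have hy : 0 < r q ^ x := Real.rpow_pos_of_pos h0 x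
    have hm := h.massAspect_pos hq.1
    have e := hμ q hq
    rw [Real.div_rpow hr₀.le h0.le, Real.rpow_add_one hr₀.ne', Real.rpow_add_one h0.ne'] at e
    rw [Real.rpow_neg h0.le]
    have e2 : M * r₀ * r₀ ^ x * (r q ^ x)⁻¹ * (Real.exp (δ q) * (1 + (massAspect G.D r W q)⁻¹)) =
        (Real.exp (δ q) * (M * (r₀ ^ x * r₀ / (r q ^ x * r q)))) * r q *
          (1 + (massAspect G.D r W q)⁻¹) := by field_simp
    rw [e2, ← e]
    field_simp
    ring
  · have h0 := h.r_pos hq.1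
    rw [Real.div_rpow hr₀.le h0.le, Real.rpow_neg h0.le]
    ring

theorem exists_gradSq_bound (hp : p ∈ G.S) : ∃ C, 0 ≤ C ∧ ∀ q ∈ G.past p,
    |-(massAspect G.D r W q / r q ^ 2 * (kasnerU G.D r φ q * kasnerV G.D r φ q)) -
      -(Real.exp (extendFrom G.D (logMass G r W φ) p) * extendFrom G.D (kasnerU G.D r φ) p ^ 2 /
      r (G.u₀, G.v₀) ^ 2 *
      (r (G.u₀, G.v₀) / r q) ^ (extendFrom G.D (kasnerU G.D r φ) p ^ 2 + 3))| ≤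
      C * (r q ^ (-(extendFrom G.D (kasnerU G.D r φ) p ^ 2) - 3 + α) *
        (1 + |Real.log (r q)|)) := by
  obtain ⟨B, hB⟩ := h.exists_logRate_le
  obtain ⟨δ, hδ, hμ⟩ := h.exists_massAspect_eq hp
  have hr₀ := h.r₀_pos
  have hPO := h.hasRate_logRate (h.hasRate_rpow_mul (h.hasRate_kasnerU hp) (h.hasRate_kasnerV hp))
  rw [← sq] at hPO
  set r₀ := r (G.u₀, G.v₀)
  set M := Real.exp (extendFrom G.D (logMass G r W φ) p)
  have hM : 0 < M := Real.exp_pos _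
  set x := extendFrom G.D (kasnerU G.D r φ) p ^ 2
  have hy₀ : 0 < r₀ ^ x := Real.rpow_pos_of_pos hr₀ x
  have hf := (h.hasRate_logRate_mul (HasRate.exp (fun q hq => hB q hq.1) hδ) hPO).neg
  rw [one_mul] at hf
  have e3 : ∀ s : ℝ, 0 < s → s ^ (x + 3) = s ^ x * s ^ 3 := fun s hs => by
    rw [Real.rpow_add hs]; norm_num
  refine h.exists_bound_of_hasRate (K := M * r₀ * r₀ ^ x) (x := -x - 3) (by positivity) hf
    (fun q hq => ?_) (fun q hq => ?_) rfl
  · have h0 := h.r_pos hq.1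
    have hy : 0 < r q ^ x := Real.rpow_pos_of_pos h0 x
    rw [hμ q hq, Real.div_rpow hr₀.le h0.le, Real.rpow_add_one hr₀.ne', Real.rpow_add_one h0.ne',
      show -x - 3 = -(x + 3) by ring, Real.rpow_neg h0.le, e3 _ h0]
    field_simp
  · have h0 := h.r_pos hq.1
    have hy : 0 < r q ^ x := Real.rpow_pos_of_pos h0 x
    rw [Real.div_rpow hr₀.le h0.le, show -x - 3 = -(x + 3) by ring, Real.rpow_neg h0.le, e3 _ h0,
      e3 _ hr₀]
    field_simp

theorem exists_kretschmann_bound (hp : p ∈ G.S) : ∃ C, 0 ≤ C ∧ ∀ q ∈ G.past p,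
    |4 * massAspect G.D r W q ^ 2 / r q ^ 4 *
      ((1 - kasnerU G.D r φ q * kasnerV G.D r φ q
          + (massAspect G.D r W q)⁻¹ * (1 - 2 * (Q ^ 2 / r q ^ 2))) ^ 2
        + (1 + (massAspect G.D r W q)⁻¹ * (1 - Q ^ 2 / r q ^ 2)) ^ 2
        + (kasnerU G.D r φ q * kasnerV G.D r φ q) ^ 2 + (1 + (massAspect G.D r W q)⁻¹) ^ 2) -
      Real.exp (extendFrom G.D (logMass G r W φ) p) ^ 2 *
      (r (G.u₀, G.v₀) / r q) ^ (2 * (extendFrom G.D (kasnerU G.D r φ) p ^ 2 + 3)) *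
      (4 * (3 - 2 * extendFrom G.D (kasnerU G.D r φ) p ^ 2 +
        2 * extendFrom G.D (kasnerU G.D r φ) p ^ 4) / r (G.u₀, G.v₀) ^ 4)| ≤
      C * (r q ^ (-2 * extendFrom G.D (kasnerU G.D r φ) p ^ 2 - 6 + α) *
        (1 + |Real.log (r q)|)) := by
  obtain ⟨B, hB⟩ := h.exists_logRate_le
  obtain ⟨δ, hδ, hμ⟩ := h.exists_massAspect_eq hp
  have hr₀ := h.r₀_pos
  have hPO := h.hasRate_logRate (h.hasRate_rpow_mul (h.hasRate_kasnerU hp) (h.hasRate_kasnerV hp))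
  rw [← sq] at hPO
  have h1 := h.hasRate_logRate_const (p := p) 1
  obtain ⟨hm, hmQ⟩ := h.hasRate_inv_massAspect (p := p)
  have hm1 := hmQ 1
  simp only [one_mul] at hm1
  have hA := (h1.sub hPO).add (hmQ 2)
  have hB' := h1.add hm1
  have hD := h1.add hm
  have hE := HasRate.exp (fun q hq => hB q hq.1) hδ
  -- The limit of the squared exponential is `1`, and that of the bracket is the sum of the limits
  -- of the four squares.
  have hf := h.hasRate_logRate_mul (h.hasRate_logRate_mul hE hE)
    ((((h.hasRate_logRate_mul hA hA).add (h.hasRate_logRate_mul hB' hB')).add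
      (h.hasRate_logRate_mul hPO hPO)).add (h.hasRate_logRate_mul hD hD))
  simp only [← sq] at hf
  rw [show extendFrom G.D (kasnerU G.D r φ) p ^ 4 = (extendFrom G.D (kasnerU G.D r φ) p ^ 2) ^ 2 by
    ring]
  set r₀ := r (G.u₀, G.v₀)
  set M := Real.exp (extendFrom G.D (logMass G r W φ) p)
  have hM : 0 < M := Real.exp_pos _
  set x := extendFrom G.D (kasnerU G.D r φ) p ^ 2
  have hy₀ : 0 < r₀ ^ x := Real.rpow_pos_of_pos hr₀ x
  have e6 : ∀ s : ℝ, 0 < s → s ^ (2 * (x + 3)) = (s ^ x) ^ 2 * s ^ 6 := fun s hs => by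
    rw [show 2 * (x + 3) = x + x + 6 by ring, Real.rpow_add hs, Real.rpow_add hs, sq]; norm_num
  -- The constant part of `4 massAspect² / r⁴` is `4 M² (r₀ ^ (x + 1))²`, and its power of `r` is
  -- `-2 (x + 1) - 4 = -2 x - 6`.
  refine h.exists_bound_of_hasRate (K := 4 * M ^ 2 * (r₀ ^ x) ^ 2 * r₀ ^ 2) (x := -2 * x - 6)
    (by positivity) hf (fun q hq => ?_) (fun q hq => ?_) rfl
  · have h0 := h.r_pos hq.1
    have hy : 0 < r q ^ x := Real.rpow_pos_of_pos h0 x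
    have e : massAspect G.D r W q ^ 2 =
        Real.exp (δ q) ^ 2 * (M ^ 2 * (r₀ ^ x * r₀ / (r q ^ x * r q)) ^ 2) := by
      rw [hμ q hq, Real.div_rpow hr₀.le h0.le, Real.rpow_add_one hr₀.ne',
        Real.rpow_add_one h0.ne']
      ring
    have e' : ∀ z : ℝ, 4 * (Real.exp (δ q) ^ 2 * (M ^ 2 * (r₀ ^ x * r₀ / (r q ^ x * r q)) ^ 2)) /
        r q ^ 4 * z = 4 * M ^ 2 * (r₀ ^ x) ^ 2 * r₀ ^ 2 * ((r q ^ x) ^ 2 * r q ^ 6)⁻¹ *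
          (Real.exp (δ q) ^ 2 * z) := fun z => by field_simp
    rw [e, show -2 * x - 6 = -(2 * (x + 3)) by ring, Real.rpow_neg h0.le, e6 _ h0]
    exact e' _
  · have h0 := h.r_pos hq.1
    have hy : 0 < r q ^ x := Real.rpow_pos_of_pos h0 x
    rw [Real.div_rpow hr₀.le h0.le, show -2 * x - 6 = -(2 * (x + 3)) by ring, Real.rpow_neg h0.le,
      e6 _ h0, e6 _ hr₀]
    field_simp
    ring

end SingularDevelopment

end EMSF

/-! ### Assembly of the asymptotics. -/

theorem theorem3p2
    (G : SingularRegion) (Q : ℝ) (hQ : Q ≠ 0) (r W φ : ℝ × ℝ → ℝ)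
    (hsol : IsStronglySingular G Q r W φ)
    (R₀ : ℝ) (hR₀ : 0 < R₀) (hQTS : QTS G.D r R₀)
    (α : ℝ) (hα : α ∈ Ioo (0 : ℝ) 1) (hSKE : SKE G.D r φ α)
    (r₀ : ℝ) (hr₀ : r₀ = r (G.u₀, G.v₀)) :
    -- (I) asymptotics for `r`
    IsC1Holder G.D (α / 2) (fun p => r p ^ 2) ∧
    (∃ R₁ > R₀, ∀ p ∈ G.D,
      -(r p) * du G.D r p ∈ Icc R₀ R₁ ∧ -(r p) * dv G.D r p ∈ Icc R₀ R₁) ∧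
    IsC1HolderOn G.uS G.u₁ (α / 2) G.vs ∧
    ∃ Cu Cv Ψ Ξ M : ℝ × ℝ → ℝ,
      (∀ p ∈ G.S,
        Tendsto (fun q => -(r q) * du G.D r q) (𝓝[G.D] p) (𝓝 (Cu p)) ∧
        Tendsto (fun q => -(r q) * dv G.D r q) (𝓝[G.D] p) (𝓝 (Cv p))) ∧
      -- (II) asymptotics for `φ`
      IsHolder G.D (α / 2) Ψ ∧ IsLogHolder G.D (α / 2) Ξ ∧
      ContinuousOn Ψ (G.D ∪ G.S) ∧ ContinuousOn Ξ (G.D ∪ G.S) ∧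
      (∀ p ∈ G.D, φ p = Ψ p * Real.log (r₀ / r p) + Ξ p) ∧
      -- (III) asymptotics for `Ω²`
      IsLogHolder G.D (α / 2) M ∧ ContinuousOn M (G.D ∪ G.S) ∧ (∀ p ∈ G.D ∪ G.S, 0 < M p) ∧
      (∀ p ∈ G.D, 4 * (W p)⁻¹ * du G.D r p * dv G.D r p =
        M p * (r p / r₀) ^ (-(Ψ p ^ 2 + 1))) ∧
      (∀ p ∈ G.S, ∃ D > 0, ∀ q ∈ G.past p,
        -- (IV) estimates localized at a TIP
        |-(r q) * du G.D r q - Cu p| ≤ D * r q ^ α ∧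
        |-(r q) * dv G.D r q - Cv p| ≤ D * r q ^ α ∧
        |r q ^ 2 * du G.D φ q - Cu p * Ψ p| ≤ D * r q ^ α ∧
        |r q ^ 2 * dv G.D φ q - Cv p * Ψ p| ≤ D * r q ^ α ∧
        |φ q - Ψ p * Real.log (r₀ / r q) - Ξ p| ≤ D * (r q ^ α * (1 + |Real.log (r q)|)) ∧
        |W q - 4 * Cu p * Cv p / r₀ ^ 2 * (M p)⁻¹ * (r q / r₀) ^ (Ψ p ^ 2 - 1)| ≤
          D * (r q ^ (Ψ p ^ 2 - 1 + α) * (1 + |Real.log (r q)|)) ∧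
        -- (V) precise blow-up estimates, at every point of the sphere over `q`
        ∀ θ ∈ Ioo 0 Real.pi, ∀ ϕ : ℝ,
          |2 * hawkingMass G.D r W ![q.1, q.2, θ, ϕ] - M p * r₀ * (r₀ / r q) ^ (Ψ p ^ 2)| ≤
            D * (r q ^ (-(Ψ p ^ 2) + α) * (1 + |Real.log (r q)|)) ∧
          |kretschmann (chart G.D) (metric r W) ![q.1, q.2, θ, ϕ] -
              M p ^ 2 * (r₀ / r q) ^ (2 * (Ψ p ^ 2 + 3)) *
                (4 * (3 - 2 * Ψ p ^ 2 + 2 * Ψ p ^ 4) / r₀ ^ 4)| ≤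
            D * (r q ^ (-2 * Ψ p ^ 2 - 6 + α) * (1 + |Real.log (r q)|)) ∧
          |gradSq (chart G.D) (metric r W) (lift φ) ![q.1, q.2, θ, ϕ] +
              M p * Ψ p ^ 2 / r₀ ^ 2 * (r₀ / r q) ^ (Ψ p ^ 2 + 3)| ≤
            D * (r q ^ (-(Ψ p ^ 2) - 3 + α) * (1 + |Real.log (r q)|))) ∧
      (∀ q ∈ G.D, ∀ θ ∈ Ioo 0 Real.pi, ∀ ϕ : ℝ,
        tensorSq (metric r W) (maxwell Q r W) ![q.1, q.2, θ, ϕ] = -2 * Q ^ 2 / r q ^ 4) := by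
  subst hr₀
  have h : SingularDevelopment G Q r W φ R₀ α := ⟨hsol, hR₀, hQTS, hα.1, hα.2, hSKE⟩
  have hr₀ := h.r₀_pos
  have hg := isGauge_rpow hα.1 (r (G.u₀, G.v₀))
  have hlg := isGauge_logGauge hα.1 hr₀
  -- `Ψ` is the extension of `kasnerU`; by `hasRate_kasnerV`, `kasnerV` has the same boundary
  -- values. The mass is the exponential of an extended logarithm, hence positive on the singularity
  -- too.
  refine ⟨h.isC1Holder_r_sq, ?_, h.isC1HolderOn_vs, extendFrom G.D (areaU G.D r),
    extendFrom G.D (areaV G.D r), extendFrom G.D (kasnerU G.D r φ),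
    extendFrom G.D (scalarRemainder G r φ),
    fun p => Real.exp (extendFrom G.D (logMass G r W φ) p), fun p hp => ?_, ?_, ?_, ?_, ?_, ?_, ?_,
    ?_, ?_, ?_, ?_, ?_⟩
  · obtain ⟨R₁, hR₁, hR⟩ := h.exists_area_le
    exact ⟨R₁, hR₁, fun p hp => ⟨⟨h.le_areaU hp, (hR p hp).1⟩, h.le_areaV hp, (hR p hp).2⟩⟩
  · exact ⟨h.tendsto_extendFrom hg h.gaugeBound_areaU hp,
      h.tendsto_extendFrom hg h.gaugeBound_areaV hp⟩
  · exact (h.isHolder h.gaugeBound_kasnerU).congr fun p hp =>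
      SingularDevelopment.extendFrom_eq_self h.contDiffOn_kasnerU.continuousOn hp
  · exact (h.isLogHolder h.gaugeBound_scalarRemainder).congr fun p hp =>
      SingularDevelopment.extendFrom_eq_self h.continuousOn_scalarRemainder hp
  · exact h.continuousOn_extendFrom hg h.gaugeBound_kasnerU h.contDiffOn_kasnerU.continuousOn
  · exact h.continuousOn_extendFrom hlg h.gaugeBound_scalarRemainder h.continuousOn_scalarRemainder
  · intro p hp
    rw [SingularDevelopment.extendFrom_eq_self h.contDiffOn_kasnerU.continuousOn hp,
      SingularDevelopment.extendFrom_eq_self h.continuousOn_scalarRemainder hp, scalarRemainder]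
    ring
  · exact h.isLogHolder_mass.congr fun p hp => by
      rw [SingularDevelopment.extendFrom_eq_self h.continuousOn_logMass hp]
  · exact Real.continuous_exp.comp_continuousOn
      (h.continuousOn_extendFrom hlg h.gaugeBound_logMass h.continuousOn_logMass)
  · exact fun p _ => Real.exp_pos _
  · intro p hp
    beta_reduce
    rw [SingularDevelopment.extendFrom_eq_self h.contDiffOn_kasnerU.continuousOn hp,
      SingularDevelopment.extendFrom_eq_self h.continuousOn_logMass hp]
    exact h.mass_eq hp
  · intro p hp
    have hU := h.hasRate_areaU hp
    have hV := h.hasRate_areaV hp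
    have hP := h.hasRate_kasnerU hp
    obtain ⟨C₁, hC₁, b₁⟩ := id hU
    obtain ⟨C₂, hC₂, b₂⟩ := id hV
    obtain ⟨C₃, hC₃, b₃⟩ := h.hasRate_rpow_mul hU hP
    obtain ⟨C₄, hC₄, b₄⟩ := h.hasRate_rpow_mul hV (h.hasRate_kasnerV hp)
    obtain ⟨C₅, hC₅, b₅⟩ := h.hasRate_scalar hp
    obtain ⟨C₆, hC₆, b₆⟩ := h.exists_W_bound hp
    obtain ⟨C₇, hC₇, b₇⟩ := h.exists_hawkingMass_bound hp
    obtain ⟨C₈, hC₈, b₈⟩ := h.exists_kretschmann_bound hp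
    obtain ⟨C₉, hC₉, b₉⟩ := h.exists_gradSq_bound hp
    refine ⟨C₁ + C₂ + C₃ + C₄ + C₅ + C₆ + C₇ + C₈ + C₉ + 1, by positivity, fun q hq => ?_⟩
    have h0 := h.r_pos hq.1
    have hk : ∀ k : ℝ, 0 ≤ r q ^ k := fun k => Real.rpow_nonneg h0.le k
    have hl : ∀ k : ℝ, 0 ≤ r q ^ k * (1 + |Real.log (r q)|) := fun k =>
      mul_nonneg (hk k) (by positivity)
    have up : ∀ {C x y : ℝ}, 0 ≤ x → y ≤ C * x →
        C ≤ C₁ + C₂ + C₃ + C₄ + C₅ + C₆ + C₇ + C₈ + C₉ + 1 →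
        y ≤ (C₁ + C₂ + C₃ + C₄ + C₅ + C₆ + C₇ + C₈ + C₉ + 1) * x := fun hx hy hC =>
      hy.trans (mul_le_mul_of_nonneg_right hC hx)
    refine ⟨up (hk _) (b₁ q hq) (by linarith), up (hk _) (b₂ q hq) (by linarith),
      up (hk _) ?_ (?_ : C₃ ≤ _), up (hk _) ?_ (?_ : C₄ ≤ _), up (hl _) (b₅ q hq) (by linarith),
      up (hl _) (b₆ q hq) (by linarith), fun θ hθ ϕ => ⟨up (hl _) ?_ (?_ : C₇ ≤ _),
      up (hl _) ?_ (?_ : C₈ ≤ _), up (hl _) ?_ (?_ : C₉ ≤ _)⟩⟩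
    · have h1 := b₃ q hq
      have e : r q ^ 2 * du G.D φ q = areaU G.D r q * kasnerU G.D r φ q := by
        rw [h.du_φ hq.1]; field_simp
      rwa [e]
    · linarith
    · have h1 := b₄ q hq
      have e : r q ^ 2 * dv G.D φ q = areaV G.D r q * kasnerV G.D r φ q := by
        rw [h.dv_φ hq.1]; field_simp
      rwa [e]
    · linarith
    · rw [h.two_mul_hawkingMass hq.1 hθ]
      exact b₇ q hq
    · linarith
    · rw [h.kretschmann_eq_massAspect hq.1 hθ]
      exact b₈ q hq
    · linarith
    · rw [h.gradSq_scalar hq.1 hθ, ← sub_neg_eq_add]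
      exact b₉ q hq
    · linarith
  · intro q hq θ hθ ϕ
    exact tensorSq_maxwell Q (h.r_pos hq).ne' (h.W_pos hq).ne'
      (Real.sin_pos_of_pos_of_lt_pi hθ.1 hθ.2).ne'
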